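/- **Setting.** *Surface.* Let $\Omega\subset\mathbb R^3$ be a compact, simply connected Lipschitz polyhedron with $\partial\Omega=\bigcup_{i=1}^I\overline{F_i}$, where the patches $F_i$ are flat open quadrilaterals and two closed patches are disjoint or meet in exactly one common edge or one common vertex. Let $\tilde d\in\mathbb N$ and let $\kappa_i:[0,1]^2\to\overline{F_i}$ be $C^{\tilde d}$-diffeomorphisms, mapping the open square onto $F_i$. Put $\langle u,v\rangle=\sum_i\int_{[0,1]^2}(u\circ\kappa_i)\,\overline{(v\circ\kappa_i)}\,dx$. A function is patchwise smooth if it is continuous on $\partial\Omega$ and $C^\infty$ on every $\overline{F_i}$. At a vertex $\nu_n$ let $\Gamma^{n,t}$ be the infinite plane sectors tangent to the patches $F_{i(n,t)}$ meeting at $\nu_n$ (the faces of the tangent cone $\mathcal C_n$), with polar coordinates $r>0$, $0<\phi<\gamma_{n,t}$. *Weighted Sobolev spaces.* Fix non-negative patchwise smooth functions $\varphi_n$, one for each vertex, with $\sum_n\varphi_n=1$ on $\partial\Omega$, with $\varphi_n=1$ on $U_{n,0}$ and $\varphi_n=0$ on $\partial\Omega\setminus U_{n,1}$, where $\nu_n\in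 U_{n,0}\subsetneq U_{n,1}\subsetneq\partial\Omega$ are relatively open and, for some $C_1>0$: $\mathrm{dist}(U_{n,1},F_\ell)\ge C_1$ whenever $\nu_n\notin\overline{F_\ell}$; $\mathrm{dist}(U_{n,1}\cap\Gamma^{n,t},F_{i(n,t)}\setminus\Gamma^{n,t})\ge C_1$; and $U_{n,1}\cap\overline{F_{i(n,t)}}\subset\overline{\Gamma^{n,t}}$. For $k\in\mathbb N$ and $0\le\rho\le k$, $X^k_\rho(\partial\Omega)\subset L_2(\partial\Omega)$ is the closure of the patchwise smooth functions of finite norm with respect to $$\|u\|_{X^k_\rho}=\sum_n\Big(\|\varphi_nu\|_{L_2(\partial\mathcal C_n)}+\sum_t\sum_{1\le a+b\le k}\big\|r^{-\rho}(1+r)^\rho(qr)^{a}\partial_r^{a}\,q^{b-\rho}\partial_\phi^{b}(\varphi_nu)\big\|_{L_2(\Gamma^{n,t})}\Big),\qquad q=\min\{\phi,\gamma_{n,t}-\phi\},$$ where $\varphi_nu$ is extended by $0$ to $\partial\mathcal C_n$. *Sobolev spaces.* $H^0(\partial\Omega)=L_2(\partial\Omega)$; for $0<s<1$, $H^s(\partial\Omega)$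 is the Sobolev–Slobodeckij space on $\partial\Omega$; for $1\le s<3/2$ it consists of the functions that belong to $H^s(F_i)$ on every patch and have matching traces across the edges (equivalently, that also belong to $H^{1/2}(\partial\Omega)$); for $-1/2<s<0$ it is defined by $L_2$-duality. *Wavelets.* Let $\Psi=(\Psi^{\partial\Omega},\tilde\Psi^{\partial\Omega})$ be a pair of $\langle\cdot,\cdot\rangle$-biorthogonal Riesz bases of $L_2(\partial\Omega)$, each consisting of finitely many generators together with wavelets $\psi_{j,\xi}$, respectively $\tilde\psi_{j,\xi}$, for $j\ge j^*$ and $\xi\in\nabla_j=\bigcup_i\nabla_j^{F_i}$. Let $P$ be the biorthogonal projector onto the span of the primal generators, and let $s_{\partial\Omega}\ge1$. Assume, with constants independent of $j$ and $\xi$: - (I) $\#\nabla_j^{F_i}\sim2^{2j}$, and the grid points belonging to $\nabla_j^{F_i}$ lie on $\overline{F_i}$; - (II) $\|\tilde\psi_{j,\xi}\|_{L_2}\sim1$; - (III) $\operatorname{supp}\tilde\psi_{j,\xi}\subset\partial\Omega$ is compact, contains its grid point, has area $\sim2^{-2j}$ and diameter $\lesssim2^{-j}$; - (IV) if $\operatorname{supp}\tilde\psi_{j,\xi}\subset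 F_i$, then $\tilde\psi_{j,\xi}\circ\kappa_i$ is $L_2([0,1]^2)$-orthogonal to all polynomials of total degree $<\tilde d$; - (V) the number of $\xi\in\nabla_j$ with $0<\mathrm{dist}(\operatorname{supp}\tilde\psi_{j,\xi},\bigcup_i\partial F_i)\le b2^{-j}$ is $\lesssim2^j$ for every $b>0$ and $\gtrsim2^j$ for some $b>0$, and the number of those whose support meets $\bigcup_i\partial F_i$ is $\lesssim2^j$; - (VI) every $x\in\partial\Omega$ lies in at most a bounded number of the supports on each level; - (VII) for all $-1/2<s<\min\{3/2,s_{\partial\Omega}\}$ and all $u\in L_2(\partial\Omega)$, $\|u\|_{H^s(\partial\Omega)}\sim\|Pu\|_{L_2}+\big(\sum_{j\ge j^*}\sum_{\xi\in\nabla_j}2^{2sj}|\langle u,\tilde\psi_{j,\xi}\rangle|^2\big)^{1/2}$. *Besov-type spaces.* A tuple $(\alpha,p,q)$ is admissible if $\frac12\le\frac1p\le\frac\alpha2+\frac12$ and $0<q\le\infty$, with $q\le2$ if $\frac1p=\frac\alpha2+\frac12$. Then $B^\alpha_{\Psi,q}(L_p(\partial\Omega))$ is the set of all $u\in L_2(\partial\Omega)$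 for which $$\|Pu\|_{L_p(\partial\Omega)}+\Big(\sum_{j\ge j^*}2^{j(\alpha+2[\frac12-\frac1p])q}\Big[\sum_{\xi\in\nabla_j}|\langle u,\tilde\psi_{j,\xi}\rangle|^p\Big]^{q/p}\Big)^{1/q}$$ is finite (with the usual modification if $q=\infty$). *Best $n$-term approximation.* $\sigma_n(u;\Psi^{\partial\Omega},H^{s'})$ is the infimum of $\|u-\sum_{m=1}^nc_mf_m\|_{H^{s'}(\partial\Omega)}$ over all $c_m\in\mathbb C$ and all $f_1,\dots,f_n$ among the primal generators and wavelets. **Theorem.** Let $k\in\{1,\dots,\tilde d\}$, $\rho\in(0,k)$, and let $(s,p,p)$ be admissible with $s>0$. Let $S$ be an operator acting on functions on $\partial\Omega$ and let $u$ be a solution of $S(u)=g$ on $\partial\Omega$ with $u\in B^s_{\Psi,p}(L_p(\partial\Omega))\cap X^k_\rho(\partial\Omega)$. Put $$\alpha^*=\min\Big\{\rho,\;k-\rho,\;s-\Big(\frac1p-\frac12\Big)\Big\}.$$ Then $u\in B^\alpha_{\Psi,\tau}(L_\tau(\partial\Omega))$ for all (automatically admissible) tuples $(\alpha,\tau,\tau)$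 with $\frac1\tau=\frac\alpha2+\frac12$ and $0\le\alpha<2\alpha^*$. Moreover, for every $0\le s'<\min\{3/2,s_{\partial\Omega}\}$ with $s-s'\ge2\big(\frac1p-\frac12\big)$, setting (with $0/0:=0$) $$\Theta=1-\frac{s'}{s-2(1/p-1/2)},\qquad \gamma^*=s-s'+\Theta\,(2\alpha^*-s),$$ we have $\Theta\in[0,1]$, $\gamma^*\ge0$, and for every $\gamma<\gamma^*$ there is a constant $C$ such that $\sigma_n(u;\Psi^{\partial\Omega},H^{s'}(\partial\Omega))\le C\,n^{-\gamma/2}$ for all $n\in\mathbb N$. -/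

import Mathlib

open MeasureTheory Set Filter Topology
open scoped ENNReal NNReal ContDiff

noncomputable section

/-- The Euclidean plane. -/
abbrev E2 := EuclideanSpace ℝ (Fin 2)

/-- Euclidean three-space. -/
abbrev E3 := EuclideanSpace ℝ (Fin 3)

/-! ### Polyhedra with flat quadrilateral sides -/

/-- The closed unit square. -/
def closedSquare : Set E2 := {x | ∀ l, x l ∈ Icc (0 : ℝ) 1}

/-- The open unit square. -/
def openSquare : Set E2 := {x | ∀ l, x l ∈ Ioo (0 : ℝ) 1}

/-- The point with polar coordinates `(r, φ)` with respect to the centre `v` and the initial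
direction `(cos θ, sin θ)`. -/
def polarPoint (v : E2) (θ r φ : ℝ) : E2 :=
  v + r • !₂[Real.cos (θ + φ), Real.sin (θ + φ)]

/-- A flat open quadrilateral patch in `ℝ³` together with a `C^m` diffeomorphic parametrization
over the unit square.  The plane of the patch carries Cartesian coordinates `frame`, in which the
patch is the open bounded planar set `dom`. -/
structure QuadPatch (m : ℕ) where
  /-- Cartesian coordinates in the affine plane that contains the patch. -/
  frame : E2 →ᵃⁱ[ℝ] E3
  /-- The patch in these coordinates. -/
  dom : Set E2
  /-- The four corners in cyclic order. -/
  corner : Fin 4 → E2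
  corner_injective : Function.Injective corner
  adjacent_edges : ∀ k, segment ℝ (corner k) (corner (k + 1)) ∩
    segment ℝ (corner (k + 1)) (corner (k + 2)) = {corner (k + 1)}
  opposite_edges : ∀ k, Disjoint (segment ℝ (corner k) (corner (k + 1)))
    (segment ℝ (corner (k + 2)) (corner (k + 3)))
  dom_nonempty : dom.Nonempty
  dom_open : IsOpen dom
  dom_bounded : Bornology.IsBounded dom
  dom_frontier : frontier dom = ⋃ k, segment ℝ (corner k) (corner (k + 1))
  /-- Direction angle of the first side of the interior angle at a corner. -/
  theta : Fin 4 → ℝ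
  /-- The interior angle at a corner. -/
  angle : Fin 4 → ℝ
  angle_mem : ∀ k, angle k ∈ Ioo 0 (2 * Real.pi)
  /-- Near each corner the patch is the plane sector described by `theta` and `angle`. -/
  local_sector : ∀ k, ∃ ε > 0, dom ∩ Metric.ball (corner k) ε =
    {y | ∃ r ∈ Ioo 0 ε, ∃ φ ∈ Ioo 0 (angle k), y = polarPoint (corner k) (theta k) r φ}
  /-- The parametrization over the unit square, in planar coordinates. -/
  param : E2 → E2
  param_closed : BijOn param closedSquare (closure dom)
  param_open : BijOn param openSquare dom
  param_smooth : ContDiffOn ℝ m param closedSquare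
  param_inv_smooth : ∃ inv : E2 → E2, ContDiffOn ℝ m inv (closure dom) ∧
    LeftInvOn inv param closedSquare

namespace QuadPatch

variable {m : ℕ} (F : QuadPatch m)

/-- The open patch as a subset of `ℝ³`. -/
def face : Set E3 := F.frame '' F.dom

/-- The closed patch. -/
def closedFace : Set E3 := F.frame '' closure F.dom

/-- The relative boundary of the patch. -/
def rim : Set E3 := F.frame '' frontier F.dom

/-- The corners as points of `ℝ³`. -/
def vert (k : Fin 4) : E3 := F.frame (F.corner k)

/-- The edges. -/
def edge (k : Fin 4) : Set E3 := segment ℝ (F.vert k) (F.vert (k + 1))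

/-- The parametric lifting of the unit square to the closed patch. -/
def kappa (x : E2) : E3 := F.frame (F.param x)

/-- The infinite open plane sector in `ℝ³` that is tangent to the patch at its corner `k`. -/
def sector (k : Fin 4) : Set E3 :=
  {x | ∃ r > 0, ∃ φ ∈ Ioo 0 (F.angle k), x = F.frame (polarPoint (F.corner k) (F.theta k) r φ)}

end QuadPatch

/-- `Ω` is locally, in suitable Cartesian coordinates, the epigraph of a Lipschitz function. -/
def HasLipschitzBoundary (Ω : Set E3) : Prop :=
  ∀ x ∈ frontier Ω, ∃ T : E3 ≃ᵃⁱ[ℝ] E3, ∃ h : E2 → ℝ, ∃ K : ℝ≥0, LipschitzWith K h ∧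
    ∀ᶠ y in 𝓝 x, (y ∈ Ω ↔ h !₂[T y 0, T y 1] ≤ T y 2)

/-- A bounded, closed, simply connected Lipschitz polyhedron in `ℝ³` whose boundary is decomposed
into finitely many flat quadrilaterals; two closed patches are disjoint or meet in exactly one
common edge or in exactly one common vertex. -/
structure PolySurface (m : ℕ) where
  Ω : Set E3
  compact : IsCompact Ω
  simplyConnected : SimplyConnectedSpace Ω
  lipschitz : HasLipschitzBoundary Ω
  I : ℕ
  patch : Fin I → QuadPatch m
  boundary : frontier Ω = ⋃ i, (patch i).closedFace
  meet : ∀ i l, i ≠ l →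
    (patch i).closedFace ∩ (patch l).closedFace = ∅ ∨
    (∃ a b, (patch i).edge a = (patch l).edge b ∧
      (patch i).closedFace ∩ (patch l).closedFace = (patch i).edge a) ∨
    (∃ a b, (patch i).vert a = (patch l).vert b ∧
      (patch i).closedFace ∩ (patch l).closedFace = {(patch i).vert a})

/-! ### Sobolev (semi-)norms -/

/-- The squared Slobodeckij semi-norm of order `θ ∈ (0,1)` over a two-dimensional set. -/
def slobodeckijSq {X : Type*} [MeasurableSpace X] [PseudoEMetricSpace X]
    (μ : Measure X) (θ : ℝ) (f : X → ℂ) : ℝ≥0∞ :=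
  ∫⁻ x, ∫⁻ y, ‖f x - f y‖ₑ ^ 2 / edist x y ^ (2 + 2 * θ) ∂μ ∂μ

/-- `g` is the weak gradient of `f` in the open planar set `P`, with components in `L₂(P)`. -/
def IsWeakGrad (P : Set E2) (f : E2 → ℂ) (g : Fin 2 → E2 → ℂ) : Prop :=
  (∀ l, MemLp (g l) 2 (volume.restrict P)) ∧
  ∀ η : E2 → ℝ, ContDiff ℝ ∞ η → HasCompactSupport η → tsupport η ⊆ P → ∀ l,
    ∫ x in P, fderiv ℝ η x (EuclideanSpace.single l 1) • f x = - ∫ x in P, η x • g l x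

/-- The squared norm of the weak gradient of `f` in `W^θ(L₂(P))`, `0 ≤ θ < 1`; it is `∞` if there
is no square integrable weak gradient. -/
def gradNormSq (P : Set E2) (θ : ℝ) (f : E2 → ℂ) : ℝ≥0∞ :=
  ⨅ (g : Fin 2 → E2 → ℂ) (_ : IsWeakGrad P f g),
    ∑ l, ((∫⁻ x in P, ‖g l x‖ₑ ^ 2) +
      if θ = 0 then 0 else slobodeckijSq (volume.restrict P) θ (g l))

namespace PolySurface

variable {m : ℕ} (S : PolySurface m)

/-- The canonical surface measure. -/
def area : Measure E3 :=
  ∑ i, Measure.map (S.patch i).frame (volume.restrict (S.patch i).dom)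

/-- The union of all patch interfaces. -/
def interface : Set E3 := ⋃ i, (S.patch i).rim

open Classical in
/-- The finite set of vertices. -/
def verts : Finset E3 :=
  Finset.univ.image fun c : Fin S.I × Fin 4 => (S.patch c.1).vert c.2

open Classical in
/-- The corners (patch, number of the corner) located at the point `ν`.  If `ν` is a vertex, the
boundary of the tangent cone at `ν` is the union of the closures of the corresponding sectors. -/
def cornersAt (ν : E3) : Finset (Fin S.I × Fin 4) :=
  Finset.univ.filter fun c => (S.patch c.1).vert c.2 = ν

/-- Patchwise smooth functions: globally continuous on the surface, and smooth on every closed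
patch. Values off the surface are irrelevant. -/
def PwSmooth (u : E3 → ℂ) : Prop :=
  ContinuousOn u (frontier S.Ω) ∧
  ∀ i, ContDiffOn ℝ ∞ (u ∘ (S.patch i).frame) (closure (S.patch i).dom)

/-- The inner product of `u` and `v` that is defined through the parametric liftings. -/
def pairing (u v : E3 → ℂ) : ℂ :=
  ∑ i, ∫ x in closedSquare, u ((S.patch i).kappa x) * starRingEnd ℂ (v ((S.patch i).kappa x))

/-- The norm in `H^s(∂Ω)`, `0 ≤ s < 3/2`, with value `∞` off this space.  For `1 ≤ s < 3/2` the
space consists of all `u` in `H^{1/2}(∂Ω)` whose restriction to each patch `F` is in `H^s(F)`;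
for functions that are patchwise in `H¹`, being in `H^{1/2}(∂Ω)` means that the traces from both
sides of each edge coincide, that is, `u ∈ H¹(∂Ω)`. -/
def sobolevNormNonneg (s : ℝ) (u : E3 → ℂ) : ℝ≥0∞ :=
  ((∫⁻ x, ‖u x‖ₑ ^ 2 ∂S.area) +
    if s = 0 then 0
    else if s < 1 then slobodeckijSq S.area s u
    else slobodeckijSq S.area (1 / 2) u +
      ∑ i, gradNormSq (S.patch i).dom (s - 1) (u ∘ (S.patch i).frame)) ^ (1 / 2 : ℝ)

/-- The norm in `H^s(∂Ω)` for `s < 3/2`; for negative `s` by duality. -/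
def sobolevNorm (s : ℝ) (u : E3 → ℂ) : ℝ≥0∞ :=
  if 0 ≤ s then S.sobolevNormNonneg s u
  else ⨆ (v : E3 → ℂ) (_ : MemLp v 2 S.area ∧ S.sobolevNormNonneg (-s) v ≤ 1),
    ‖∫ x, u x * starRingEnd ℂ (v x) ∂S.area‖ₑ

/-! ### Weighted Sobolev spaces -/

/-- A special resolution of unity subordinate to the vertices. -/
structure SpecialResolution where
  /-- The function that belongs to the vertex `ν`. -/
  fn : E3 → E3 → ℝ
  U0 : E3 → Set E3
  U1 : E3 → Set E3
  C1 : ℝ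
  C1_pos : 0 < C1
  nonneg : ∀ ν ∈ S.verts, ∀ x ∈ frontier S.Ω, 0 ≤ fn ν x
  smooth : ∀ ν ∈ S.verts, S.PwSmooth fun x => (fn ν x : ℂ)
  sum_eq_one : ∀ x ∈ frontier S.Ω, ∑ ν ∈ S.verts, fn ν x = 1
  U0_open : ∀ ν ∈ S.verts, ∃ O, IsOpen O ∧ U0 ν = O ∩ frontier S.Ω
  U1_open : ∀ ν ∈ S.verts, ∃ O, IsOpen O ∧ U1 ν = O ∩ frontier S.Ω
  mem_U0 : ∀ ν ∈ S.verts, ν ∈ U0 ν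
  U0_ssubset : ∀ ν ∈ S.verts, U0 ν ⊂ U1 ν
  U1_ssubset : ∀ ν ∈ S.verts, U1 ν ⊂ frontier S.Ω
  /-- The larger neighbourhood stays away from all patches that do not touch the vertex. -/
  dist_other : ∀ ν ∈ S.verts, ∀ l, ν ∉ (S.patch l).closedFace →
    ∀ x ∈ U1 ν, ∀ y ∈ (S.patch l).face, C1 ≤ dist x y
  /-- Within a sector at the vertex, the larger neighbourhood stays away from the part of the
  patch outside of this sector. -/
  dist_outside : ∀ ν ∈ S.verts, ∀ c ∈ S.cornersAt ν,
    ∀ x ∈ U1 ν ∩ (S.patch c.1).sector c.2,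
    ∀ y ∈ (S.patch c.1).face \ (S.patch c.1).sector c.2, C1 ≤ dist x y
  /-- The larger neighbourhood is covered by the closed sectors at the vertex. -/
  covered : ∀ ν ∈ S.verts, ∀ c ∈ S.cornersAt ν,
    U1 ν ∩ (S.patch c.1).closedFace ⊆ closure ((S.patch c.1).sector c.2)
  eq_one : ∀ ν ∈ S.verts, ∀ x ∈ U0 ν, fn ν x = 1
  eq_zero : ∀ ν ∈ S.verts, ∀ x ∈ frontier S.Ω \ U1 ν, fn ν x = 0

end PolySurface

/-- The norm in `L₂` of the infinite plane sector with opening angle `γ` of a function that is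
given in polar coordinates. -/
def sectorL2 (γ : ℝ) (f : ℝ → ℝ → ℂ) : ℝ≥0∞ :=
  (∫⁻ z in Ioi (0 : ℝ) ×ˢ Ioo (0 : ℝ) γ, ‖f z.1 z.2‖ₑ ^ 2 * ENNReal.ofReal z.1) ^ (1 / 2 : ℝ)

/-- The weighted mixed derivative
`r^{-μ} (1+r)^μ (q r)^a (∂/∂r)^a q^{b-ρ} (∂/∂φ)^b f`, where `q = min {φ, γ - φ}`. -/
def weightedDeriv (γ ρ μ : ℝ) (a b : ℕ) (f : ℝ → ℝ → ℂ) (r φ : ℝ) : ℂ :=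
  ((r ^ (-μ) * (1 + r) ^ μ * (min φ (γ - φ) * r) ^ a * min φ (γ - φ) ^ ((b : ℝ) - ρ) : ℝ) : ℂ) *
    iteratedDeriv a (fun r' => iteratedDeriv b (fun φ' => f r' φ') φ) r

namespace PolySurface

variable {m : ℕ} (S : PolySurface m)

/-- The norm in `X^k_{ρ,μ}` over the boundary of the tangent cone at the vertex `ν` of a facewise
smooth function, given in polar coordinates on every sector at `ν`. -/
def coneNorm (k : ℕ) (ρ μ : ℝ) (ν : E3) (f : Fin S.I × Fin 4 → ℝ → ℝ → ℂ) : ℝ≥0∞ :=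
  (∑ c ∈ S.cornersAt ν, sectorL2 ((S.patch c.1).angle c.2) (f c) ^ 2) ^ (1 / 2 : ℝ) +
  ∑ c ∈ S.cornersAt ν,
    ∑ β ∈ (Finset.range (k + 1) ×ˢ Finset.range (k + 1)).filter
        (fun β => 1 ≤ β.1 + β.2 ∧ β.1 + β.2 ≤ k),
      sectorL2 ((S.patch c.1).angle c.2)
        (weightedDeriv ((S.patch c.1).angle c.2) ρ μ β.1 β.2 (f c))

namespace SpecialResolution

variable {S} (R : S.SpecialResolution)

/-- The product of `u` with the localizing function of the vertex `ν`, in polar coordinates on the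
sector at the corner `c`; it is zero on the part of the sector outside of the patch. -/
def localized (u : E3 → ℂ) (ν : E3) (c : Fin S.I × Fin 4) (r φ : ℝ) : ℂ :=
  (closure (S.patch c.1).dom).indicator
    (fun y => (R.fn ν ((S.patch c.1).frame y) : ℂ) * u ((S.patch c.1).frame y))
    (polarPoint ((S.patch c.1).corner c.2) ((S.patch c.1).theta c.2) r φ)

/-- The norm in `X^k_ρ(∂Ω)` of a patchwise smooth function. -/
def weightedNorm (k : ℕ) (ρ : ℝ) (u : E3 → ℂ) : ℝ≥0∞ :=
  ∑ ν ∈ S.verts, S.coneNorm k ρ ρ ν (R.localized u ν)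

/-- The weighted Sobolev space `X^k_ρ(∂Ω)`: the closure of the patchwise smooth functions (of
finite norm) with respect to the weighted norm, realized in `L₂(∂Ω)`. -/
def weightedSobolev (k : ℕ) (ρ : ℝ) : Set (E3 → ℂ) :=
  {u | MemLp u 2 S.area ∧ ∃ w : ℕ → E3 → ℂ,
    (∀ n, S.PwSmooth (w n) ∧ R.weightedNorm k ρ (w n) < ⊤) ∧
    (∀ ε : ℝ≥0∞, 0 < ε → ∃ N, ∀ n ≥ N, ∀ n' ≥ N, R.weightedNorm k ρ (w n - w n') < ε) ∧
    Tendsto (fun n => eLpNorm (w n - u) 2 S.area) atTop (𝓝 0)}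

end SpecialResolution

/-! ### Wavelet bases -/

/-- The data of a wavelet system on the surface: a coarsest level, a finite set of generators, and
wavelets that are indexed by their level and by (types of) grid points, grouped by patches. -/
structure WaveletSystem where
  jstar : ℕ
  /-- Indices of generators. -/
  Gen : Type
  genFintype : Fintype Gen
  /-- Grid points together with a type. -/
  Grid : Type
  /-- The location of a grid point. -/
  point : Grid → E3
  /-- The grid points of a level that belong to a patch. -/
  nabla : ℕ → Fin S.I → Finset Grid
  gen : Gen → E3 → ℂ
  genDual : Gen → E3 → ℂ
  psi : ℕ → Grid → E3 → ℂ
  psiDual : ℕ → Grid → E3 → ℂ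

end PolySurface

attribute [instance] PolySurface.WaveletSystem.genFintype

/-- `f` is a Riesz basis of the complex space `L₂(μ)`. -/
def IsRieszBasis (μ : Measure E3) {J : Type} (f : J → E3 → ℂ) : Prop :=
  (∀ i, MemLp (f i) 2 μ) ∧
  (∃ c C : ℝ, 0 < c ∧ 0 < C ∧ ∀ a : J →₀ ℂ,
    c * (a.sum fun _ z => ‖z‖ ^ 2) ≤ ∫ x, ‖a.sum fun i z => z * f i x‖ ^ 2 ∂μ ∧
    ∫ x, ‖a.sum fun i z => z * f i x‖ ^ 2 ∂μ ≤ C * (a.sum fun _ z => ‖z‖ ^ 2)) ∧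
  ∀ u, MemLp u 2 μ → ∀ ε : ℝ≥0∞, 0 < ε →
    ∃ a : J →₀ ℂ, eLpNorm (fun x => u x - a.sum fun i z => z * f i x) 2 μ < ε

/-- The distance between two sets. -/
def setDist (A B : Set E3) : ℝ≥0∞ := ⨅ (x ∈ A) (y ∈ B), edist x y

namespace PolySurface.WaveletSystem

variable {m : ℕ} {S : PolySurface m} (W : S.WaveletSystem)

open Classical in
/-- All grid points of a level. -/
def level (j : ℕ) : Finset W.Grid := Finset.univ.biUnion (W.nabla j)

/-- The indices of all generators and wavelets. -/
abbrev Idx : Type := W.Gen ⊕ {x : ℕ × W.Grid // W.jstar ≤ x.1 ∧ x.2 ∈ W.level x.1}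

/-- The system of generators and primal wavelets. -/
def primal : W.Idx → E3 → ℂ
  | Sum.inl g => W.gen g
  | Sum.inr x => W.psi x.1.1 x.1.2

/-- The system of dual generators and dual wavelets. -/
def dual : W.Idx → E3 → ℂ
  | Sum.inl g => W.genDual g
  | Sum.inr x => W.psiDual x.1.1 x.1.2

/-- The wavelet coefficients. -/
def coeff (u : E3 → ℂ) (j : ℕ) (ξ : W.Grid) : ℂ := S.pairing u (W.psiDual j ξ)

/-- The biorthogonal projector onto the span of the generators. -/
def proj (u : E3 → ℂ) : E3 → ℂ := fun x => ∑ g, S.pairing u (W.genDual g) * W.gen g x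

/-- The (quasi-)norm of the Besov-type space `B^α_{Ψ,q}(L_p(∂Ω))`. -/
def besovNorm (α p : ℝ) (q : ℝ≥0∞) (u : E3 → ℂ) : ℝ≥0∞ :=
  eLpNorm (W.proj u) (ENNReal.ofReal p) S.area +
  if q = ⊤ then
    ⨆ j : Ici W.jstar, (2 : ℝ≥0∞) ^ ((j : ℕ) * (α + 2 * (1 / 2 - 1 / p))) *
      (∑ ξ ∈ W.level j, ‖W.coeff u j ξ‖ₑ ^ p) ^ (1 / p)
  else
    (∑' j : Ici W.jstar, (2 : ℝ≥0∞) ^ ((j : ℕ) * (α + 2 * (1 / 2 - 1 / p)) * q.toReal) *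
      (∑ ξ ∈ W.level j, ‖W.coeff u j ξ‖ₑ ^ p) ^ (q.toReal / p)) ^ (1 / q.toReal)

/-- The Besov-type space `B^α_{Ψ,q}(L_p(∂Ω))`. -/
def besov (α p : ℝ) (q : ℝ≥0∞) : Set (E3 → ℂ) :=
  {u | MemLp u 2 S.area ∧ W.besovNorm α p q u < ⊤}

/-- The weighted sequence norm that is to characterize `H^s(∂Ω)`. -/
def sobolevSeqNorm (s : ℝ) (u : E3 → ℂ) : ℝ≥0∞ :=
  eLpNorm (W.proj u) 2 S.area +
  (∑' j : Ici W.jstar, ∑ ξ ∈ W.level j,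
    (2 : ℝ≥0∞) ^ (2 * s * (j : ℕ)) * ‖W.coeff u j ξ‖ₑ ^ 2) ^ (1 / 2 : ℝ)

/-- The requirements on a biorthogonal wavelet Riesz basis whose dual wavelets have vanishing
moments of order `d`, and which characterizes `H^s(∂Ω)` for `-1/2 < s < min {3/2, sΓ}`. -/
structure IsWaveletBasis (d : ℕ) (sΓ : ℝ) : Prop where
  riesz_primal : IsRieszBasis S.area W.primal
  riesz_dual : IsRieszBasis S.area W.dual
  biorthogonal_same : ∀ a, S.pairing (W.primal a) (W.dual a) = 1
  biorthogonal_diff : ∀ a b, a ≠ b → S.pairing (W.primal a) (W.dual b) = 0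
  /-- The grid points of a patch lie on it, and there are about `2^{2j}` of them. -/
  point_mem : ∀ j ≥ W.jstar, ∀ i, ∀ ξ ∈ W.nabla j i, W.point ξ ∈ (S.patch i).closedFace
  card_nabla : ∃ c C : ℝ, 0 < c ∧ 0 < C ∧ ∀ j ≥ W.jstar, ∀ i,
    c * 2 ^ (2 * j) ≤ (W.nabla j i).card ∧ ((W.nabla j i).card : ℝ) ≤ C * 2 ^ (2 * j)
  /-- The dual wavelets are normalized. -/
  normalized : ∃ c C : ℝ≥0, 0 < c ∧ 0 < C ∧ ∀ j ≥ W.jstar, ∀ ξ ∈ W.level j,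
    c ≤ eLpNorm (W.psiDual j ξ) 2 S.area ∧ eLpNorm (W.psiDual j ξ) 2 S.area ≤ C
  /-- The dual wavelets have compact supports on the surface, which contain their grid points, are
  localized at scale `2^{-j}`, and have an area of about `2^{-2j}`. -/
  supp_subset : ∀ j ≥ W.jstar, ∀ ξ ∈ W.level j, tsupport (W.psiDual j ξ) ⊆ frontier S.Ω
  point_mem_supp : ∀ j ≥ W.jstar, ∀ ξ ∈ W.level j, W.point ξ ∈ tsupport (W.psiDual j ξ)
  supp_diam : ∃ C : ℝ, 0 < C ∧ ∀ j ≥ W.jstar, ∀ ξ ∈ W.level j,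
    Metric.diam (tsupport (W.psiDual j ξ)) ≤ C * (2 ^ j)⁻¹
  supp_area : ∃ c C : ℝ, 0 < c ∧ 0 < C ∧ ∀ j ≥ W.jstar, ∀ ξ ∈ W.level j,
    ENNReal.ofReal (c * (2 ^ (2 * j))⁻¹) ≤ S.area (tsupport (W.psiDual j ξ)) ∧
    S.area (tsupport (W.psiDual j ξ)) ≤ ENNReal.ofReal (C * (2 ^ (2 * j))⁻¹)
  /-- Vanishing moments of the dual wavelets supported in the interior of a patch. -/
  vanishing : ∀ j ≥ W.jstar, ∀ ξ ∈ W.level j, ∀ i, tsupport (W.psiDual j ξ) ⊆ (S.patch i).face →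
    ∀ P : MvPolynomial (Fin 2) ℂ, P.totalDegree < d →
      ∫ x in closedSquare, MvPolynomial.eval (fun l => ((x l : ℝ) : ℂ)) P *
        starRingEnd ℂ (W.psiDual j ξ ((S.patch i).kappa x)) = 0
  /-- About `2^j` dual wavelets on level `j` have a positive distance of at most a multiple of
  `2^{-j}` to the patch interfaces. -/
  card_near_le : ∀ b : ℝ, 0 < b → ∃ C : ℝ, 0 < C ∧ ∀ j ≥ W.jstar,
    ({ξ | ξ ∈ W.level j ∧ 0 < setDist (tsupport (W.psiDual j ξ)) S.interface ∧
      setDist (tsupport (W.psiDual j ξ)) S.interface ≤ ENNReal.ofReal (b * (2 ^ j)⁻¹)}.ncard : ℝ)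
      ≤ C * 2 ^ j
  card_near_ge : ∃ b c : ℝ, 0 < b ∧ 0 < c ∧ ∀ j ≥ W.jstar,
    c * 2 ^ j ≤
    ({ξ | ξ ∈ W.level j ∧ 0 < setDist (tsupport (W.psiDual j ξ)) S.interface ∧
      setDist (tsupport (W.psiDual j ξ)) S.interface ≤ ENNReal.ofReal (b * (2 ^ j)⁻¹)}.ncard : ℝ)
  /-- At most about `2^j` dual wavelets on level `j` intersect the patch interfaces. -/
  card_crossing : ∃ C : ℝ, 0 < C ∧ ∀ j ≥ W.jstar,
    ({ξ | ξ ∈ W.level j ∧ (tsupport (W.psiDual j ξ) ∩ S.interface).Nonempty}.ncard : ℝ) ≤ C * 2 ^ j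
  /-- Uniformly finite overlap of the supports on each level. -/
  overlap : ∃ C : ℕ, ∀ j ≥ W.jstar, ∀ x ∈ frontier S.Ω,
    {ξ | ξ ∈ W.level j ∧ x ∈ tsupport (W.psiDual j ξ)}.ncard ≤ C
  /-- Characterization of Sobolev spaces by wavelet coefficients. -/
  sobolev_equiv : ∀ s : ℝ, -(1 / 2) < s → s < min (3 / 2) sΓ → ∃ c C : ℝ≥0, 0 < c ∧ 0 < C ∧
    ∀ u, MemLp u 2 S.area →
      c * W.sobolevSeqNorm s u ≤ S.sobolevNorm s u ∧ S.sobolevNorm s u ≤ C * W.sobolevSeqNorm s u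

end PolySurface.WaveletSystem

/-- Admissible tuples of parameters of Besov-type spaces. -/
def Admissible (α p : ℝ) (q : ℝ≥0∞) : Prop :=
  1 / 2 ≤ 1 / p ∧ 1 / p ≤ α / 2 + 1 / 2 ∧ 0 < q ∧ (1 / p = α / 2 + 1 / 2 → q ≤ 2)

/-- The error of the best `n`-term approximation to `f` with respect to a dictionary, measured in
a (quasi-)norm. -/
def bestNTerm {J : Type} (dict : J → E3 → ℂ) (norm : (E3 → ℂ) → ℝ≥0∞) (f : E3 → ℂ) (n : ℕ) :
    ℝ≥0∞ :=
  ⨅ (i : Fin n → J) (c : Fin n → ℂ), norm (fun x => f x - ∑ t, c t * dict (i t) x)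

end

noncomputable section

/-! ### Vanishing moments and Taylor's formula -/

/-! Everything reduces to summability of the wavelet coefficients `c_ξ` of `u`. On the line `1/τ =
α/2 + 1/2` the Besov-type norm carries no level weight, so regularity means that the coefficients
lie in `ℓ_τ`. On each level `j` they are split according to whether the distance `δ_ξ` of the grid
point to the patch interfaces exceeds `B 2^{-j}`.

Far from the interfaces the dual wavelet lives in a single flat patch. Its vanishing moments bound
the coefficient by `2^{-jk}` times the `L₂` norm of the derivatives of order `k` of the lifted
function on a ball of radius about `2^{-j}` (`enorm_integral_mul_le_of_vanishing`,
`exists_interior_coeff_le`). The norm of `X^k_ρ` controls these: near a vertex a Cartesian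
derivative of order `l` costs `(r q)^{-l}` while the weights supply `(r q)^ρ`, and the distance `δ`
to the interfaces is at most a multiple of `r q` wherever the localizing function is active
(`min_le_radius_mul_angle`). Hence `δ^{k-ρ} |∇^l w|` is in `L₂` for `1 ≤ l ≤ k`
(`lintegral_weightedSq_le`). Bounded overlap then gives `∑ (δ_ξ^{k-ρ} 2^{jk} |c_ξ|)² ≤ M` with `M`
independent of `j`, and a limit argument carries this over to the closure
(`exists_interior_sum_le_of_mem_weightedSobolev`).

Hölder's inequality turns this into an `ℓ_τ` bound whose dual factor involves `∑ δ_ξ^{-β}` with `β =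
2(k-ρ)/α`. At most about `2^{2j}(t + 2^{-j})` grid points have `δ_ξ ≤ t`, so this sum is `≲
2^{j(1+β)}` provided that `β > 1`, that is `α < 2(k-ρ)`. The level contributes `≲ 2^{-jτ(ρ-α/2)}`,
which is summable for `α < 2ρ`. Near the interfaces there are only about `2^j` wavelets. Hölder's
inequality against the `ℓ_p` bound contained in the Besov assumption gives a geometric series for `α
< 2(s-(1/p-1/2))`. These are the three terms of `α*` (`tsum_coeff_lt_top_of_lt`). If `τ ≥ p`, the
inclusion of `ℓ_p` in `ℓ_τ` suffices.

For the `n`-term approximation, interpolation between the weighted `ℓ_p` and the unweighted `ℓ_τ`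
bound puts `2^{s'j} c_ξ` into `ℓ_μ` with `1/μ = (1-Θ)/p + Θ/τ` (`tsum_interpolated_lt_top`). Keeping
the generators and the largest weighted coefficients, Stechkin's estimate and the wavelet
characterization of `H^{s'}` yield the rate `n^{1/2-1/μ}` (`exists_bestNTerm_le`); letting `α`
approach `2α*` gives every `γ < γ*`. -/

theorem E2_eq_sum_single (x : E2) :
    x = ∑ l : Fin 2, x l • EuclideanSpace.single l (1 : ℝ) := by
  ext l; fin_cases l <;> simp

/-- Expanding every argument in the standard basis leaves products of `i` coordinates of `x - y`.
This brings Taylor polynomials into the form in which the vanishing moments are stated. -/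
theorem exists_mvPolynomial_eval_eq_multilinear {i : ℕ}
    (M : ContinuousMultilinearMap ℝ (fun _ : Fin i => E2) ℂ) (y : E2) :
    ∃ P : MvPolynomial (Fin 2) ℂ, P.totalDegree ≤ i ∧
      ∀ x : E2, MvPolynomial.eval (fun l => ((x l : ℝ) : ℂ)) P = M fun _ => x - y := by
  classical
  refine ⟨∑ σ : Fin i → Fin 2, MvPolynomial.C (M fun t => EuclideanSpace.single (σ t) (1 : ℝ)) *
    ∏ t, (MvPolynomial.X (σ t) - MvPolynomial.C ((y (σ t) : ℝ) : ℂ)), ?_, fun x => ?_⟩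
  · refine MvPolynomial.totalDegree_finsetSum_le fun σ _ => ?_
    refine (MvPolynomial.totalDegree_mul _ _).trans ?_
    rw [MvPolynomial.totalDegree_C, zero_add]
    refine (MvPolynomial.totalDegree_finsetProd _ _).trans ?_
    calc ∑ t : Fin i, (MvPolynomial.X (σ t) - MvPolynomial.C ((y (σ t) : ℝ) : ℂ)).totalDegree
        ≤ ∑ _t : Fin i, 1 := by
          refine Finset.sum_le_sum fun t _ => (MvPolynomial.totalDegree_sub_C_le _ _).trans ?_
          simp
      _ = i := by simp
  · have h : (fun _ : Fin i => x - y) = fun _ : Fin i =>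
        ∑ l : Fin 2, (x - y) l • EuclideanSpace.single l (1 : ℝ) := by
      funext _; exact E2_eq_sum_single _
    rw [h, ← ContinuousMultilinearMap.coe_coe, MultilinearMap.map_sum]
    simp only [map_sum, map_mul, map_prod, map_sub, MvPolynomial.eval_C, MvPolynomial.eval_X]
    refine Finset.sum_congr rfl fun σ _ => ?_
    have := MultilinearMap.map_smul_univ M.toMultilinearMap (fun t => (x - y) (σ t))
      (fun t => EuclideanSpace.single (σ t) (1 : ℝ))
    rw [this]
    simp [Complex.real_smul, mul_comm]

/-- In the plane the Jacobian factor is `t⁻²`, and it is at most `4` when `t ≥ 1/2`. -/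
theorem lintegral_comp_add_smul_le {G : E2 → ℝ≥0∞} (hG : Measurable G) {t : ℝ} (ht : 1 / 2 ≤ t)
    (c : E2) : ∫⁻ x, G (c + t • x) ≤ 4 * ∫⁻ x, G x := by
  have ht0 : t ≠ 0 := by positivity
  have h1 : ∫⁻ x, G (c + t • x) = ∫⁻ x, G (c + x) ∂(Measure.map (t • ·) (volume : Measure E2)) := by
    rw [lintegral_map (by fun_prop) (by fun_prop)]
  rw [h1, Measure.map_addHaar_smul _ ht0, lintegral_smul_measure,
    lintegral_add_left_eq_self (fun x => G x) c]
  rw [smul_eq_mul]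
  gcongr
  rw [show (4 : ℝ≥0∞) = ENNReal.ofReal 4 by simp]
  apply ENNReal.ofReal_le_ofReal
  rw [finrank_euclideanSpace_fin, abs_of_pos (by positivity), inv_le_comm₀ (by positivity) (by norm_num)]
  nlinarith

theorem lintegral_mul_sq_le {α : Type*} [MeasurableSpace α] {μ : Measure α} {f g : α → ℝ≥0∞}
    (hf : AEMeasurable f μ) (hg : AEMeasurable g μ) :
    ∫⁻ x, f x * g x ∂μ ≤ (∫⁻ x, f x ^ 2 ∂μ) ^ (1 / 2 : ℝ) * (∫⁻ x, g x ^ 2 ∂μ) ^ (1 / 2 : ℝ) := by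
  simpa using ENNReal.lintegral_mul_le_Lp_mul_Lq μ Real.HolderConjugate.two_two hf hg

/-- The average of `‖f (y + t (x - y))‖ ‖ψ x‖` over `x, y ∈ D`. -/
theorem lintegral_lintegral_segment_le {D : Set E2}
    {G : E2 → ℝ≥0∞} (hG : Measurable G) {Ψ : E2 → ℝ≥0∞} (hΨ : Measurable Ψ) {t : ℝ} :
    ∫⁻ y in D, ∫⁻ x in D, G (y + t • (x - y)) * Ψ x ≤
      2 * volume D * (∫⁻ x, G x ^ 2) ^ (1 / 2 : ℝ) * (∫⁻ x in D, Ψ x ^ 2) ^ (1 / 2 : ℝ) := by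
  have h4 : (4 * ∫⁻ x, G x ^ 2) ^ (1 / 2 : ℝ) = 2 * (∫⁻ x, G x ^ 2) ^ (1 / 2 : ℝ) := by
    rw [ENNReal.mul_rpow_of_nonneg _ _ (by norm_num)]
    congr 1
    rw [show (4 : ℝ≥0∞) = 2 ^ (2 : ℝ) by norm_num, ← ENNReal.rpow_mul]; norm_num
  -- The point is `t x + (1 - t) y`, and one of the two weights is at least `1/2`. Substituting in
  -- the corresponding variable avoids a factor that blows up as `t` tends to `0` or `1`.
  have hG2 : Measurable fun x => G x ^ 2 := by fun_prop
  rcases le_total (1 / 2) t with ht | ht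
  · calc ∫⁻ y in D, ∫⁻ x in D, G (y + t • (x - y)) * Ψ x
        ≤ ∫⁻ y in D, (2 * (∫⁻ x, G x ^ 2) ^ (1 / 2 : ℝ)) *
            (∫⁻ x in D, Ψ x ^ 2) ^ (1 / 2 : ℝ) := by
          refine lintegral_mono fun y => (lintegral_mul_sq_le (by fun_prop) (by fun_prop)).trans ?_
          gcongr
          rw [← h4]
          gcongr
          calc ∫⁻ x in D, G (y + t • (x - y)) ^ 2 ≤ ∫⁻ x, G (y + t • (x - y)) ^ 2 :=
                setLIntegral_le_lintegral _ _
            _ = ∫⁻ x, (fun x => G x ^ 2) ((y - t • y) + t • x) := by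
                congr 1; funext x; congr 2; module
            _ ≤ _ := lintegral_comp_add_smul_le hG2 ht _
      _ = _ := by rw [setLIntegral_const]; ring
  · have hsw : ∫⁻ y in D, ∫⁻ x in D, G (y + t • (x - y)) * Ψ x =
        ∫⁻ x in D, ∫⁻ y in D, G (y + t • (x - y)) * Ψ x := by
      rw [lintegral_lintegral_swap]
      refine Measurable.aemeasurable ?_
      fun_prop
    rw [hsw]
    calc ∫⁻ x in D, ∫⁻ y in D, G (y + t • (x - y)) * Ψ x
        ≤ ∫⁻ x in D, (2 * (∫⁻ x, G x ^ 2) ^ (1 / 2 : ℝ)) * volume D ^ (1 / 2 : ℝ) * Ψ x := by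
          refine lintegral_mono fun x => ?_
          rw [lintegral_mul_const _ (by fun_prop)]
          gcongr
          calc ∫⁻ y in D, G (y + t • (x - y)) = ∫⁻ y in D, G (y + t • (x - y)) * 1 := by simp
            _ ≤ (∫⁻ y in D, G (y + t • (x - y)) ^ 2) ^ (1 / 2 : ℝ) *
                (∫⁻ _y in D, 1 ^ 2) ^ (1 / 2 : ℝ) :=
                lintegral_mul_sq_le (by fun_prop) (by fun_prop)
            _ ≤ _ := by
              rw [← h4]
              simp only [one_pow, setLIntegral_one]
              gcongr
              calc ∫⁻ y in D, G (y + t • (x - y)) ^ 2 ≤ ∫⁻ y, G (y + t • (x - y)) ^ 2 :=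
                    setLIntegral_le_lintegral _ _
                _ = ∫⁻ y, (fun x => G x ^ 2) (t • x + (1 - t) • y) := by
                    congr 1; funext x; congr 2; module
                _ ≤ _ := lintegral_comp_add_smul_le hG2 (by linarith) _
      _ = (2 * (∫⁻ x, G x ^ 2) ^ (1 / 2 : ℝ)) * volume D ^ (1 / 2 : ℝ) * ∫⁻ x in D, 1 * Ψ x := by
          rw [lintegral_const_mul _ hΨ]; simp
      _ ≤ (2 * (∫⁻ x, G x ^ 2) ^ (1 / 2 : ℝ)) * volume D ^ (1 / 2 : ℝ) *
          (volume D ^ (1 / 2 : ℝ) * (∫⁻ x in D, Ψ x ^ 2) ^ (1 / 2 : ℝ)) := by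
          gcongr
          refine (lintegral_mul_sq_le (by fun_prop) (by fun_prop)).trans_eq ?_
          simp
      _ = 2 * (volume D ^ (1 / 2 : ℝ) * volume D ^ (1 / 2 : ℝ)) * (∫⁻ x, G x ^ 2) ^ (1 / 2 : ℝ) *
          (∫⁻ x in D, Ψ x ^ 2) ^ (1 / 2 : ℝ) := by ring
      _ = _ := by
          rw [← ENNReal.rpow_add_of_nonneg _ _ (by norm_num) (by norm_num)]; norm_num

/-- Integral form of the remainder, with `(1 - t)^n / n!` estimated by one. The segment stays in `D`
by convexity, so the indicator costs nothing and allows the remainder to be integrated later over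
the whole plane. -/
theorem taylor_remainder_le {D : Set E2} (hc : Convex ℝ D) {R : ℝ}
    (hR : ∀ x ∈ D, ∀ y ∈ D, dist x y ≤ R) {n : ℕ} {f : E2 → ℂ} (hD : IsOpen D)
    (hf : ContDiffOn ℝ (n + 1 : ℕ) f D) {y : E2} (hy : y ∈ D) :
    ∃ P : MvPolynomial (Fin 2) ℂ, P.totalDegree < n + 1 ∧ ∀ x ∈ D,
      ‖f x - MvPolynomial.eval (fun l => ((x l : ℝ) : ℂ)) P‖ₑ ≤ ENNReal.ofReal R ^ (n + 1) *
        ∫⁻ t in Icc (0 : ℝ) 1,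
          D.indicator (fun z => ‖iteratedFDeriv ℝ (n + 1) f z‖ₑ) (y + t • (x - y)) := by
  choose Q hQ1 hQ2 using fun i => exists_mvPolynomial_eval_eq_multilinear (iteratedFDeriv ℝ i f y) y
  refine ⟨∑ i ∈ Finset.range (n + 1), MvPolynomial.C (((i.factorial : ℝ)⁻¹ : ℝ) : ℂ) * Q i, ?_,
    fun x hx => ?_⟩
  · refine (Nat.lt_succ_iff.2 (MvPolynomial.totalDegree_finsetSum_le fun i hi => ?_))
    refine (MvPolynomial.totalDegree_mul _ _).trans ?_
    rw [MvPolynomial.totalDegree_C, zero_add]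
    exact (hQ1 i).trans (by simpa [Nat.lt_succ_iff] using hi)
  · have hseg : ∀ t ∈ Icc (0 : ℝ) 1, y + t • (x - y) ∈ D := fun t ht =>
      hc.add_smul_sub_mem hy hx ht
    have hT := map_add_eq_sum_add_integral_iteratedFDeriv (f := f) (x := y) (y := x - y) (n := n)
      (fun t ht => by
        have := hf.contDiffAt (hD.mem_nhds (hseg t ht)); exact_mod_cast this)
    rw [add_sub_cancel] at hT
    have hev : MvPolynomial.eval (fun l => ((x l : ℝ) : ℂ))
        (∑ i ∈ Finset.range (n + 1), MvPolynomial.C (((i.factorial : ℝ)⁻¹ : ℝ) : ℂ) * Q i) =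
        ∑ k ∈ Finset.range (n + 1), (k.factorial : ℝ)⁻¹ •
          (iteratedFDeriv ℝ k f y fun _ => x - y) := by
      simp only [map_sum, map_mul, MvPolynomial.eval_C, hQ2, Complex.real_smul]
    rw [hev, hT, add_sub_cancel_left, enorm_smul, intervalIntegral.integral_of_le zero_le_one,
      ← integral_Icc_eq_integral_Ioc]
    calc _ ≤ 1 * ‖∫ t in Icc (0 : ℝ) 1, (1 - t) ^ n •
            iteratedFDeriv ℝ (n + 1) f (y + t • (x - y)) fun _ => x - y‖ₑ := by
          gcongr
          rw [← ofReal_norm, ← ENNReal.ofReal_one]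
          refine ENNReal.ofReal_le_ofReal ?_
          rw [norm_inv, Real.norm_natCast]
          exact inv_le_one_of_one_le₀ (by exact_mod_cast Nat.one_le_iff_ne_zero.2 n.factorial_ne_zero)
      _ ≤ ∫⁻ t in Icc (0 : ℝ) 1, ‖(1 - t) ^ n •
            iteratedFDeriv ℝ (n + 1) f (y + t • (x - y)) fun _ => x - y‖ₑ := by
          rw [one_mul]; exact enorm_integral_le_lintegral_enorm _
      _ ≤ ∫⁻ t in Icc (0 : ℝ) 1, ENNReal.ofReal R ^ (n + 1) *
            D.indicator (fun z => ‖iteratedFDeriv ℝ (n + 1) f z‖ₑ) (y + t • (x - y)) := by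
          refine setLIntegral_mono' measurableSet_Icc fun t ht => ?_
          rw [indicator_of_mem (hseg t ht)]
          rw [← ofReal_norm, ← ofReal_norm, ← ENNReal.ofReal_pow
            (dist_nonneg.trans (hR x hx y hy)), ← ENNReal.ofReal_mul (pow_nonneg
            (dist_nonneg.trans (hR x hx y hy)) _)]
          refine ENNReal.ofReal_le_ofReal ?_
          rw [norm_smul]
          have h1 : ‖(1 - t) ^ n‖ ≤ 1 := by
            rw [norm_pow]
            refine pow_le_one₀ (norm_nonneg _) ?_
            rw [Real.norm_eq_abs, abs_le]; constructor <;> linarith [ht.1, ht.2]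
          have h2 := (iteratedFDeriv ℝ (n + 1) f (y + t • (x - y))).le_opNorm fun _ => x - y
          have h3 : ∏ _i : Fin (n + 1), ‖x - y‖ ≤ R ^ (n + 1) := by
            simp only [Finset.prod_const, Finset.card_univ, Fintype.card_fin]
            gcongr
            rw [← dist_eq_norm]; exact hR x hx y hy
          calc _ ≤ 1 * (‖iteratedFDeriv ℝ (n + 1) f (y + t • (x - y))‖ * R ^ (n + 1)) := by
                gcongr
                exact h2.trans (by gcongr)
            _ = _ := by ring
      _ = _ := lintegral_const_mul' _ _ (by finiteness)

/-- A function with vanishing moments of order `n + 1` picks up the derivatives of order `n + 1`. -/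
theorem enorm_integral_mul_le_of_vanishing {D : Set E2} (hD : IsOpen D) (hc : Convex ℝ D)
    (hne : D.Nonempty) {R : ℝ} (hR : ∀ x ∈ D, ∀ y ∈ D, dist x y ≤ R) {n : ℕ} {f : E2 → ℂ}
    (hf : ContDiffOn ℝ (n + 1 : ℕ) f D) {ψ : E2 → ℂ} (hψ : MemLp ψ 2 (volume.restrict D))
    (hfψ : IntegrableOn (fun x => f x * ψ x) D)
    (hvan : ∀ P : MvPolynomial (Fin 2) ℂ, P.totalDegree < n + 1 →
      ∫ x in D, MvPolynomial.eval (fun l => ((x l : ℝ) : ℂ)) P * ψ x = 0) :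
    ‖∫ x in D, f x * ψ x‖ₑ ≤ 2 * ENNReal.ofReal R ^ (n + 1) *
      (∫⁻ x in D, ‖iteratedFDeriv ℝ (n + 1) f x‖ₑ ^ 2) ^ (1 / 2 : ℝ) *
      (∫⁻ x in D, ‖ψ x‖ₑ ^ 2) ^ (1 / 2 : ℝ) := by
  have hbdd : Bornology.IsBounded D := Metric.isBounded_iff.2 ⟨R, fun x hx y hy => hR x hx y hy⟩
  have hvol : volume D ≠ ⊤ := hbdd.measure_lt_top.ne
  have hvol0 : volume D ≠ 0 := (hD.measure_pos volume hne).ne'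
  have : IsFiniteMeasure (volume.restrict D) := ⟨by simpa using hvol.lt_top⟩
  set G : E2 → ℝ≥0∞ := D.indicator fun z => ‖iteratedFDeriv ℝ (n + 1) f z‖ₑ with hGdef
  have hG : Measurable G := by
    classical
    have hco : ContinuousOn (fun z => ‖iteratedFDeriv ℝ (n + 1) f z‖ₑ) D := by
      refine ContinuousOn.enorm ?_
      refine (hf.continuousOn_iteratedFDerivWithin le_rfl hD.uniqueDiffOn).congr fun z hz => ?_
      exact (iteratedFDerivWithin_of_isOpen (n + 1) hD hz).symm
    have := hco.measurable_piecewise (g := (0 : E2 → ℝ≥0∞)) continuousOn_const hD.measurableSet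
    rwa [Set.piecewise_eq_indicator] at this
  have hGint : ∫⁻ x, G x ^ 2 = ∫⁻ x in D, ‖iteratedFDeriv ℝ (n + 1) f x‖ₑ ^ 2 := by
    rw [← lintegral_indicator hD.measurableSet]
    congr 1; funext x
    by_cases hx : x ∈ D <;> simp [G, hx]
  obtain ⟨ψ', hψ'm, hψ'⟩ := hψ.aestronglyMeasurable.aemeasurable
  set Ψ : E2 → ℝ≥0∞ := fun x => ‖ψ' x‖ₑ with hΨdef
  have hΨ : Measurable Ψ := by fun_prop
  have hΨint : ∫⁻ x in D, Ψ x ^ 2 = ∫⁻ x in D, ‖ψ x‖ₑ ^ 2 :=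
    lintegral_congr_ae (hψ'.mono fun x hx => by simp [Ψ, hx])
  -- The left side does not depend on the expansion point `y`, so the Taylor polynomial may be taken
  -- at any point of `D`.
  have hpoint : ∀ y ∈ D, ‖∫ x in D, f x * ψ x‖ₑ ≤ ENNReal.ofReal R ^ (n + 1) *
      ∫⁻ x in D, ∫⁻ t in Icc (0 : ℝ) 1, G (y + t • (x - y)) * Ψ x := by
    intro y hy
    obtain ⟨P, hP1, hP2⟩ := taylor_remainder_le hc hR hD hf hy
    have hPψ : IntegrableOn (fun x => MvPolynomial.eval (fun l => ((x l : ℝ) : ℂ)) P * ψ x) D := by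
      have hψ1 : Integrable ψ (volume.restrict D) := hψ.integrable (by norm_num)
      have hcont : Continuous fun x : E2 => MvPolynomial.eval (fun l => ((x l : ℝ) : ℂ)) P := by
        refine P.continuous_eval.comp ?_
        fun_prop
      obtain ⟨B, hB⟩ := (hbdd.isCompact_closure.exists_bound_of_continuousOn hcont.continuousOn)
      refine hψ1.bdd_mul (c := B) hcont.aestronglyMeasurable ?_
      filter_upwards [ae_restrict_mem hD.measurableSet] with x hx
      exact hB x (subset_closure hx)
    have heq : ∫ x in D, f x * ψ x =
        ∫ x in D, (f x - MvPolynomial.eval (fun l => ((x l : ℝ) : ℂ)) P) * ψ x := by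
      simp_rw [sub_mul]
      rw [integral_sub hfψ hPψ, hvan P hP1, sub_zero]
    rw [heq]
    refine (enorm_integral_le_lintegral_enorm _).trans ?_
    rw [← lintegral_const_mul' _ _ (by finiteness)]
    refine lintegral_mono_ae ?_
    filter_upwards [ae_restrict_mem hD.measurableSet, hψ'] with x hx hx'
    rw [enorm_mul, hx', lintegral_mul_const' _ _ (by simp [Ψ]), ← mul_assoc]
    gcongr
    exact hP2 x hx
  -- Integrating over all expansion points converts the pointwise remainder into an `L₂` norm; the
  -- factor `volume D` appears on both sides and cancels.
  have key : ‖∫ x in D, f x * ψ x‖ₑ * volume D ≤ ENNReal.ofReal R ^ (n + 1) *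
      (2 * volume D * (∫⁻ x, G x ^ 2) ^ (1 / 2 : ℝ) * (∫⁻ x in D, Ψ x ^ 2) ^ (1 / 2 : ℝ)) := by
    calc ‖∫ x in D, f x * ψ x‖ₑ * volume D = ∫⁻ _y in D, ‖∫ x in D, f x * ψ x‖ₑ := by
          rw [setLIntegral_const]
      _ ≤ ∫⁻ y in D, ENNReal.ofReal R ^ (n + 1) *
            ∫⁻ x in D, ∫⁻ t in Icc (0 : ℝ) 1, G (y + t • (x - y)) * Ψ x :=
          setLIntegral_mono' hD.measurableSet hpoint
      _ = ENNReal.ofReal R ^ (n + 1) *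
            ∫⁻ y in D, ∫⁻ x in D, ∫⁻ t in Icc (0 : ℝ) 1, G (y + t • (x - y)) * Ψ x :=
          lintegral_const_mul' _ _ (by finiteness)
      _ = ENNReal.ofReal R ^ (n + 1) *
            ∫⁻ t in Icc (0 : ℝ) 1, ∫⁻ y in D, ∫⁻ x in D, G (y + t • (x - y)) * Ψ x := by
          congr 1
          rw [lintegral_lintegral_swap (μ := volume.restrict (Icc (0 : ℝ) 1))
            (ν := volume.restrict D)
            (f := fun t y => ∫⁻ x in D, G (y + t • (x - y)) * Ψ x)]
          · refine lintegral_congr fun y => ?_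
            rw [lintegral_lintegral_swap]
            refine Measurable.aemeasurable ?_
            fun_prop
          · refine Measurable.aemeasurable ?_
            refine Measurable.lintegral_prod_right' (f := fun q : (ℝ × E2) × E2 =>
              G (q.1.2 + q.1.1 • (q.2 - q.1.2)) * Ψ q.2) ?_
            fun_prop
      _ ≤ ENNReal.ofReal R ^ (n + 1) * ∫⁻ _t in Icc (0 : ℝ) 1,
            2 * volume D * (∫⁻ x, G x ^ 2) ^ (1 / 2 : ℝ) * (∫⁻ x in D, Ψ x ^ 2) ^ (1 / 2 : ℝ) := by
          gcongr with t
          exact lintegral_lintegral_segment_le hG hΨ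
      _ = _ := by rw [setLIntegral_const]; simp
  rw [hGint, hΨint] at key
  rw [← ENNReal.mul_le_mul_iff_left hvol0 hvol]
  refine key.trans_eq ?_
  ring

/-! ### Derivatives of compositions -/

section Composition

variable {E F G : Type*} [NormedAddCommGroup E] [NormedSpace ℝ E] [NormedAddCommGroup F]
  [NormedSpace ℝ F] [NormedAddCommGroup G] [NormedSpace ℝ G]

theorem iteratedFDeriv_sub_const_of_pos (f : E → F) (c : F) {n : ℕ} (hn : 1 ≤ n) :
    iteratedFDeriv ℝ n (fun x => f x - c) = iteratedFDeriv ℝ n f := by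
  obtain ⟨m, rfl⟩ := Nat.exists_eq_add_of_le' hn
  funext x
  have : fderiv ℝ (fun x => f x - c) = fderiv ℝ f := by funext y; exact fderiv_sub_const c
  rw [iteratedFDeriv_succ_eq_comp_right, iteratedFDeriv_succ_eq_comp_right, this]

/-- A bound of the derivatives of a composition which does not involve the values. -/
theorem norm_iteratedFDeriv_comp_le_of_isOpen {g : F → G} {f : E → F} {n : ℕ} (hn : 1 ≤ n)
    {s : Set E} {t : Set F} (hs : IsOpen s) (ht : IsOpen t) (hg : ContDiffOn ℝ n g t)
    (hf : ContDiffOn ℝ n f s) (hst : MapsTo f s t) {x : E} (hx : x ∈ s) {C D : ℝ}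
    (hC : ∀ i, 1 ≤ i → i ≤ n → ‖iteratedFDeriv ℝ i g (f x)‖ ≤ C)
    (hD : ∀ i, 1 ≤ i → i ≤ n → ‖iteratedFDeriv ℝ i f x‖ ≤ D ^ i) :
    ‖iteratedFDeriv ℝ n (g ∘ f) x‖ ≤ n.factorial * C * D ^ n := by
  -- Subtracting the constant `g (f x)` makes the term of order zero vanish without changing the
  -- derivatives of positive order.
  have h := norm_iteratedFDerivWithin_comp_le (g := fun y => g y - g (f x)) (f := f) (n := n)
    (N := n) (C := C) (D := D) (s := s) (t := t) (x := x) (hg.sub contDiffOn_const) hf le_rfl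
    ht.uniqueDiffOn hs.uniqueDiffOn hst hx ?_ ?_
  · rw [iteratedFDerivWithin_of_isOpen n hs hx] at h
    have he : (fun y => g y - g (f x)) ∘ f = fun y => (g ∘ f) y - g (f x) := rfl
    rwa [he, iteratedFDeriv_sub_const_of_pos _ _ hn] at h
  · intro i hi
    rw [iteratedFDerivWithin_of_isOpen i ht (hst hx)]
    rcases Nat.eq_zero_or_pos i with rfl | hi0
    · rw [norm_iteratedFDeriv_zero, sub_self, norm_zero]
      exact (norm_nonneg _).trans (hC 1 le_rfl hn)
    · rw [iteratedFDeriv_sub_const_of_pos _ _ hi0]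
      exact hC i hi0 hi
  · intro i h1 h2
    rw [iteratedFDerivWithin_of_isOpen i hs hx]
    exact hD i h1 h2

theorem iteratedFDeriv_comp_clm_of_isOpen {f : F → G} {t : Set F} (ht : IsOpen t) {n : ℕ}
    (hf : ContDiffOn ℝ n f t) (A : E →L[ℝ] F) {x : E} (hx : A x ∈ t) :
    iteratedFDeriv ℝ n (f ∘ A) x =
      (iteratedFDeriv ℝ n f (A x)).compContinuousLinearMap fun _ => A := by
  have h := A.iteratedFDerivWithin_comp_right hf ht.uniqueDiffOn
    (ht.preimage A.continuous).uniqueDiffOn hx le_rfl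
  rwa [iteratedFDerivWithin_of_isOpen n ht hx,
    iteratedFDerivWithin_of_isOpen n (ht.preimage A.continuous) hx] at h

/-! ### Directional derivatives -/

/-- The derivative of `f` in direction `v`. -/
def dirDeriv (v : E) (f : E → F) : E → F := fun p => fderiv ℝ f p v

variable {V : Set E} {f g : E → F}

theorem dirDeriv_eqOn (hV : IsOpen V) (h : EqOn f g V) (v : E) :
    EqOn (dirDeriv v f) (dirDeriv v g) V := fun p hp => by
  have : f =ᶠ[𝓝 p] g := h.eventuallyEq_of_mem (hV.mem_nhds hp)
  simp only [dirDeriv, this.fderiv_eq]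

theorem ContDiffOn.dirDeriv (hV : IsOpen V) (hf : ContDiffOn ℝ ∞ f V) (v : E) :
    ContDiffOn ℝ ∞ (dirDeriv v f) V :=
  (hf.fderiv_of_isOpen hV (m := ∞) (by simp)).clm_apply contDiffOn_const

theorem ContDiffOn.foldr_dirDeriv (hV : IsOpen V) (hf : ContDiffOn ℝ ∞ f V) (l : List E) :
    ContDiffOn ℝ ∞ (l.foldr _root_.dirDeriv f) V := by
  induction l with
  | nil => exact hf
  | cons v l ih => exact ih.dirDeriv hV v

theorem dirDeriv_comm (hV : IsOpen V) (hf : ContDiffOn ℝ ∞ f V) (v w : E) :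
    EqOn (dirDeriv v (dirDeriv w f)) (dirDeriv w (dirDeriv v f)) V := fun p hp => by
  have hfp : ContDiffAt ℝ ∞ f p := hf.contDiffAt (hV.mem_nhds hp)
  have hd : DifferentiableAt ℝ (fderiv ℝ f) p :=
    (hfp.fderiv_right (m := 1) (by norm_num; exact ENat.LEInfty.out)).differentiableAt (by simp)
  have key : ∀ a b : E, dirDeriv a (dirDeriv b f) p = fderiv ℝ (fderiv ℝ f) p a b := by
    intro a b
    have h1 : dirDeriv b f = fun q => (fderiv ℝ f q) ((fun _ => b) q) := rfl
    rw [dirDeriv, h1, fderiv_clm_apply hd (by fun_prop)]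
    simp
  rw [key, key]
  have hs : IsSymmSndFDerivAt ℝ f p := hfp.isSymmSndFDerivAt (by
    simp only [minSmoothness_of_isRCLikeNormedField]; exact ENat.LEInfty.out)
  exact hs v w

theorem foldr_dirDeriv_perm (hV : IsOpen V) (hf : ContDiffOn ℝ ∞ f V) {l l' : List E}
    (h : l.Perm l') : EqOn (l.foldr dirDeriv f) (l'.foldr dirDeriv f) V := by
  induction h with
  | nil => exact eqOn_refl _ _
  | cons v _ ih => exact dirDeriv_eqOn hV ih v
  | swap v w l => exact dirDeriv_comm hV (hf.foldr_dirDeriv hV l) w v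
  | trans _ _ h1 h2 => exact h1.trans h2

/-- Written as iterated directional derivatives, the components of the derivative can be reordered
and compared with the one-variable derivatives in the weighted norm. -/
theorem iteratedFDeriv_apply_eq_foldr (hV : IsOpen V) (hf : ContDiffOn ℝ ∞ f V) {n : ℕ}
    (m : Fin n → E) :
    EqOn (fun p => iteratedFDeriv ℝ n f p m) ((List.ofFn m).foldr dirDeriv f) V := by
  induction n with
  | zero => intro p _; simp
  | succ n ih =>
    intro p hp
    have hd : DifferentiableAt ℝ (iteratedFDeriv ℝ n f) p :=
      (hf.contDiffAt (hV.mem_nhds hp)).differentiableAt_iteratedFDeriv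
        (by exact_mod_cast ENat.natCast_lt_top n)
    simp only
    rw [hd.iteratedFDeriv_succ_apply_left', List.ofFn_succ, List.foldr_cons]
    exact dirDeriv_eqOn hV (ih (Fin.tail m)) (m 0) hp

end Composition

/-! ### Mixed partial derivatives in two real variables -/

section MixedPartials

/-- The mixed derivative `∂₁^a ∂₂^b` of a function of two real variables. -/
def mixedDeriv (a b : ℕ) (f : ℝ → ℝ → ℂ) (r φ : ℝ) : ℂ :=
  iteratedDeriv a (fun r' => iteratedDeriv b (fun φ' => f r' φ') φ) r

variable {V : Set (ℝ × ℝ)} {F : ℝ × ℝ → ℂ}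

theorem iteratedDeriv_snd_eq (hV : IsOpen V) (hF : ContDiffOn ℝ ∞ F V) (b : ℕ) :
    ∀ p ∈ V, iteratedDeriv b (fun φ' => F (p.1, φ')) p.2 =
      ((List.replicate b ((0, 1) : ℝ × ℝ)).foldr dirDeriv F) p := by
  induction b with
  | zero => intro p _; simp
  | succ b ih =>
    intro p hp
    rw [iteratedDeriv_succ, List.replicate_succ, List.foldr_cons]
    have hev : iteratedDeriv b (fun φ' => F (p.1, φ')) =ᶠ[𝓝 p.2]
        fun φ => ((List.replicate b ((0, 1) : ℝ × ℝ)).foldr dirDeriv F) (p.1, φ) := by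
      have : ∀ᶠ φ in 𝓝 p.2, (p.1, φ) ∈ V :=
        (Continuous.prodMk_right p.1).continuousAt.eventually (hV.mem_nhds hp)
      filter_upwards [this] with φ hφ using ih (p.1, φ) hφ
    rw [hev.deriv_eq]
    have hd : DifferentiableAt ℝ ((List.replicate b ((0, 1) : ℝ × ℝ)).foldr dirDeriv F) p :=
      ((hF.foldr_dirDeriv hV _).contDiffAt (hV.mem_nhds hp)).differentiableAt (by simp)
    have hl : HasDerivAt (fun φ : ℝ => (p.1, φ)) ((0, 1) : ℝ × ℝ) p.2 :=
      (hasDerivAt_const _ _).prodMk (hasDerivAt_id _)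
    exact (hd.hasFDerivAt.comp_hasDerivAt p.2 hl).deriv

theorem iteratedDeriv_fst_eq (hV : IsOpen V) (hF : ContDiffOn ℝ ∞ F V) (a : ℕ) :
    ∀ p ∈ V, iteratedDeriv a (fun r' => F (r', p.2)) p.1 =
      ((List.replicate a ((1, 0) : ℝ × ℝ)).foldr dirDeriv F) p := by
  induction a with
  | zero => intro p _; simp
  | succ b ih =>
    intro p hp
    rw [iteratedDeriv_succ, List.replicate_succ, List.foldr_cons]
    have hev : iteratedDeriv b (fun r' => F (r', p.2)) =ᶠ[𝓝 p.1]
        fun r => ((List.replicate b ((1, 0) : ℝ × ℝ)).foldr dirDeriv F) (r, p.2) := by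
      have : ∀ᶠ r in 𝓝 p.1, (r, p.2) ∈ V :=
        (Continuous.prodMk_left p.2).continuousAt.eventually (hV.mem_nhds hp)
      filter_upwards [this] with r hr using ih (r, p.2) hr
    rw [hev.deriv_eq]
    have hd : DifferentiableAt ℝ ((List.replicate b ((1, 0) : ℝ × ℝ)).foldr dirDeriv F) p :=
      ((hF.foldr_dirDeriv hV _).contDiffAt (hV.mem_nhds hp)).differentiableAt (by simp)
    have hl : HasDerivAt (fun r : ℝ => (r, p.2)) ((1, 0) : ℝ × ℝ) p.1 :=
      (hasDerivAt_id _).prodMk (hasDerivAt_const _ _)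
    exact (hd.hasFDerivAt.comp_hasDerivAt p.1 hl).deriv

theorem mixedDeriv_eq_foldr (hV : IsOpen V) (hF : ContDiffOn ℝ ∞ F V) (a b : ℕ) {p : ℝ × ℝ}
    (hp : p ∈ V) : mixedDeriv a b (fun r φ => F (r, φ)) p.1 p.2 =
      ((List.replicate a ((1, 0) : ℝ × ℝ) ++ List.replicate b (0, 1)).foldr dirDeriv F) p := by
  rw [List.foldr_append, ← iteratedDeriv_fst_eq hV (hF.foldr_dirDeriv hV _) a p hp, mixedDeriv]
  refine Filter.EventuallyEq.iteratedDeriv_eq a ?_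
  have : ∀ᶠ r in 𝓝 p.1, (r, p.2) ∈ V :=
    (Continuous.prodMk_left p.2).continuousAt.eventually (hV.mem_nhds hp)
  filter_upwards [this] with r hr using iteratedDeriv_snd_eq hV hF b (r, p.2) hr

theorem continuousOn_mixedDeriv (hV : IsOpen V) (hF : ContDiffOn ℝ ∞ F V) (a b : ℕ) :
    ContinuousOn (fun p : ℝ × ℝ => mixedDeriv a b (fun r φ => F (r, φ)) p.1 p.2) V :=
  (hF.foldr_dirDeriv hV _).continuousOn.congr fun _ hp => mixedDeriv_eq_foldr hV hF a b hp

/-- The linear map `(s, ψ) ↦ (r s, ψ)`. -/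
def scaleFst (r : ℝ) : ℝ × ℝ →L[ℝ] ℝ × ℝ :=
  (r • ContinuousLinearMap.fst ℝ ℝ ℝ).prod (ContinuousLinearMap.snd ℝ ℝ ℝ)

/-- Expansion in the standard basis gives `2 ^ n` words in the two coordinate directions. Each is a
mixed derivative, and every occurrence of the first direction contributes one factor `r`. -/
theorem norm_iteratedFDeriv_comp_scaleFst_le (hV : IsOpen V) (hF : ContDiffOn ℝ ∞ F V) {n : ℕ}
    {p : ℝ × ℝ} (hp : p ∈ V) {r M : ℝ} (hr : 0 ≤ r)
    (hM : ∀ a b, a + b = n → r ^ a * ‖mixedDeriv a b (fun r φ => F (r, φ)) p.1 p.2‖ ≤ M) :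
    ‖(iteratedFDeriv ℝ n F p).compContinuousLinearMap fun _ => scaleFst r‖ ≤ 2 ^ n * M := by
  have hM0 : 0 ≤ M := le_trans (by positivity) (hM n 0 (by simp))
  refine ContinuousMultilinearMap.opNorm_le_bound (by positivity) fun m => ?_
  set e : Fin 2 → ℝ × ℝ := ![(1, 0), (0, 1)] with he
  set c : Fin 2 → ℝ := ![r, 1] with hc
  set z : ℝ × ℝ → Fin 2 → ℝ := fun q => ![q.1, q.2] with hz
  have hm : (fun i => scaleFst r (m i)) = fun i => ∑ l : Fin 2, (z (m i) l * c l) • e l := by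
    funext i
    simp [scaleFst, z, c, e, mul_comm]
  rw [ContinuousMultilinearMap.compContinuousLinearMap_apply, hm,
    ← ContinuousMultilinearMap.coe_coe, MultilinearMap.map_sum]
  refine (norm_sum_le _ _).trans ?_
  have hword : ∀ σ : Fin n → Fin 2, ‖(iteratedFDeriv ℝ n F p).toMultilinearMap
      (fun i => (z (m i) (σ i) * c (σ i)) • e (σ i))‖ ≤ M * ∏ i, ‖m i‖ := by
    intro σ
    rw [MultilinearMap.map_smul_univ, norm_smul, norm_prod]
    have h1 : (iteratedFDeriv ℝ n F p).toMultilinearMap (fun i => e (σ i)) =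
        ((List.ofFn fun i => e (σ i)).foldr dirDeriv F) p :=
      iteratedFDeriv_apply_eq_foldr hV hF (fun i => e (σ i)) hp
    set a := (List.ofFn σ).count 0 with ha
    set b := (List.ofFn σ).count 1 with hb
    -- Since directional derivatives commute, only the numbers `a` and `b` of the two letters
    -- matter.
    have hperm : (List.ofFn σ).Perm (List.replicate a 0 ++ List.replicate b 1) := by
      rw [List.perm_replicate_append_replicate (by decide)]
      refine ⟨rfl, rfl, fun x _ => ?_⟩
      fin_cases x <;> simp
    have hab : a + b = n := by simpa using hperm.length_eq.symm
    have hperm2 : (List.ofFn fun i => e (σ i)).Perm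
        (List.replicate a ((1, 0) : ℝ × ℝ) ++ List.replicate b (0, 1)) := by
      have := hperm.map e
      rw [List.map_ofFn] at this
      simpa [e, Function.comp_def] using this
    rw [h1, foldr_dirDeriv_perm hV hF hperm2 hp, ← mixedDeriv_eq_foldr hV hF a b hp]
    have h2 : ∏ i, ‖c (σ i)‖ = r ^ a := by
      have : ∏ i, ‖c (σ i)‖ = ((List.ofFn σ).map fun l => ‖c l‖).prod := by
        rw [List.map_ofFn, List.prod_ofFn]; rfl
      rw [this, (hperm.map _).prod_eq]
      simp [c, abs_of_nonneg hr]
    have h3 : ∏ i, ‖z (m i) (σ i)‖ ≤ ∏ i, ‖m i‖ := by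
      refine Finset.prod_le_prod (fun _ _ => norm_nonneg _) fun i _ => ?_
      have : ∀ q : ℝ × ℝ, ∀ l : Fin 2, ‖z q l‖ ≤ ‖q‖ := by
        intro q l
        fin_cases l
        · exact norm_fst_le q
        · exact norm_snd_le q
      exact this _ _
    simp only [norm_mul, Finset.prod_mul_distrib, h2]
    calc _ = (∏ i, ‖z (m i) (σ i)‖) *
          (r ^ a * ‖mixedDeriv a b (fun r φ => F (r, φ)) p.1 p.2‖) := by ring
      _ ≤ (∏ i, ‖m i‖) * M := by
          gcongr
          exact hM a b hab
      _ = _ := mul_comm _ _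
  refine (Finset.sum_le_sum fun σ _ => hword σ).trans_eq ?_
  simp [mul_assoc]

end MixedPartials

/-! ### Polar coordinates -/

section Polar

variable (v : E2) (θ : ℝ)

@[simp] theorem polarPoint_zero_coord (r φ : ℝ) :
    polarPoint v θ r φ 0 = v 0 + r * Real.cos (θ + φ) := by simp [polarPoint]

@[simp] theorem polarPoint_one_coord (r φ : ℝ) :
    polarPoint v θ r φ 1 = v 1 + r * Real.sin (θ + φ) := by simp [polarPoint]

theorem E2_ext {x y : E2} (h0 : x 0 = y 0) (h1 : x 1 = y 1) : x = y := by
  ext l; fin_cases l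
  · exact h0
  · exact h1

theorem E2_norm_sq (x : E2) : ‖x‖ ^ 2 = x 0 ^ 2 + x 1 ^ 2 := by
  rw [EuclideanSpace.norm_sq_eq]; simp

theorem contDiff_polarPoint : ContDiff ℝ ∞ fun q : ℝ × ℝ => polarPoint v θ q.1 q.2 := by
  rw [contDiff_euclidean]
  intro l
  fin_cases l
  · simp only [Fin.zero_eta, polarPoint_zero_coord]; fun_prop
  · simp only [Fin.mk_one, polarPoint_one_coord]; fun_prop

theorem dist_polarPoint_le (r φ ψ : ℝ) :
    dist (polarPoint v θ r φ) (polarPoint v θ r ψ) ≤ |r| * |φ - ψ| := by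
  rw [dist_eq_norm]
  refine le_of_sq_le_sq ?_ (by positivity)
  rw [E2_norm_sq, mul_pow, sq_abs, sq_abs]
  simp only [PiLp.sub_apply, polarPoint_zero_coord, polarPoint_one_coord]
  have h := Real.one_sub_sq_div_two_le_cos (x := (θ + φ) - (θ + ψ))
  rw [Real.cos_sub] at h
  have h1 := Real.sin_sq_add_cos_sq (θ + φ)
  have h2 := Real.sin_sq_add_cos_sq (θ + ψ)
  have h3 : (Real.cos (θ + φ) - Real.cos (θ + ψ)) ^ 2 + (Real.sin (θ + φ) - Real.sin (θ + ψ)) ^ 2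
      ≤ (φ - ψ) ^ 2 := by nlinarith
  calc _ = r ^ 2 * ((Real.cos (θ + φ) - Real.cos (θ + ψ)) ^ 2 +
        (Real.sin (θ + φ) - Real.sin (θ + ψ)) ^ 2) := by ring
    _ ≤ _ := by gcongr

theorem dist_polarPoint_center (r φ : ℝ) : dist (polarPoint v θ r φ) v = |r| := by
  rw [dist_eq_norm, ← abs_of_nonneg (norm_nonneg (polarPoint v θ r φ - v)), ← sq_eq_sq_iff_abs_eq_abs,
    E2_norm_sq]
  simp only [PiLp.sub_apply, polarPoint_zero_coord, polarPoint_one_coord]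
  have := Real.sin_sq_add_cos_sq (θ + φ)
  linear_combination r ^ 2 * this

theorem polarPoint_injective {r r' φ φ' : ℝ} (hr : 0 < r) (hr' : 0 < r')
    (h : polarPoint v θ r φ = polarPoint v θ r' φ') (hφ : |φ - φ'| < 2 * Real.pi) :
    r = r' ∧ φ = φ' := by
  have hrr : r = r' := by
    have := congrArg (dist · v) h
    simpa [dist_polarPoint_center, abs_of_pos hr, abs_of_pos hr'] using this
  subst hrr
  refine ⟨rfl, ?_⟩
  have h0 := congrArg (fun x : E2 => x 0) h
  have h1 := congrArg (fun x : E2 => x 1) h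
  simp only [polarPoint_zero_coord, polarPoint_one_coord, add_right_inj,
    mul_right_inj' hr.ne'] at h0 h1
  have := Real.Angle.cos_sin_inj h0 h1
  rw [Real.Angle.angle_eq_iff_two_pi_dvd_sub] at this
  obtain ⟨k, hk⟩ := this
  have hk' : φ - φ' = 2 * Real.pi * k := by linarith
  have : |(k : ℝ)| < 1 := by
    rw [hk', abs_mul, abs_of_pos (by positivity)] at hφ
    nlinarith [Real.pi_pos]
  have hk0 : k = 0 := by
    have : |k| < 1 := by exact_mod_cast this
    exact Int.abs_lt_one_iff.1 this
  rw [hk0] at hk'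
  simp at hk'
  linarith

theorem exists_polarPoint (x : E2) (hx : x ≠ v) :
    ∃ r > 0, ∃ φ ∈ Ico 0 (2 * Real.pi), x = polarPoint v θ r φ := by
  set z : ℂ := ⟨x 0 - v 0, x 1 - v 1⟩ with hz
  have hz0 : z ≠ 0 := by
    intro h
    apply hx
    have h0 := congrArg Complex.re h
    have h1 := congrArg Complex.im h
    simp [z] at h0 h1
    exact E2_ext (by linarith) (by linarith)
  refine ⟨‖z‖, norm_pos_iff.2 hz0, toIcoMod Real.two_pi_pos 0 (z.arg - θ),
    by simpa using toIcoMod_mem_Ico Real.two_pi_pos 0 (z.arg - θ), ?_⟩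
  have hmod : θ + toIcoMod Real.two_pi_pos 0 (z.arg - θ) =
      z.arg - toIcoDiv Real.two_pi_pos 0 (z.arg - θ) * (2 * Real.pi) := by
    rw [toIcoMod, zsmul_eq_mul]; ring
  apply E2_ext
  · rw [polarPoint_zero_coord, hmod, Real.cos_sub_int_mul_two_pi, Complex.norm_mul_cos_arg]
    simp [z]
  · rw [polarPoint_one_coord, hmod, Real.sin_sub_int_mul_two_pi, Complex.norm_mul_sin_arg]
    simp [z]

/-- Polar coordinates of `(1, 0) + z` for small `z`. -/
def localPolar (z : E2) : ℝ × ℝ :=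
  (Real.sqrt ((1 + z 0) ^ 2 + z 1 ^ 2), Real.arctan (z 1 / (1 + z 0)))

theorem isOpen_localPolar_domain : IsOpen {z : E2 | 0 < 1 + z 0} :=
  isOpen_lt continuous_const (by fun_prop)

theorem contDiffOn_localPolar : ContDiffOn ℝ ∞ localPolar {z : E2 | 0 < 1 + z 0} := by
  intro z hz
  have hz : 0 < 1 + z 0 := hz
  refine ContDiffAt.contDiffWithinAt (ContDiffAt.prodMk ?_ ?_)
  · refine ContDiffAt.sqrt (by fun_prop) ?_
    positivity
  · exact Real.contDiff_arctan.contDiffAt.comp z (ContDiffAt.div (by fun_prop) (by fun_prop) hz.ne')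

theorem localPolar_zero : localPolar 0 = (1, 0) := by simp [localPolar]

/-- `z ↦ r⁻¹ R z` with the rotation `R` by the angle `-η`. -/
def scaledRotation (r η : ℝ) : E2 →L[ℝ] E2 :=
  LinearMap.toContinuousLinearMap
    { toFun := fun w => !₂[r⁻¹ * (Real.cos η * w 0 + Real.sin η * w 1),
        r⁻¹ * (-Real.sin η * w 0 + Real.cos η * w 1)]
      map_add' := fun a b => by
        apply E2_ext <;> simp <;> ring
      map_smul' := fun c a => by
        apply E2_ext <;> simp <;> ring }

theorem scaledRotation_zero_coord (r η : ℝ) (w : E2) :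
    scaledRotation r η w 0 = r⁻¹ * (Real.cos η * w 0 + Real.sin η * w 1) := by
  simp [scaledRotation]

theorem scaledRotation_one_coord (r η : ℝ) (w : E2) :
    scaledRotation r η w 1 = r⁻¹ * (-Real.sin η * w 0 + Real.cos η * w 1) := by
  simp [scaledRotation]

theorem norm_scaledRotation_le {r : ℝ} (hr : 0 < r) (η : ℝ) : ‖scaledRotation r η‖ ≤ r⁻¹ := by
  refine ContinuousLinearMap.opNorm_le_bound _ (by positivity) fun w => ?_
  refine le_of_sq_le_sq ?_ (by positivity)
  rw [E2_norm_sq, mul_pow, E2_norm_sq, scaledRotation_zero_coord, scaledRotation_one_coord]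
  have := Real.sin_sq_add_cos_sq η
  apply le_of_eq
  linear_combination (r⁻¹ ^ 2 * (w 0 ^ 2 + w 1 ^ 2)) * this

/-- A rotation and a dilation by `r⁻¹` move the base point to `(1, 0)`. Polar coordinates near any
point are therefore the one fixed map `localPolar` near the origin after a similarity, which makes
the later constants independent of the point. -/
theorem polarPoint_localPolar {r φ : ℝ} (hr : 0 < r) {y : E2}
    (hy : 0 < 1 + scaledRotation r (θ + φ) (y - polarPoint v θ r φ) 0) :
    polarPoint v θ (r * (localPolar (scaledRotation r (θ + φ) (y - polarPoint v θ r φ))).1)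
      (φ + (localPolar (scaledRotation r (θ + φ) (y - polarPoint v θ r φ))).2) = y := by
  set z := scaledRotation r (θ + φ) (y - polarPoint v θ r φ) with hz
  have h0 : z 0 = r⁻¹ * (Real.cos (θ + φ) * (y 0 - (v 0 + r * Real.cos (θ + φ))) +
      Real.sin (θ + φ) * (y 1 - (v 1 + r * Real.sin (θ + φ)))) := by
    rw [hz, scaledRotation_zero_coord]; simp
  have h1 : z 1 = r⁻¹ * (-Real.sin (θ + φ) * (y 0 - (v 0 + r * Real.cos (θ + φ))) +
      Real.cos (θ + φ) * (y 1 - (v 1 + r * Real.sin (θ + φ)))) := by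
    rw [hz, scaledRotation_one_coord]; simp
  have hsc := Real.sin_sq_add_cos_sq (θ + φ)
  set L := localPolar z with hL
  have hs : 0 < Real.sqrt ((1 + z 0) ^ 2 + z 1 ^ 2) := Real.sqrt_pos.2 (by positivity)
  have hsq : Real.sqrt (1 + (z 1 / (1 + z 0)) ^ 2) =
      Real.sqrt ((1 + z 0) ^ 2 + z 1 ^ 2) / (1 + z 0) := by
    rw [show 1 + (z 1 / (1 + z 0)) ^ 2 = ((1 + z 0) ^ 2 + z 1 ^ 2) / (1 + z 0) ^ 2 by
      field_simp, Real.sqrt_div (by positivity), Real.sqrt_sq hy.le]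
  have hc : L.1 * Real.cos L.2 = 1 + z 0 := by
    simp only [L, localPolar, Real.cos_arctan, hsq]
    field_simp
  have hsn : L.1 * Real.sin L.2 = z 1 := by
    simp only [L, localPolar, Real.sin_arctan, hsq]
    field_simp
  have hrr : r * r⁻¹ = 1 := mul_inv_cancel₀ hr.ne'
  have e0 : r * (1 + z 0) = Real.cos (θ + φ) * (y 0 - v 0) + Real.sin (θ + φ) * (y 1 - v 1) := by
    rw [h0]; field_simp; linear_combination (-r) * hsc
  have e1 : r * z 1 = -Real.sin (θ + φ) * (y 0 - v 0) + Real.cos (θ + φ) * (y 1 - v 1) := by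
    rw [h1]; field_simp; ring
  apply E2_ext
  · rw [polarPoint_zero_coord, ← add_assoc, Real.cos_add]
    have : r * L.1 * (Real.cos (θ + φ) * Real.cos L.2 - Real.sin (θ + φ) * Real.sin L.2) =
        Real.cos (θ + φ) * (r * (1 + z 0)) - Real.sin (θ + φ) * (r * z 1) := by
      rw [← hc, ← hsn]; ring
    rw [this, e0, e1]
    linear_combination (y 0 - v 0) * hsc
  · rw [polarPoint_one_coord, ← add_assoc, Real.sin_add]
    have : r * L.1 * (Real.sin (θ + φ) * Real.cos L.2 + Real.cos (θ + φ) * Real.sin L.2) =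
        Real.sin (θ + φ) * (r * (1 + z 0)) + Real.cos (θ + φ) * (r * z 1) := by
      rw [← hc, ← hsn]; ring
    rw [this, e0, e1]
    linear_combination (y 1 - v 1) * hsc

/-- The derivatives of a function are controlled by its derivatives with respect to polar
coordinates. -/
theorem exists_norm_iteratedFDeriv_le_polar (l : ℕ) : ∃ C : ℝ, 0 < C ∧
    ∀ (v : E2) (θ : ℝ) (U : Set E2) (h : E2 → ℂ), IsOpen U → ContDiffOn ℝ ∞ h U →
    ∀ r φ : ℝ, 0 < r → polarPoint v θ r φ ∈ U → ∀ M : ℝ,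
    (∀ a b, 1 ≤ a + b → a + b ≤ l →
      r ^ a * ‖mixedDeriv a b (fun r φ => h (polarPoint v θ r φ)) r φ‖ ≤ M) →
    ∀ n, 1 ≤ n → n ≤ l → ‖iteratedFDeriv ℝ n h (polarPoint v θ r φ)‖ ≤ C * M * r⁻¹ ^ n := by
  -- This involves only the fixed map `localPolar` at the origin.
  set K : ℝ := 1 + ∑ i ∈ Finset.range (l + 1), ‖iteratedFDeriv ℝ i localPolar 0‖ with hK
  have hK1 : 1 ≤ K := le_add_of_nonneg_right (Finset.sum_nonneg fun _ _ => norm_nonneg _)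
  refine ⟨l.factorial * 2 ^ l * K ^ l, by positivity, ?_⟩
  intro v θ U h hU hh r φ hr hx M hM n hn hnl
  set x := polarPoint v θ r φ with hxdef
  have hM0 : 0 ≤ M := le_trans (by positivity) (hM 1 0 (by simp) (by omega))
  -- the function in polar coordinates
  set P : ℝ × ℝ → E2 := fun q => polarPoint v θ q.1 q.2 with hP
  set V : Set (ℝ × ℝ) := P ⁻¹' U with hVdef
  have hV : IsOpen V := hU.preimage (contDiff_polarPoint v θ).continuous
  have hF : ContDiffOn ℝ ∞ (h ∘ P) V := hh.comp (contDiff_polarPoint v θ).contDiffOn fun _ hq => hq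
  have hpV : ((r, φ) : ℝ × ℝ) ∈ V := hx
  -- the scaled function
  set F' : ℝ × ℝ → ℂ := fun q => (h ∘ P) (q + (0, φ)) with hF'
  set V' : Set (ℝ × ℝ) := (fun q => q + (0, φ)) ⁻¹' V with hV'def
  have hV' : IsOpen V' := hV.preimage (by fun_prop)
  have hF'c : ContDiffOn ℝ ∞ F' V' := hF.comp (by fun_prop) fun _ hq => hq
  set H : ℝ × ℝ → ℂ := F' ∘ scaleFst r with hHdef
  set T : Set (ℝ × ℝ) := scaleFst r ⁻¹' V' with hTdef
  have hT : IsOpen T := hV'.preimage (scaleFst r).continuous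
  have hHc : ContDiffOn ℝ ∞ H T := hF'c.comp (scaleFst r).contDiff.contDiffOn fun _ hq => hq
  have hs1 : scaleFst r ((1, 0) : ℝ × ℝ) = (r, 0) := by simp [scaleFst]
  have hC : ∀ i, 1 ≤ i → i ≤ n → ‖iteratedFDeriv ℝ i H (1, 0)‖ ≤ 2 ^ l * M := by
    intro i h1 h2
    rw [hHdef, iteratedFDeriv_comp_clm_of_isOpen hV' (hF'c.of_le (by exact ENat.LEInfty.out))
      (scaleFst r) (by rw [hs1]; simpa [V'] using hpV), hs1, hF', iteratedFDeriv_comp_add_right]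
    simp only [Prod.mk_add_mk, add_zero, zero_add]
    refine (norm_iteratedFDeriv_comp_scaleFst_le hV hF hpV hr.le fun a b hab =>
      hM a b (by omega) (by omega)).trans ?_
    gcongr
    · norm_num
    · omega
  -- the change of coordinates
  set B : E2 → E2 := fun y => scaledRotation r (θ + φ) (y - x) with hB
  set f : E2 → ℝ × ℝ := localPolar ∘ B with hf
  set s0 : Set E2 := {z : E2 | 0 < 1 + z 0} with hs0
  have hBc : Continuous B := by fun_prop
  set s1 : Set E2 := B ⁻¹' s0 with hs1def
  have hs1o : IsOpen s1 := isOpen_localPolar_domain.preimage hBc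
  have hBx : B x = 0 := by simp [B]
  have hfc : ContDiffOn ℝ ∞ f s1 :=
    contDiffOn_localPolar.comp (by fun_prop) fun _ hq => hq
  have hxs1 : x ∈ s1 := by
    simp [s1, s0, hBx]
  have hfx : f x = (1, 0) := by simp [f, hBx, localPolar_zero]
  set s : Set E2 := s1 ∩ f ⁻¹' T with hsdef
  have hs : IsOpen s := hfc.continuousOn.isOpen_inter_preimage hs1o hT
  have hxs : x ∈ s := ⟨hxs1, by
    simp only [mem_preimage, hfx, T, V', hs1]
    simpa using hpV⟩
  have hD : ∀ i, 1 ≤ i → i ≤ n → ‖iteratedFDeriv ℝ i f x‖ ≤ (K * r⁻¹) ^ i := by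
    intro i h1 h2
    have e : f = fun y => (localPolar ∘ scaledRotation r (θ + φ)) (y - x) := rfl
    rw [e, iteratedFDeriv_comp_sub, sub_self, iteratedFDeriv_comp_clm_of_isOpen
      isOpen_localPolar_domain (contDiffOn_localPolar.of_le (by exact ENat.LEInfty.out)) _ (by simp)]
    refine (ContinuousMultilinearMap.norm_compContinuousLinearMap_le _ _).trans ?_
    rw [map_zero, Finset.prod_const, Finset.card_univ, Fintype.card_fin, mul_pow]
    gcongr
    · calc ‖iteratedFDeriv ℝ i localPolar 0‖ ≤ K := by
            rw [hK]
            have := Finset.single_le_sum (f := fun i => ‖iteratedFDeriv ℝ i localPolar 0‖)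
              (fun _ _ => norm_nonneg _) (Finset.mem_range.2 (by omega : i < l + 1))
            linarith
        _ ≤ K ^ i := le_self_pow₀ hK1 (by omega)
    · exact norm_scaledRotation_le hr _
  -- The outer factor `H` takes `(s, ψ)` to the value at radius `r s` and has derivatives bounded by
  -- `2 ^ l * M`. All negative powers of `r` come from `f`, one for each derivative.
  have hcomp : h =ᶠ[𝓝 x] H ∘ f := by
    filter_upwards [hs1o.mem_nhds hxs1] with y hy
    have := polarPoint_localPolar v θ hr (y := y) (φ := φ) hy
    simp only [H, F', P, f, B, scaleFst, Function.comp_apply, ContinuousLinearMap.prod_apply,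
      smul_apply, ContinuousLinearMap.coe_fst', ContinuousLinearMap.coe_snd',
      smul_eq_mul, Prod.fst_add, Prod.snd_add, add_zero]
    rw [add_comm φ] at this
    exact congrArg h this.symm
  rw [(hcomp.iteratedFDeriv ℝ n).eq_of_nhds]
  refine (norm_iteratedFDeriv_comp_le_of_isOpen hn hs hT (hHc.of_le ENat.LEInfty.out)
    ((hfc.mono inter_subset_left).of_le ENat.LEInfty.out) (fun _ hy => hy.2) hxs
    (C := 2 ^ l * M) (D := K * r⁻¹) (by rwa [hfx]) hD).trans ?_
  rw [mul_pow]
  have : (n.factorial : ℝ) ≤ l.factorial := by exact_mod_cast Nat.factorial_le hnl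
  have : K ^ n ≤ K ^ l := pow_le_pow_right₀ hK1 hnl
  calc (n.factorial : ℝ) * (2 ^ l * M) * (K ^ n * r⁻¹ ^ n)
      ≤ l.factorial * (2 ^ l * M) * (K ^ l * r⁻¹ ^ n) := by gcongr
    _ = _ := by ring

end Polar

/-! ### Plane sectors -/

/-- The open plane sector with vertex `v`, initial angle `θ` and opening angle `γ`. -/
def planarSector (v : E2) (θ γ : ℝ) : Set E2 :=
  {y | ∃ r > 0, ∃ φ ∈ Ioo 0 γ, y = polarPoint v θ r φ}

theorem isOpen_planarSector (v : E2) (θ γ : ℝ) : IsOpen (planarSector v θ γ) := by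
  rw [isOpen_iff_mem_nhds]
  rintro x ⟨r, hr, φ, hφ, rfl⟩
  set B : E2 → E2 := fun y => scaledRotation r (θ + φ) (y - polarPoint v θ r φ) with hB
  have hBc : Continuous B := by fun_prop
  have hB0 : B (polarPoint v θ r φ) = 0 := by simp [B]
  have hc : ContinuousAt (fun y => localPolar (B y)) (polarPoint v θ r φ) := by
    refine ContinuousAt.comp (g := localPolar) ?_ hBc.continuousAt
    rw [hB0]
    exact contDiffOn_localPolar.continuousOn.continuousAt
      (isOpen_localPolar_domain.mem_nhds (by simp))
  have h1 : ∀ᶠ y in 𝓝 (polarPoint v θ r φ), 0 < 1 + B y 0 := by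
    have : ContinuousAt (fun y => 1 + B y 0) (polarPoint v θ r φ) := by fun_prop
    exact this.eventually (lt_mem_nhds (by simp [hB0]))
  have h2 : ∀ᶠ y in 𝓝 (polarPoint v θ r φ), φ + (localPolar (B y)).2 ∈ Ioo 0 γ := by
    have : ContinuousAt (fun y => φ + (localPolar (B y)).2) (polarPoint v θ r φ) :=
      continuousAt_const.add (continuous_snd.continuousAt.comp hc)
    exact this.eventually (isOpen_Ioo.mem_nhds (by simpa [hB0, localPolar_zero] using hφ))
  filter_upwards [h1, h2] with y hy1 hy2
  refine ⟨r * (localPolar (B y)).1, ?_, φ + (localPolar (B y)).2, hy2,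
    (polarPoint_localPolar v θ hr hy1).symm⟩
  refine mul_pos hr (Real.sqrt_pos.2 ?_)
  positivity

/-- Cartesian coordinates. -/
def planeEquiv : E2 ≃ᵐ ℝ × ℝ :=
  (MeasurableEquiv.toLp 2 (Fin 2 → ℝ)).symm.trans MeasurableEquiv.finTwoArrow

theorem measurePreserving_planeEquiv : MeasurePreserving planeEquiv := by
  refine MeasurePreserving.trans (μb := volume) ?_ (volume_preserving_finTwoArrow ℝ)
  exact EuclideanSpace.volume_preserving_symm_measurableEquiv_toLp (Fin 2)

theorem planeEquiv_apply (x : E2) : planeEquiv x = (x 0, x 1) := rfl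

/-- Polar coordinates shifted by the angle `θ`. They are injective on the sector because `γ ≤ 2π`,
and the change of variables asks for no measurability of `g`. -/
theorem lintegral_planarSector {v : E2} {θ γ : ℝ} (hγ : γ ≤ 2 * Real.pi) (g : E2 → ℝ≥0∞) :
    ∫⁻ x in planarSector v θ γ, g x =
      ∫⁻ q in Ioi (0 : ℝ) ×ˢ Ioo (0 : ℝ) γ, ENNReal.ofReal q.1 * g (polarPoint v θ q.1 q.2) := by
  set f : ℝ × ℝ → ℝ × ℝ := fun q => planeEquiv (polarPoint v θ q.1 q.2) with hf
  set s : Set (ℝ × ℝ) := Ioi (0 : ℝ) ×ˢ Ioo (0 : ℝ) γ with hs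
  have hsm : MeasurableSet s := measurableSet_Ioi.prod measurableSet_Ioo
  have hfeq : f = fun q => ((v 0, v 1) : ℝ × ℝ) + polarCoord.symm (q + (0, θ)) := by
    funext q
    simp [f, planeEquiv_apply, polarCoord, add_comm θ]
  have hder : ∀ q ∈ s, HasFDerivWithinAt f (fderivPolarCoordSymm (q + (0, θ))) s q := by
    intro q _
    rw [hfeq]
    refine HasFDerivAt.hasFDerivWithinAt (HasFDerivAt.const_add _ ?_)
    have := (hasFDerivAt_polarCoord_symm (q + (0, θ))).comp q ((hasFDerivAt_id q).add_const (0, θ))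
    exact this
  have hinj : InjOn f s := by
    rintro ⟨r, φ⟩ ⟨hr, hφ⟩ ⟨r', φ'⟩ ⟨hr', hφ'⟩ h
    simp only [mem_Ioi, mem_Ioo] at hr hφ hr' hφ'
    have h := planeEquiv.injective h
    obtain ⟨h1, h2⟩ := polarPoint_injective v θ hr hr' h (by
      rw [abs_lt]; constructor <;> linarith [hφ.1, hφ.2, hφ'.1, hφ'.2])
    exact Prod.ext h1 h2
  have himage : f '' s = planeEquiv '' planarSector v θ γ := by
    ext z
    constructor
    · rintro ⟨⟨r, φ⟩, ⟨hr, hφ⟩, rfl⟩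
      exact ⟨_, ⟨r, hr, φ, hφ, rfl⟩, rfl⟩
    · rintro ⟨_, ⟨r, hr, φ, hφ, rfl⟩, rfl⟩
      exact ⟨(r, φ), ⟨hr, hφ⟩, rfl⟩
  have h1 : ∫⁻ x in planarSector v θ γ, g x = ∫⁻ z in f '' s, g (planeEquiv.symm z) := by
    rw [himage, MeasurableEquiv.image_eq_preimage_symm]
    have := measurePreserving_planeEquiv.setLIntegral_comp_preimage_emb
      planeEquiv.measurableEmbedding (fun z => g (planeEquiv.symm z))
      (planeEquiv.symm ⁻¹' planarSector v θ γ)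
    rw [← this]
    simp [← preimage_comp]
  rw [h1, lintegral_image_eq_lintegral_abs_det_fderiv_mul volume hsm hder hinj]
  refine setLIntegral_congr_fun hsm fun q hq => ?_
  simp only [f, MeasurableEquiv.symm_apply_apply]
  rw [det_fderivPolarCoordSymm]
  congr 2
  simpa using (mem_Ioi.1 hq.1).le

theorem planarSector_disjoint {v : E2} {θ γ : ℝ} :
    Disjoint (planarSector v θ γ) (planarSector v (θ + γ) (2 * Real.pi - γ)) := by
  rw [Set.disjoint_left]
  rintro x ⟨r, hr, φ, hφ, rfl⟩ ⟨r', hr', φ', hφ', h⟩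
  have h' : polarPoint v (θ + γ) r' φ' = polarPoint v θ r' (γ + φ') := by
    simp [polarPoint, add_assoc]
  rw [h'] at h
  have := (polarPoint_injective v θ hr hr' h (by
    rw [abs_lt]; constructor <;> linarith [hφ.1, hφ.2, hφ'.1, hφ'.2])).2
  linarith [hφ.2, hφ'.1]

/-- All real `r` are admitted, so the set is a full line: a translate of a proper subspace. -/
theorem volume_ray (v : E2) (θ φ : ℝ) : volume {x : E2 | ∃ r : ℝ, x = polarPoint v θ r φ} = 0 := by
  set w : E2 := !₂[Real.cos (θ + φ), Real.sin (θ + φ)] with hw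
  have h : {x : E2 | ∃ r : ℝ, x = polarPoint v θ r φ} =
      (fun x => v + x) '' (Submodule.span ℝ {w} : Set E2) := by
    ext x
    simp only [mem_ofPred_eq, mem_image, SetLike.mem_coe, Submodule.mem_span_singleton, polarPoint]
    constructor
    · rintro ⟨r, rfl⟩; exact ⟨r • w, ⟨r, rfl⟩, rfl⟩
    · rintro ⟨_, ⟨r, rfl⟩, rfl⟩; exact ⟨r, rfl⟩
  rw [h, image_add_left, measure_preimage_add]
  refine Measure.addHaar_submodule _ _ fun htop => ?_
  have h1 := finrank_span_le_card (R := ℝ) ({w} : Set E2)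
  rw [htop, finrank_top] at h1
  simp at h1

/-- A point off the two bounding lines is in the sector or in the complementary open sector, and the
latter does not meet the closure of the former. -/
theorem ae_mem_planarSector_or_notMem_closure (v : E2) (θ γ : ℝ) :
    ∀ᵐ x : E2, x ∈ planarSector v θ γ ∨ x ∉ closure (planarSector v θ γ) := by
  have h0 := measure_eq_zero_iff_ae_notMem.1 (volume_ray v θ 0)
  have h1 := measure_eq_zero_iff_ae_notMem.1 (volume_ray v θ γ)
  filter_upwards [h0, h1] with x hx0 hx1
  by_cases hxv : x = v
  · exact absurd ⟨0, by simp [hxv, polarPoint]⟩ hx0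
  obtain ⟨r, hr, φ, hφ, rfl⟩ := exists_polarPoint v θ x hxv
  rcases eq_or_lt_of_le hφ.1 with h | hφ0
  · exact absurd ⟨r, by rw [← h]⟩ hx0
  rcases lt_trichotomy φ γ with h | h | h
  · exact Or.inl ⟨r, hr, φ, ⟨hφ0, h⟩, rfl⟩
  · exact absurd ⟨r, by rw [← h]⟩ hx1
  · right
    have hmem : polarPoint v θ r φ ∈ planarSector v (θ + γ) (2 * Real.pi - γ) :=
      ⟨r, hr, φ - γ, ⟨by linarith, by linarith [hφ.2]⟩, by simp [polarPoint]⟩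
    exact (planarSector_disjoint.closure_left (isOpen_planarSector _ _ _)).notMem_of_mem_right
      hmem

/-! ### Parametrized patches -/

/-- Near each point of `K` the smoothness provides some Taylor series with continuous, hence locally
bounded, coefficients. On the open set `U` these must be the true derivatives, and compactness of
`K` makes the bound global. No regularity of the boundary of `K` is needed. -/
theorem exists_bound_iteratedFDeriv {E F : Type*} [NormedAddCommGroup E] [NormedSpace ℝ E]
    [NormedAddCommGroup F] [NormedSpace ℝ F] {f : E → F} {K U : Set E} (hK : IsCompact K)
    (hU : IsOpen U) (hUK : U ⊆ K) {n : ℕ} (hf : ContDiffOn ℝ n f K) {i : ℕ} (hi : i ≤ n) :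
    ∃ C : ℝ, ∀ x ∈ U, ‖iteratedFDeriv ℝ i f x‖ ≤ C := by
  have key : ∃ C : ℝ, ∀ x ∈ K, x ∈ U → ‖iteratedFDeriv ℝ i f x‖ ≤ C := by
    refine hK.induction_on (p := fun s => ∃ C : ℝ, ∀ x ∈ s, x ∈ U → ‖iteratedFDeriv ℝ i f x‖ ≤ C)
      ⟨0, by simp⟩ ?_ ?_ ?_
    · rintro s t hst ⟨C, hC⟩
      exact ⟨C, fun x hx => hC x (hst hx)⟩
    · rintro s t ⟨C, hC⟩ ⟨C', hC'⟩
      refine ⟨max C C', fun x hx hxU => ?_⟩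
      rcases hx with hx | hx
      · exact (hC x hx hxU).trans (le_max_left _ _)
      · exact (hC' x hx hxU).trans (le_max_right _ _)
    · intro x hx
      obtain ⟨u, hu, p, hp⟩ := contDiffWithinAt_nat.1 (hf x hx)
      rw [insert_eq_of_mem hx] at hu
      have hxu : x ∈ u := mem_of_mem_nhdsWithin hx hu
      have hc : ContinuousWithinAt (fun y => ‖p y i‖) u x :=
        ((hp.cont i (by exact_mod_cast hi)) x hxu).norm
      have h1 : ∀ᶠ y in 𝓝[u] x, ‖p y i‖ < ‖p x i‖ + 1 :=
        hc.eventually (gt_mem_nhds (by linarith))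
      have h2 : ∀ᶠ y in 𝓝[K] x, ‖p y i‖ < ‖p x i‖ + 1 := by
        rw [eventually_nhdsWithin_iff] at h1 ⊢
        rw [mem_nhdsWithin_iff_eventually] at hu
        filter_upwards [h1, hu] with y hy1 hy2 hyK using hy1 (hy2 hyK)
      obtain ⟨O, hO, hxO, hOu⟩ := mem_nhdsWithin.1 hu
      refine ⟨{y | ‖p y i‖ < ‖p x i‖ + 1} ∩ O,
        inter_mem h2 (mem_nhdsWithin_of_mem_nhds (hO.mem_nhds hxO)), ‖p x i‖ + 1, ?_⟩
      rintro y ⟨hy1, hyO⟩ hyU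
      have hop : IsOpen (O ∩ U) := hO.inter hU
      have := (hp.mono (show O ∩ U ⊆ u from fun z hz => hOu ⟨hz.1, hUK hz.2⟩)
        ).eq_iteratedFDerivWithin_of_uniqueDiffOn (m := i) (by exact_mod_cast hi)
        hop.uniqueDiffOn ⟨hyO, hyU⟩
      rw [iteratedFDerivWithin_of_isOpen i hop ⟨hyO, hyU⟩] at this
      rw [← this]
      exact le_of_lt hy1
  obtain ⟨C, hC⟩ := key
  exact ⟨C, fun x hx => hC x (hUK hx) hx⟩

theorem exists_mem_segment_frontier {E : Type*} [NormedAddCommGroup E] [NormedSpace ℝ E]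
    {A : Set E} {a b : E} (ha : a ∈ A) (hb : b ∉ A) : ∃ z ∈ segment ℝ a b, z ∈ frontier A := by
  by_contra! h
  have hd : Disjoint (segment ℝ a b) (frontier A) := Set.disjoint_left.2 h
  have hpre : IsPreconnected (segment ℝ a b) := (convex_segment a b).isPreconnected
  have hcov : segment ℝ a b ⊆ interior A ∪ (closure A)ᶜ := by
    intro z hz
    by_cases hzi : z ∈ interior A
    · exact Or.inl hzi
    · exact Or.inr fun hzc => h z hz ⟨hzc, hzi⟩
  obtain ⟨z, _, hz1, hz2⟩ := hpre _ _ isOpen_interior isClosed_closure.isOpen_compl hcov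
    ⟨a, left_mem_segment ℝ a b, (hcov (left_mem_segment ℝ a b)).resolve_right
      fun h => h (subset_closure ha)⟩
    ⟨b, right_mem_segment ℝ a b, (hcov (right_mem_segment ℝ a b)).resolve_left
      fun h => hb (interior_subset h)⟩
  exact hz2 (interior_subset_closure hz1)

/-! ### The unit square -/

theorem isOpen_openSquare : IsOpen openSquare := by
  have : openSquare = ⋂ l : Fin 2, {x : E2 | x l ∈ Ioo (0 : ℝ) 1} := by
    ext x; simp [openSquare]
  rw [this]
  exact isOpen_iInter_of_finite fun l => isOpen_Ioo.preimage (by fun_prop)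

theorem isCompact_closedSquare : IsCompact closedSquare := by
  refine Metric.isCompact_of_isClosed_isBounded ?_ ?_
  · have : closedSquare = ⋂ l : Fin 2, {x : E2 | x l ∈ Icc (0 : ℝ) 1} := by
      ext x; simp [closedSquare]
    rw [this]
    exact isClosed_iInter fun l => isClosed_Icc.preimage (by fun_prop)
  · refine (Metric.isBounded_closedBall (x := (0 : E2)) (r := 2)).subset fun x hx => ?_
    rw [mem_closedBall_zero_iff]
    refine le_of_sq_le_sq ?_ (by norm_num)
    rw [E2_norm_sq]
    nlinarith [(hx 0).1, (hx 0).2, (hx 1).1, (hx 1).2]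

theorem convex_openSquare : Convex ℝ openSquare := by
  have : openSquare = ⋂ l : Fin 2, (EuclideanSpace.proj l : E2 →L[ℝ] ℝ) ⁻¹' Ioo (0 : ℝ) 1 := by
    ext x; simp [openSquare]
  rw [this]
  exact convex_iInter fun l => (convex_Ioo 0 1).linear_preimage
    (EuclideanSpace.proj l : E2 →L[ℝ] ℝ).toLinearMap

theorem openSquare_subset_closedSquare : openSquare ⊆ closedSquare :=
  fun _ hx l => Ioo_subset_Icc_self (hx l)

theorem closedSquare_subset_closure : closedSquare ⊆ closure openSquare := by
  intro x hx
  set c : E2 := !₂[1 / 2, 1 / 2] with hc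
  have hcl : ∀ l : Fin 2, c l = 1 / 2 := by intro l; fin_cases l <;> simp [c]
  have h1 : openSegment ℝ x c ⊆ openSquare := by
    rintro _ ⟨a, b, ha, hb, hab, rfl⟩ l
    have := hx l
    simp only [PiLp.add_apply, PiLp.smul_apply, smul_eq_mul, hcl, mem_Ioo]
    constructor <;> nlinarith [this.1, this.2]
  exact closure_mono h1 (segment_subset_closure_openSegment (left_mem_segment ℝ x c))

theorem volume_closedSquare_diff : volume (closedSquare \ openSquare) = 0 := by
  have hpl : ∀ (l : Fin 2) (c : ℝ), volume {x : E2 | x l = c} = 0 := by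
    intro l c
    have h := (EuclideanSpace.volume_preserving_symm_measurableEquiv_toLp (Fin 2)).measure_preimage
      (s := {f : Fin 2 → ℝ | f l = c})
      (measurableSet_eq_fun (by fun_prop) (by fun_prop)).nullMeasurableSet
    rw [volume_pi, Measure.pi_hyperplane] at h
    exact h
  refine measure_mono_null (t := ⋃ l : Fin 2, {x : E2 | x l = 0} ∪ {x | x l = 1}) ?_ ?_
  · rintro x ⟨hx, hx'⟩
    simp only [openSquare, mem_ofPred_eq, not_forall] at hx'
    obtain ⟨l, hl⟩ := hx'
    refine mem_iUnion.2 ⟨l, ?_⟩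
    have := hx l
    by_contra hcon
    simp only [mem_union, mem_ofPred_eq, not_or] at hcon
    exact hl ⟨lt_of_le_of_ne this.1 (Ne.symm hcon.1), lt_of_le_of_ne this.2 hcon.2⟩
  · exact measure_iUnion_null fun l => measure_union_null (hpl l 0) (hpl l 1)

/-- The pairing and the moments are integrals over the closed square; this moves them to the open
one, where the parametrization has ordinary derivatives. -/
theorem restrict_closedSquare :
    (volume : Measure E2).restrict closedSquare = volume.restrict openSquare := by
  refine Measure.restrict_congr_set ?_
  refine (ae_eq_set.2 ⟨volume_closedSquare_diff, ?_⟩)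
  rw [sdiff_eq_empty.2 openSquare_subset_closedSquare, measure_empty]

namespace QuadPatch

variable {m : ℕ} (F : QuadPatch m)

theorem isCompact_closure_dom : IsCompact (closure F.dom) := F.dom_bounded.isCompact_closure

theorem frame_isometry : Isometry F.frame := F.frame.isometry

theorem measurableEmbedding_frame : MeasurableEmbedding F.frame :=
  F.frame_isometry.isClosedEmbedding.measurableEmbedding

theorem face_subset_closedFace : F.face ⊆ F.closedFace := image_mono subset_closure

theorem closedFace_eq : F.closedFace = F.face ∪ F.rim := by
  rw [closedFace, face, rim, ← image_union, closure_eq_self_union_frontier]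

theorem disjoint_face_rim : Disjoint F.face F.rim := by
  refine (Set.disjoint_image_iff F.frame.injective).2 ?_
  rw [F.dom_open.frontier_eq]
  exact disjoint_sdiff_right

theorem isCompact_closedFace : IsCompact F.closedFace :=
  F.isCompact_closure_dom.image F.frame.continuous

theorem isCompact_rim : IsCompact F.rim :=
  (F.isCompact_closure_dom.of_isClosed_subset isClosed_frontier frontier_subset_closure).image
    F.frame.continuous

theorem param_contDiffOn : ContDiffOn ℝ m F.param openSquare :=
  F.param_smooth.mono openSquare_subset_closedSquare

theorem exists_norm_iteratedFDeriv_param_le : ∃ K : ℝ, 1 ≤ K ∧ ∀ x ∈ openSquare, ∀ i, 1 ≤ i →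
    i ≤ m → ‖iteratedFDeriv ℝ i F.param x‖ ≤ K ^ i := by
  have h : ∀ i : Fin (m + 1), ∃ C : ℝ, ∀ x ∈ openSquare, ‖iteratedFDeriv ℝ i F.param x‖ ≤ C :=
    fun i => exists_bound_iteratedFDeriv isCompact_closedSquare isOpen_openSquare
      openSquare_subset_closedSquare F.param_smooth (Nat.lt_succ_iff.1 i.2)
  choose C hC using h
  have hK : 1 ≤ 1 + ∑ i, |C i| := le_add_of_nonneg_right (Finset.sum_nonneg fun _ _ => abs_nonneg _)
  refine ⟨1 + ∑ i, |C i|, hK, fun x hx i h1 h2 => ?_⟩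
  have h3 := hC ⟨i, by omega⟩ x hx
  have h4 := Finset.single_le_sum (f := fun i => |C i|) (fun _ _ => abs_nonneg _)
    (Finset.mem_univ (⟨i, by omega⟩ : Fin (m + 1)))
  calc ‖iteratedFDeriv ℝ i F.param x‖ ≤ 1 + ∑ i, |C i| := by
        have := le_abs_self (C ⟨i, by omega⟩)
        simp only at h3 h4
        linarith
    _ ≤ _ := le_self_pow₀ hK (by omega)

/-- Derivatives of functions that are lifted to the unit square. -/
theorem exists_norm_iteratedFDeriv_comp_param_le (n : ℕ) (hn : 1 ≤ n) (hnm : n ≤ m) :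
    ∃ C : ℝ, 0 < C ∧ ∀ h : E2 → ℂ, ContDiffOn ℝ ∞ h F.dom → ∀ x ∈ openSquare,
      ‖iteratedFDeriv ℝ n (h ∘ F.param) x‖ ≤
        C * ∑ l ∈ Finset.Icc 1 n, ‖iteratedFDeriv ℝ l h (F.param x)‖ := by
  obtain ⟨K, hK1, hK⟩ := F.exists_norm_iteratedFDeriv_param_le
  refine ⟨n.factorial * K ^ n, by positivity, fun h hh x hx => ?_⟩
  refine (norm_iteratedFDeriv_comp_le_of_isOpen hn isOpen_openSquare F.dom_open
    (hh.of_le ENat.LEInfty.out) (F.param_contDiffOn.of_le (by exact_mod_cast hnm))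
    F.param_open.mapsTo hx (C := ∑ l ∈ Finset.Icc 1 n, ‖iteratedFDeriv ℝ l h (F.param x)‖) (D := K)
    (fun i h1 h2 => ?_) fun i h1 h2 => hK x hx i h1 (h2.trans hnm)).trans_eq (by ring)
  exact Finset.single_le_sum (f := fun l => ‖iteratedFDeriv ℝ l h (F.param x)‖)
    (fun _ _ => norm_nonneg _) (Finset.mem_Icc.2 ⟨h1, h2⟩)

/-- A bounded derivative on the convex open square gives the Lipschitz estimate there, and
continuity extends it to the closed square. -/
theorem exists_lipschitz_param (hm : 1 ≤ m) :
    ∃ L : ℝ≥0, 0 < L ∧ LipschitzOnWith L F.param closedSquare := by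
  obtain ⟨K, hK1, hK⟩ := F.exists_norm_iteratedFDeriv_param_le
  have hd : ∀ x ∈ openSquare, ‖fderiv ℝ F.param x‖₊ ≤ K.toNNReal := by
    intro x hx
    rw [← NNReal.coe_le_coe, Real.coe_toNNReal _ (by linarith), coe_nnnorm,
      ← norm_iteratedFDeriv_one]
    simpa using hK x hx 1 le_rfl hm
  refine ⟨K.toNNReal, by simpa using by linarith, ?_⟩
  have hLip : LipschitzOnWith K.toNNReal F.param openSquare :=
    convex_openSquare.lipschitzOnWith_of_nnnorm_fderiv_le (fun x hx =>
      (F.param_contDiffOn.contDiffAt (isOpen_openSquare.mem_nhds hx)).differentiableAt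
        (by exact_mod_cast (by omega : m ≠ 0))) hd
  refine LipschitzOnWith.mono ?_ (Subset.refl _)
  intro x hx y hy
  have hcx : ContinuousOn F.param closedSquare := F.param_smooth.continuousOn
  have hx' : (𝓝[openSquare] x).NeBot := mem_closure_iff_nhdsWithin_neBot.1
    (closedSquare_subset_closure hx)
  have hy' : (𝓝[openSquare] y).NeBot := mem_closure_iff_nhdsWithin_neBot.1
    (closedSquare_subset_closure hy)
  have hp : (𝓝[openSquare] x ×ˢ 𝓝[openSquare] y).NeBot := inferInstance
  have tx : Tendsto F.param (𝓝[openSquare] x) (𝓝 (F.param x)) :=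
    (hcx x hx).mono_left (nhdsWithin_mono _ openSquare_subset_closedSquare)
  have ty : Tendsto F.param (𝓝[openSquare] y) (𝓝 (F.param y)) :=
    (hcx y hy).mono_left (nhdsWithin_mono _ openSquare_subset_closedSquare)
  have t1 : Tendsto (fun q : E2 × E2 => edist (F.param q.1) (F.param q.2))
      (𝓝[openSquare] x ×ˢ 𝓝[openSquare] y) (𝓝 (edist (F.param x) (F.param y))) :=
    (tx.comp tendsto_fst).edist (ty.comp tendsto_snd)
  have t2 : Tendsto (fun q : E2 × E2 => (K.toNNReal : ℝ≥0∞) * edist q.1 q.2)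
      (𝓝[openSquare] x ×ˢ 𝓝[openSquare] y) (𝓝 (K.toNNReal * edist x y)) := by
    refine ENNReal.Tendsto.const_mul ?_ (Or.inr ENNReal.coe_ne_top)
    exact ((tendsto_id.mono_left nhdsWithin_le_nhds).comp tendsto_fst).edist
      ((tendsto_id.mono_left nhdsWithin_le_nhds).comp tendsto_snd)
  refine le_of_tendsto_of_tendsto t1 t2 ?_
  filter_upwards [prod_mem_prod (self_mem_nhdsWithin (a := x) (s := openSquare))
    (self_mem_nhdsWithin (a := y) (s := openSquare))] with q hq
  exact hLip hq.1 hq.2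

/-- A `C^m` inverse of the parametrization. -/
def paramInv : E2 → E2 := F.param_inv_smooth.choose

theorem paramInv_contDiffOn : ContDiffOn ℝ m F.paramInv (closure F.dom) :=
  F.param_inv_smooth.choose_spec.1

theorem paramInv_param {x : E2} (hx : x ∈ closedSquare) : F.paramInv (F.param x) = x :=
  F.param_inv_smooth.choose_spec.2 hx

theorem paramInv_mem {y : E2} (hy : y ∈ F.dom) : F.paramInv y ∈ openSquare := by
  obtain ⟨x, hx, rfl⟩ := F.param_open.surjOn hy
  rwa [F.paramInv_param (openSquare_subset_closedSquare hx)]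

theorem param_paramInv {y : E2} (hy : y ∈ F.dom) : F.param (F.paramInv y) = y := by
  obtain ⟨x, hx, rfl⟩ := F.param_open.surjOn hy
  rw [F.paramInv_param (openSquare_subset_closedSquare hx)]

theorem exists_norm_fderiv_paramInv_le (hm : 1 ≤ m) :
    ∃ C : ℝ≥0, 0 < C ∧ ∀ y ∈ F.dom, ‖fderiv ℝ F.paramInv y‖ ≤ C := by
  obtain ⟨C, hC⟩ := exists_bound_iteratedFDeriv F.isCompact_closure_dom F.dom_open subset_closure
    F.paramInv_contDiffOn hm
  refine ⟨(|C| + 1).toNNReal, by simp, fun y hy => ?_⟩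
  rw [← norm_iteratedFDeriv_one, Real.coe_toNNReal _ (by positivity)]
  linarith [hC y hy, le_abs_self C]

/-- The Jacobian of the parametrization is bounded below, because that of the inverse is bounded
above and their product is one. -/
theorem exists_lintegral_comp_param_le (hm : 1 ≤ m) : ∃ C : ℝ≥0, 0 < C ∧
    ∀ A ⊆ openSquare, MeasurableSet A → ∀ g : E2 → ℝ≥0∞,
      ∫⁻ x in A, g (F.param x) ≤ C * ∫⁻ y in F.param '' A, g y := by
  obtain ⟨C, hC0, hC⟩ := F.exists_norm_fderiv_paramInv_le hm
  -- The determinant is continuous, hence bounded on the compact ball of operators of norm at most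
  -- `C`.
  obtain ⟨M, hM⟩ := ((ProperSpace.isCompact_closedBall (0 : E2 →L[ℝ] E2) C).image
    ContinuousLinearMap.continuous_det).isBounded.exists_norm_le
  have hdp : ∀ x ∈ openSquare, DifferentiableAt ℝ F.param x := fun x hx =>
    (F.param_contDiffOn.contDiffAt (isOpen_openSquare.mem_nhds hx)).differentiableAt
      (by exact_mod_cast (by omega : m ≠ 0))
  have hdi : ∀ y ∈ F.dom, DifferentiableAt ℝ F.paramInv y := fun y hy =>
    ((F.paramInv_contDiffOn.mono subset_closure).contDiffAt
      (F.dom_open.mem_nhds hy)).differentiableAt (by exact_mod_cast (by omega : m ≠ 0))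
  have hdet : ∀ x ∈ openSquare, 1 ≤ (|M| + 1) * |(fderiv ℝ F.param x).det| := by
    intro x hx
    have hy := F.param_open.mapsTo hx
    have hcomp : (fderiv ℝ F.paramInv (F.param x)).comp (fderiv ℝ F.param x) =
        ContinuousLinearMap.id ℝ E2 := by
      rw [← fderiv_comp x (hdi _ hy) (hdp x hx)]
      have : F.paramInv ∘ F.param =ᶠ[𝓝 x] id := by
        filter_upwards [isOpen_openSquare.mem_nhds hx] with z hz
        exact F.paramInv_param (openSquare_subset_closedSquare hz)
      rw [this.fderiv_eq, fderiv_id]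
    have h1 : (fderiv ℝ F.paramInv (F.param x)).det * (fderiv ℝ F.param x).det = 1 := by
      have := congrArg ContinuousLinearMap.det hcomp
      simpa [ContinuousLinearMap.det, LinearMap.det_comp] using this
    have h2 : |(fderiv ℝ F.paramInv (F.param x)).det| ≤ |M| + 1 := by
      have := hM _ (mem_image_of_mem _ (mem_closedBall_zero_iff.2 (hC _ hy)))
      rw [Real.norm_eq_abs] at this
      linarith [le_abs_self M]
    calc (1 : ℝ) = |(fderiv ℝ F.paramInv (F.param x)).det * (fderiv ℝ F.param x).det| := by
          rw [h1, abs_one]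
      _ ≤ _ := by rw [abs_mul]; gcongr
  refine ⟨(|M| + 1).toNNReal, by simp, fun A hA hAm g => ?_⟩
  rw [lintegral_image_eq_lintegral_abs_det_fderiv_mul volume hAm
    (fun x hx => (hdp x (hA hx)).hasFDerivAt.hasFDerivWithinAt)
    (F.param_open.injOn.mono hA), ← lintegral_const_mul' _ _ ENNReal.coe_ne_top]
  refine setLIntegral_mono' hAm fun x hx => ?_
  rw [← mul_assoc]
  calc g (F.param x) = 1 * g (F.param x) := (one_mul _).symm
    _ ≤ _ := by
      gcongr
      change 1 ≤ ENNReal.ofReal (|M| + 1) * _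
      rw [← ENNReal.ofReal_mul (by positivity), ← ENNReal.ofReal_one]
      exact ENNReal.ofReal_le_ofReal (hdet x (hA hx))

end QuadPatch

/-! ### Weighted derivatives near a vertex -/

theorem mixedDeriv_congr {V : Set (ℝ × ℝ)} (hV : IsOpen V) {f g : ℝ → ℝ → ℂ}
    (h : ∀ p ∈ V, f p.1 p.2 = g p.1 p.2) (a b : ℕ) {p : ℝ × ℝ} (hp : p ∈ V) :
    mixedDeriv a b f p.1 p.2 = mixedDeriv a b g p.1 p.2 := by
  refine Filter.EventuallyEq.iteratedDeriv_eq a ?_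
  have h1 : ∀ᶠ r in 𝓝 p.1, (r, p.2) ∈ V :=
    (Continuous.prodMk_left p.2).continuousAt.eventually (hV.mem_nhds hp)
  filter_upwards [h1] with r hr
  refine Filter.EventuallyEq.iteratedDeriv_eq b ?_
  have h2 : ∀ᶠ φ in 𝓝 p.2, (r, φ) ∈ V :=
    (Continuous.prodMk_right r).continuousAt.eventually (hV.mem_nhds hr)
  filter_upwards [h2] with φ hφ using h (r, φ) hφ

theorem ENNReal.sum_sq_le {ι : Type*} (s : Finset ι) (f : ι → ℝ≥0∞) :
    (∑ i ∈ s, f i) ^ 2 ≤ s.card * ∑ i ∈ s, f i ^ 2 := by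
  have := ENNReal.rpow_sum_le_const_mul_sum_rpow s f (p := 2) (by norm_num)
  norm_num at this
  exact this

theorem norm_weightedDeriv (γ ρ μ : ℝ) (a b : ℕ) (f : ℝ → ℝ → ℂ) {r φ : ℝ} (hr : 0 < r)
    (hφ : φ ∈ Ioo 0 γ) : ‖weightedDeriv γ ρ μ a b f r φ‖ = r ^ (-μ) * (1 + r) ^ μ *
      (min φ (γ - φ) * r) ^ a * min φ (γ - φ) ^ ((b : ℝ) - ρ) * ‖mixedDeriv a b f r φ‖ := by
  have hq : 0 < min φ (γ - φ) := lt_min hφ.1 (by linarith [hφ.2])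
  rw [weightedDeriv, norm_mul, Complex.norm_real, Real.norm_of_nonneg (by positivity)]
  rfl

/-- After multiplication by `(r q)^ρ` the weights leave `(1 + r)^ρ q^(a+b) r^a`. The first factor is
at least one, and `q^(a+b)` is compensated by `4^l q^(-l)`, since `q ≤ π ≤ 4` and `a + b ≤ l`. -/
theorem pow_mul_norm_mixedDeriv_le {γ ρ : ℝ} (hγ : γ ≤ 2 * Real.pi) (hρ : 0 ≤ ρ) {a b l : ℕ}
    (hab : a + b ≤ l) (f : ℝ → ℝ → ℂ) {r φ : ℝ} (hr : 0 < r) (hφ : φ ∈ Ioo 0 γ) :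
    r ^ a * ‖mixedDeriv a b f r φ‖ ≤ 4 ^ l * (min φ (γ - φ))⁻¹ ^ l *
      (r * min φ (γ - φ)) ^ ρ * ‖weightedDeriv γ ρ ρ a b f r φ‖ := by
  rw [norm_weightedDeriv γ ρ ρ a b f hr hφ]
  set q := min φ (γ - φ) with hqdef
  have hq : 0 < q := lt_min hφ.1 (by linarith [hφ.2])
  have hq4 : q ≤ 4 := by
    have h1 : q ≤ φ := min_le_left _ _
    have h2 : q ≤ γ - φ := min_le_right _ _
    linarith [Real.pi_le_four]
  have h1 : 1 ≤ (1 + r) ^ ρ := Real.one_le_rpow (by linarith) hρ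
  have h2 : r ^ (-ρ) * r ^ ρ = 1 := by
    rw [← Real.rpow_add hr]; simp
  have h3 : q ^ ((b : ℝ) - ρ) * q ^ ρ = q ^ b := by
    rw [← Real.rpow_add hq]; simp
  have h4 : 1 ≤ 4 ^ l * q⁻¹ ^ l * q ^ (a + b) := by
    have : (q / 4) ^ l ≤ (q / 4) ^ (a + b) :=
      pow_le_pow_of_le_one (by positivity) (by linarith) hab
    have h5 : (4 : ℝ) ^ l * q⁻¹ ^ l * (q / 4) ^ l = 1 := by
      rw [← mul_pow, ← mul_pow]; field_simp; simp
    have h6 : (q / 4) ^ (a + b) ≤ q ^ (a + b) := by gcongr; linarith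
    calc (1 : ℝ) = (4 : ℝ) ^ l * q⁻¹ ^ l * (q / 4) ^ l := h5.symm
      _ ≤ _ := by gcongr; exact this.trans h6
  rw [Real.mul_rpow hr.le hq.le]
  calc r ^ a * ‖mixedDeriv a b f r φ‖ = 1 * 1 * (r ^ a * ‖mixedDeriv a b f r φ‖) := by ring
    _ ≤ (1 + r) ^ ρ * (4 ^ l * q⁻¹ ^ l * q ^ (a + b)) * (r ^ a * ‖mixedDeriv a b f r φ‖) := by
        gcongr
    _ = 4 ^ l * q⁻¹ ^ l * (r ^ ρ * q ^ ρ) * (r ^ (-ρ) * (1 + r) ^ ρ * (q * r) ^ a *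
        q ^ ((b : ℝ) - ρ) * ‖mixedDeriv a b f r φ‖) := by
        have e : 4 ^ l * q⁻¹ ^ l * (r ^ ρ * q ^ ρ) * (r ^ (-ρ) * (1 + r) ^ ρ * (q * r) ^ a *
          q ^ ((b : ℝ) - ρ) * ‖mixedDeriv a b f r φ‖) = 4 ^ l * q⁻¹ ^ l * (r ^ (-ρ) * r ^ ρ) *
          (q ^ ((b : ℝ) - ρ) * q ^ ρ) * (1 + r) ^ ρ * q ^ a * r ^ a *
          ‖mixedDeriv a b f r φ‖ := by rw [mul_pow]; ring
        rw [e, h2, h3, pow_add]; ring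

/-- The index set of the derivatives of orders `1, …, k`. -/
def derivIndices (k : ℕ) : Finset (ℕ × ℕ) :=
  (Finset.range (k + 1) ×ˢ Finset.range (k + 1)).filter
    (fun β => 1 ≤ β.1 + β.2 ∧ β.1 + β.2 ≤ k)

theorem mem_derivIndices {k : ℕ} {β : ℕ × ℕ} :
    β ∈ derivIndices k ↔ 1 ≤ β.1 + β.2 ∧ β.1 + β.2 ≤ k := by
  simp only [derivIndices, Finset.mem_filter, Finset.mem_product, Finset.mem_range]
  omega

/-- The angular weights cost `q^(-l)`, the passage from polar to Cartesian coordinates costs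
`r^(-l)`, and together with `(r q)^ρ` they form the power `(r q)^(ρ-l)`. -/
theorem exists_norm_iteratedFDeriv_le_weightedDeriv (k : ℕ) {ρ : ℝ} (hρ : 0 < ρ) : ∃ C : ℝ, 0 < C ∧
    ∀ (v : E2) (θ γ : ℝ) (U : Set E2) (h : E2 → ℂ), γ ≤ 2 * Real.pi → IsOpen U →
    ContDiffOn ℝ ∞ h U → ∀ r φ : ℝ, 0 < r → φ ∈ Ioo 0 γ → polarPoint v θ r φ ∈ U →
    ∀ l, 1 ≤ l → l ≤ k → ‖iteratedFDeriv ℝ l h (polarPoint v θ r φ)‖ ≤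
      C * (r * min φ (γ - φ)) ^ (ρ - l) * ∑ β ∈ derivIndices k,
        ‖weightedDeriv γ ρ ρ β.1 β.2 (fun r φ => h (polarPoint v θ r φ)) r φ‖ := by
  choose C hC0 hC using exists_norm_iteratedFDeriv_le_polar
  have hCs : ∀ l ∈ Finset.range (k + 1), C l ≤ ∑ l ∈ Finset.range (k + 1), C l := fun l hl =>
    Finset.single_le_sum (fun l _ => (hC0 l).le) hl
  have hCpos : 0 < ∑ l ∈ Finset.range (k + 1), C l :=
    Finset.sum_pos (fun l _ => hC0 l) ⟨0, by simp⟩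
  refine ⟨(∑ l ∈ Finset.range (k + 1), C l) * 4 ^ k, by positivity, ?_⟩
  intro v θ γ U h hγ hU hh r φ hr hφ hx l h1 hl
  set q := min φ (γ - φ) with hqdef
  have hq : 0 < q := lt_min hφ.1 (by linarith [hφ.2])
  set W := ∑ β ∈ derivIndices k,
        ‖weightedDeriv γ ρ ρ β.1 β.2 (fun r φ => h (polarPoint v θ r φ)) r φ‖ with hW
  have hW0 : 0 ≤ W := Finset.sum_nonneg fun _ _ => norm_nonneg _
  have hM : ∀ a b, 1 ≤ a + b → a + b ≤ l →
      r ^ a * ‖mixedDeriv a b (fun r φ => h (polarPoint v θ r φ)) r φ‖ ≤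
        4 ^ l * q⁻¹ ^ l * (r * q) ^ ρ * W := by
    intro a b hab1 hab2
    refine (pow_mul_norm_mixedDeriv_le hγ hρ.le hab2 _ hr hφ).trans ?_
    gcongr
    exact Finset.single_le_sum (f := fun β : ℕ × ℕ => ‖weightedDeriv γ ρ ρ β.1 β.2
      (fun r φ => h (polarPoint v θ r φ)) r φ‖) (fun _ _ => norm_nonneg _)
      (mem_derivIndices.2 ⟨hab1, hab2.trans hl⟩ : (a, b) ∈ derivIndices k)
  refine (hC l v θ U h hU hh r φ hr hx _ hM l h1 le_rfl).trans ?_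
  have e : (r * q) ^ (ρ - l) = (r * q) ^ ρ * (q⁻¹ ^ l * r⁻¹ ^ l) := by
    rw [Real.rpow_sub (by positivity), Real.rpow_natCast, div_eq_mul_inv, mul_pow, mul_inv,
      inv_pow, inv_pow]
    ring
  rw [e]
  calc C l * (4 ^ l * q⁻¹ ^ l * (r * q) ^ ρ * W) * r⁻¹ ^ l
      = C l * 4 ^ l * ((r * q) ^ ρ * (q⁻¹ ^ l * r⁻¹ ^ l)) * W := by ring
    _ ≤ _ := by
      gcongr
      · exact hCs l (by simp; omega)
      · norm_num

/-! ### Incidence of patches, edges and vertices -/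

namespace PolySurface

variable {m : ℕ} (S : PolySurface m)

theorem closedFace_subset_frontier (i : Fin S.I) : (S.patch i).closedFace ⊆ frontier S.Ω := by
  rw [S.boundary]; exact subset_iUnion (fun i => (S.patch i).closedFace) i

theorem rim_subset_interface (i : Fin S.I) : (S.patch i).rim ⊆ S.interface :=
  subset_iUnion (fun i => (S.patch i).rim) i

theorem isCompact_interface : IsCompact S.interface :=
  isCompact_iUnion fun i => (S.patch i).isCompact_rim

end PolySurface

namespace QuadPatch

variable {m : ℕ} (F : QuadPatch m)

theorem edge_eq (a : Fin 4) : F.edge a = F.frame '' segment ℝ (F.corner a) (F.corner (a + 1)) := by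
  rw [edge, vert, vert]
  exact (image_segment ℝ F.frame.toAffineMap _ _).symm

theorem edge_subset_rim (a : Fin 4) : F.edge a ⊆ F.rim := by
  rw [edge_eq, rim, F.dom_frontier]
  exact image_mono (subset_iUnion (fun k => segment ℝ (F.corner k) (F.corner (k + 1))) a)

theorem vert_mem_rim (a : Fin 4) : F.vert a ∈ F.rim :=
  F.edge_subset_rim a (left_mem_segment ℝ _ _)

theorem corner_mem_closure (a : Fin 4) : F.corner a ∈ closure F.dom := by
  refine frontier_subset_closure ?_
  rw [F.dom_frontier]
  exact mem_iUnion.2 ⟨a, left_mem_segment ℝ _ _⟩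

/-- The other two corners lie on the opposite edge, which is disjoint from this one. -/
theorem eq_of_vert_mem_edge {k b : Fin 4} (h : F.vert k ∈ F.edge b) : k = b ∨ k = b + 1 := by
  rw [edge_eq] at h
  obtain ⟨y, hy, hyk⟩ := h
  have hyk : y = F.corner k := F.frame.injective hyk
  subst hyk
  have hd := Set.disjoint_left.1 (F.opposite_edges b) hy
  have : k = b ∨ k = b + 1 ∨ k = b + 2 ∨ k = b + 3 := by
    have : ∀ k b : Fin 4, k = b ∨ k = b + 1 ∨ k = b + 2 ∨ k = b + 3 := by decide
    exact this k b
  rcases this with h | h | h | h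
  · exact Or.inl h
  · exact Or.inr h
  · rw [h] at hd; exact absurd (left_mem_segment ℝ _ _) hd
  · rw [h] at hd; exact absurd (right_mem_segment ℝ _ _) hd

theorem sector_eq (k : Fin 4) :
    F.sector k = F.frame '' planarSector (F.corner k) (F.theta k) (F.angle k) := by
  ext x
  constructor
  · rintro ⟨r, hr, φ, hφ, rfl⟩; exact ⟨_, ⟨r, hr, φ, hφ, rfl⟩, rfl⟩
  · rintro ⟨_, ⟨r, hr, φ, hφ, rfl⟩, rfl⟩; exact ⟨r, hr, φ, hφ, rfl⟩

end QuadPatch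

/-- An end point is extreme. Writing `u` as a combination of `x` and `y`, and these as `u` plus
nonnegative multiples of `v - u`, forces the multiples with positive weight to vanish. -/
theorem left_eq_of_segment_eq {E : Type*} [AddCommGroup E] [Module ℝ E] {x y u v : E}
    (h : segment ℝ x y = segment ℝ u v) : u = x ∨ u = y := by
  have hu : u ∈ segment ℝ x y := h ▸ left_mem_segment ℝ u v
  have hx : x ∈ segment ℝ u v := h ▸ left_mem_segment ℝ x y
  have hy : y ∈ segment ℝ u v := h ▸ right_mem_segment ℝ x y
  rw [segment_eq_image'] at hu hx hy
  obtain ⟨t, ht, htu⟩ := hu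
  obtain ⟨a, ha, hax⟩ := hx
  obtain ⟨b, hb, hby⟩ := hy
  simp only at htu hax hby
  by_cases huv : v - u = 0
  · left; rw [← hax, huv]; simp
  have h1 : ((1 - t) * a + t * b) • (v - u) = 0 := by
    have : u = u + ((1 - t) * a + t * b) • (v - u) := by
      conv_lhs => rw [← htu, ← hax, ← hby]
      module
    simpa using this
  have h2 : (1 - t) * a + t * b = 0 := (smul_eq_zero.1 h1).resolve_right huv
  have h3 : 0 ≤ (1 - t) * a := mul_nonneg (by linarith [ht.2]) ha.1
  have h4 : 0 ≤ t * b := mul_nonneg ht.1 hb.1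
  have h5 : (1 - t) * a = 0 := by linarith
  rcases mul_eq_zero.1 h5 with h6 | h6
  · right
    have : t = 1 := by linarith
    rw [← htu, this]; simp
  · left
    rw [← hax, h6]; simp

namespace PolySurface

variable {m : ℕ} (S : PolySurface m)

theorem disjoint_face_closedFace {i l : Fin S.I} (hil : i ≠ l) :
    Disjoint (S.patch i).face (S.patch l).closedFace := by
  rw [Set.disjoint_left]
  intro x hx hxl
  have hmem : x ∈ (S.patch i).closedFace ∩ (S.patch l).closedFace :=
    ⟨(S.patch i).face_subset_closedFace hx, hxl⟩
  have hnr : x ∉ (S.patch i).rim := Set.disjoint_left.1 (S.patch i).disjoint_face_rim hx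
  rcases S.meet i l hil with h | ⟨a, b, _, h⟩ | ⟨a, b, _, h⟩
  · rw [h] at hmem; exact hmem
  · rw [h] at hmem; exact hnr ((S.patch i).edge_subset_rim a hmem)
  · rw [h] at hmem
    rw [mem_singleton_iff.1 hmem] at hnr
    exact hnr ((S.patch i).vert_mem_rim a)

/-- There are no hanging vertices: two patches share whole edges, and equal segments have the same
end points. Hence the sectors at `ν` account for every patch that touches `ν`. -/
theorem exists_vert_eq {ν : E3} (hν : ν ∈ S.verts) {i : Fin S.I}
    (hi : ν ∈ (S.patch i).closedFace) : ∃ t, (S.patch i).vert t = ν := by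
  classical
  obtain ⟨⟨l, k⟩, -, hlk⟩ := Finset.mem_image.1 hν
  simp only at hlk
  by_cases hil : i = l
  · subst hil; exact ⟨k, hlk⟩
  have hl : ν ∈ (S.patch l).closedFace := by
    rw [← hlk, QuadPatch.closedFace_eq]; exact Or.inr ((S.patch l).vert_mem_rim k)
  have hmem : ν ∈ (S.patch i).closedFace ∩ (S.patch l).closedFace := ⟨hi, hl⟩
  rcases S.meet i l hil with h | ⟨a, b, hab, h⟩ | ⟨a, b, _, h⟩
  · rw [h] at hmem; exact absurd hmem (notMem_empty _)
  · rw [h] at hmem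
    have hseg : segment ℝ ((S.patch i).vert a) ((S.patch i).vert (a + 1)) =
      segment ℝ ((S.patch l).vert b) ((S.patch l).vert (b + 1)) := hab
    rw [hab, ← hlk] at hmem
    rcases (S.patch l).eq_of_vert_mem_edge hmem with rfl | rfl
    · rcases left_eq_of_segment_eq hseg with h | h
      · exact ⟨a, by rw [← hlk, h]⟩
      · exact ⟨a + 1, by rw [← hlk, h]⟩
    · rw [segment_symm ℝ ((S.patch l).vert b)] at hseg
      rcases left_eq_of_segment_eq hseg with h | h
      · exact ⟨a, by rw [← hlk, h]⟩
      · exact ⟨a + 1, by rw [← hlk, h]⟩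
  · rw [h] at hmem
    exact ⟨a, (mem_singleton_iff.1 hmem).symm⟩

end PolySurface

/-! ### Control of Cartesian derivatives by the weighted norm -/

namespace PolySurface

variable {m : ℕ} (S : PolySurface m)

theorem sectorL2_le_coneNorm (k : ℕ) (ρ μ : ℝ) (ν : E3) (f : Fin S.I × Fin 4 → ℝ → ℝ → ℂ)
    {c : Fin S.I × Fin 4} (hc : c ∈ S.cornersAt ν) {β : ℕ × ℕ} (hβ : β ∈ derivIndices k) :
    sectorL2 ((S.patch c.1).angle c.2)
      (weightedDeriv ((S.patch c.1).angle c.2) ρ μ β.1 β.2 (f c)) ≤ S.coneNorm k ρ μ ν f := by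
  have h1 := Finset.single_le_sum (f := fun β : ℕ × ℕ => sectorL2 ((S.patch c.1).angle c.2)
      (weightedDeriv ((S.patch c.1).angle c.2) ρ μ β.1 β.2 (f c))) (fun _ _ => zero_le) hβ
  have h2 := Finset.single_le_sum (f := fun c : Fin S.I × Fin 4 => ∑ β ∈ derivIndices k,
      sectorL2 ((S.patch c.1).angle c.2)
      (weightedDeriv ((S.patch c.1).angle c.2) ρ μ β.1 β.2 (f c))) (fun _ _ => zero_le) hc
  rw [coneNorm]
  exact (h1.trans h2).trans (le_add_left le_rfl)

end PolySurface

namespace PolySurface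

variable {m : ℕ} (S : PolySurface m)

/-- The distance to the patch interfaces. -/
def distInterface (x : E3) : ℝ := Metric.infDist x S.interface

theorem distInterface_nonneg (x : E3) : 0 ≤ S.distInterface x := Metric.infDist_nonneg

theorem continuous_distInterface : Continuous S.distInterface := Metric.continuous_infDist_pt _

theorem distInterface_le_dist {x y : E3} (hy : y ∈ S.interface) : S.distInterface x ≤ dist x y :=
  Metric.infDist_le_dist_of_mem hy

/-- A path within the plane of a patch that leaves the patch is longer than the distance to the
interface. -/
theorem distInterface_le_of_notMem {i : Fin S.I} {y p : E2} (hy : y ∈ (S.patch i).dom)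
    (hp : p ∉ (S.patch i).dom) : S.distInterface ((S.patch i).frame y) ≤ dist y p := by
  obtain ⟨z, hz, hzf⟩ := exists_mem_segment_frontier hy hp
  refine (S.distInterface_le_dist (S.rim_subset_interface i (mem_image_of_mem _ hzf))).trans ?_
  rw [(S.patch i).frame_isometry.dist_eq]
  have := dist_add_dist_of_mem_segment hz
  linarith [dist_nonneg (x := z) (y := p)]

namespace SpecialResolution

variable {S} (R : S.SpecialResolution)

/-- The product of `w` with the localizing function of `ν` in the plane of a patch. -/
def piece (w : E3 → ℂ) (ν : E3) (i : Fin S.I) (y : E2) : ℂ :=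
  (R.fn ν ((S.patch i).frame y) : ℂ) * w ((S.patch i).frame y)

theorem contDiffOn_piece {w : E3 → ℂ} (hw : S.PwSmooth w) {ν : E3} (hν : ν ∈ S.verts)
    (i : Fin S.I) : ContDiffOn ℝ ∞ (R.piece w ν i) (S.patch i).dom :=
  (((R.smooth ν hν).2 i).mono subset_closure).mul ((hw.2 i).mono subset_closure)

theorem frame_mem_frontier {i : Fin S.I} {y : E2} (hy : y ∈ (S.patch i).dom) :
    (S.patch i).frame y ∈ frontier S.Ω :=
  S.closedFace_subset_frontier i (mem_image_of_mem _ (subset_closure hy))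

theorem sum_piece (w : E3 → ℂ) {i : Fin S.I} {y : E2} (hy : y ∈ (S.patch i).dom) :
    ∑ ν ∈ S.verts, R.piece w ν i y = (w ∘ (S.patch i).frame) y := by
  simp only [piece, ← Finset.sum_mul, ← Complex.ofReal_sum]
  rw [R.sum_eq_one _ (frame_mem_frontier hy)]
  simp

/-- The part of the patch that lies in the larger neighbourhood of a vertex. -/
def near (ν : E3) (i : Fin S.I) : Set E2 :=
  {z | z ∈ (S.patch i).dom ∧ (S.patch i).frame z ∈ R.U1 ν}

theorem iteratedFDeriv_piece_eq_zero (w : E3 → ℂ) {ν : E3} (hν : ν ∈ S.verts) {i : Fin S.I}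
    {y : E2} (hy : y ∈ (S.patch i).dom) (hyn : y ∉ closure (R.near ν i)) (l : ℕ) :
    iteratedFDeriv ℝ l (R.piece w ν i) y = 0 := by
  have h : R.piece w ν i =ᶠ[𝓝 y] fun _ => 0 := by
    filter_upwards [(S.patch i).dom_open.mem_nhds hy, isClosed_closure.isOpen_compl.mem_nhds hyn]
      with z hz hzn
    have : (S.patch i).frame z ∉ R.U1 ν := fun h => hzn (subset_closure ⟨hz, h⟩)
    simp [piece, R.eq_zero ν hν _ ⟨frame_mem_frontier hz, this⟩]
  rw [(h.iteratedFDeriv ℝ l).eq_of_nhds]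
  simp

/-- The separation by `C1 > 0` would apply to a point and itself. -/
theorem near_eq_empty {ν : E3} (hν : ν ∈ S.verts) {i : Fin S.I}
    (hi : ν ∉ (S.patch i).closedFace) : R.near ν i = ∅ := by
  rw [eq_empty_iff_forall_notMem]
  rintro z ⟨hz, hzU⟩
  have := R.dist_other ν hν i hi _ hzU _ (mem_image_of_mem _ hz)
  rw [dist_self] at this
  exact absurd R.C1_pos this.not_gt

theorem near_subset_closure_sector {i : Fin S.I} {t : Fin 4}
    (hν : (S.patch i).vert t ∈ S.verts) : R.near ((S.patch i).vert t) i ⊆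
      closure (planarSector ((S.patch i).corner t) ((S.patch i).theta t) ((S.patch i).angle t)) := by
  classical
  rintro z ⟨hz, hzU⟩
  have h := R.covered _ hν (i, t) (by simp [cornersAt]) ⟨hzU, mem_image_of_mem _ (subset_closure hz)⟩
  rw [QuadPatch.sector_eq] at h
  rw [(S.patch i).frame_isometry.isClosedEmbedding.closure_image_eq] at h
  obtain ⟨z', hz', he⟩ := h
  rwa [(S.patch i).frame.injective he] at hz'

/-- Rotating `y` about the corner onto the nearer bounding ray gives a point `p` outside the sector,
at distance at most `r q`. If `p` is not in the patch, the segment from `y` to `p` meets the rim. If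
`p` is in the patch, which can happen without convexity, the separation constant `C1` applies. -/
theorem min_le_radius_mul_angle {i : Fin S.I} {t : Fin 4} (hν : (S.patch i).vert t ∈ S.verts)
    {r φ : ℝ} (hr : 0 < r) (hφ : φ ∈ Ioo 0 ((S.patch i).angle t))
    (hy : polarPoint ((S.patch i).corner t) ((S.patch i).theta t) r φ ∈ (S.patch i).dom)
    (hyn : polarPoint ((S.patch i).corner t) ((S.patch i).theta t) r φ ∈
      closure (R.near ((S.patch i).vert t) i)) :
    min R.C1 (S.distInterface ((S.patch i).frame
      (polarPoint ((S.patch i).corner t) ((S.patch i).theta t) r φ))) ≤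
      r * min φ ((S.patch i).angle t - φ) := by
  classical
  set F := S.patch i with hF
  set y := polarPoint (F.corner t) (F.theta t) r φ with hydef
  have hγ := F.angle_mem t
  have key : ∀ ψ : ℝ, ψ = 0 ∨ ψ = F.angle t →
      min R.C1 (S.distInterface (F.frame y)) ≤ r * |φ - ψ| := by
    intro ψ hψ
    set p := polarPoint (F.corner t) (F.theta t) r ψ with hp
    have hd : dist y p ≤ r * |φ - ψ| := by
      have := dist_polarPoint_le (F.corner t) (F.theta t) r φ ψ
      rwa [abs_of_pos hr] at this
    refine le_trans ?_ hd
    have hps : p ∉ planarSector (F.corner t) (F.theta t) (F.angle t) := by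
      rintro ⟨r', hr', φ', hφ', h⟩
      have h1 : |ψ - φ'| < 2 * Real.pi := by
        rw [abs_lt]
        rcases hψ with rfl | rfl <;> constructor <;> linarith [hφ'.1, hφ'.2, hγ.1, hγ.2]
      have h2 := (polarPoint_injective _ _ hr hr' h h1).2
      rcases hψ with rfl | rfl <;> linarith [hφ'.1, hφ'.2]
    by_cases hpd : p ∈ F.dom
    · refine (min_le_left _ _).trans ?_
      -- The separation is assumed for points of the neighbourhood inside the sector, while `y` is
      -- only in the closure of the neighbourhood; the closed inequality persists in the limit.
      have hclosed : IsClosed {z : E2 | R.C1 ≤ dist z p} :=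
        isClosed_le continuous_const (by fun_prop)
      have hsub : R.near (F.vert t) i ∩ planarSector (F.corner t) (F.theta t) (F.angle t) ⊆
          {z : E2 | R.C1 ≤ dist z p} := by
        rintro z ⟨⟨_, hzU⟩, hzs⟩
        have := R.dist_outside _ hν (i, t) (by simp [cornersAt, ← hF]) (F.frame z)
          ⟨hzU, by rw [QuadPatch.sector_eq]; exact mem_image_of_mem _ hzs⟩ (F.frame p)
          ⟨mem_image_of_mem _ hpd, by
            rw [QuadPatch.sector_eq]
            rintro ⟨q, hq, hqe⟩
            rw [F.frame.injective hqe] at hq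
            exact hps hq⟩
        rwa [F.frame_isometry.dist_eq] at this
      have hycl : y ∈ closure (R.near (F.vert t) i ∩
          planarSector (F.corner t) (F.theta t) (F.angle t)) := by
        rw [inter_comm]
        exact (isOpen_planarSector _ _ _).inter_closure ⟨⟨r, hr, φ, hφ, rfl⟩, hyn⟩
      exact hclosed.closure_subset_iff.2 hsub hycl
    · exact (min_le_right _ _).trans (S.distInterface_le_of_notMem hy hpd)
  have k0 := key 0 (Or.inl rfl)
  have k1 := key _ (Or.inr rfl)
  rw [sub_zero, abs_of_pos hφ.1] at k0
  rw [abs_of_neg (by linarith [hφ.2]), neg_sub] at k1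
  rcases min_choice φ (F.angle t - φ) with h | h <;> rw [h] <;> assumption

/-- Where the derivative does not vanish, `δ ≤ c r q`. The nonnegative power `δ^(k-ρ)` then turns
`(r q)^(ρ-l)` into at most a multiple of `(r q)^(k-l)`, which is bounded for all `l ≤ k`. -/
theorem exists_norm_iteratedFDeriv_piece_le (k : ℕ) {ρ : ℝ} (hρ : 0 < ρ) (hρk : ρ < k)
    (i : Fin S.I) : ∃ C : ℝ, 0 < C ∧ ∀ w : E3 → ℂ, S.PwSmooth w → ∀ t : Fin 4,
    (S.patch i).vert t ∈ S.verts → ∀ r φ : ℝ, 0 < r → φ ∈ Ioo 0 ((S.patch i).angle t) →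
    polarPoint ((S.patch i).corner t) ((S.patch i).theta t) r φ ∈ (S.patch i).dom →
    ∀ l, 1 ≤ l → l ≤ k →
    S.distInterface ((S.patch i).frame
      (polarPoint ((S.patch i).corner t) ((S.patch i).theta t) r φ)) ^ (k - ρ) *
      ‖iteratedFDeriv ℝ l (R.piece w ((S.patch i).vert t) i)
        (polarPoint ((S.patch i).corner t) ((S.patch i).theta t) r φ)‖ ≤
    C * ∑ β ∈ derivIndices k, ‖weightedDeriv ((S.patch i).angle t) ρ ρ β.1 β.2
      (R.localized w ((S.patch i).vert t) (i, t)) r φ‖ := by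
  obtain ⟨C, hC0, hC⟩ := exists_norm_iteratedFDeriv_le_weightedDeriv k hρ
  set F := S.patch i with hF
  set D := Metric.diam (closure F.dom) with hD
  have hD0 : 0 ≤ D := Metric.diam_nonneg
  -- The second entry handles the case `C1 ≤ r q`, in which `δ ≤ D` is used instead; `T` below
  -- bounds `r q`, by `r ≤ D` and `q ≤ 4`.
  set c : ℝ := max 1 (D / R.C1) with hc
  have hc1 : 1 ≤ c := le_max_left _ _
  set T : ℝ := max 1 (4 * D) with hT
  have hT1 : 1 ≤ T := le_max_left _ _
  refine ⟨C * c ^ (k - ρ) * T ^ k, by positivity, ?_⟩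
  intro w hw t hν r φ hr hφ hy l hl1 hlk
  set y := polarPoint (F.corner t) (F.theta t) r φ with hydef
  set W := ∑ β ∈ derivIndices k, ‖weightedDeriv (F.angle t) ρ ρ β.1 β.2
      (R.localized w (F.vert t) (i, t)) r φ‖ with hW
  have hW0 : 0 ≤ W := Finset.sum_nonneg fun _ _ => norm_nonneg _
  by_cases hyn : y ∈ closure (R.near (F.vert t) i)
  swap
  · rw [R.iteratedFDeriv_piece_eq_zero w hν hy hyn l, norm_zero, mul_zero]
    positivity
  set q := min φ (F.angle t - φ) with hq
  have hq0 : 0 < q := lt_min hφ.1 (by linarith [hφ.2])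
  have hγ := F.angle_mem t
  have hq4 : q ≤ 4 := by
    have h1 : q ≤ φ := min_le_left _ _
    have h2 : q ≤ F.angle t - φ := min_le_right _ _
    linarith [Real.pi_le_four, hγ.2]
  have hmin : min R.C1 (S.distInterface (F.frame y)) ≤ r * q :=
    R.min_le_radius_mul_angle hν hr hφ hy hyn
  have hrD : r ≤ D := by
    have h1 := Metric.dist_le_diam_of_mem F.isCompact_closure_dom.isBounded (subset_closure hy)
      (F.corner_mem_closure t)
    rwa [dist_polarPoint_center, abs_of_pos hr] at h1
  set δ := S.distInterface (F.frame y) with hδ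
  have hδ0 : 0 ≤ δ := S.distInterface_nonneg _
  have hδD : δ ≤ D := by
    refine le_trans ?_ hrD
    have h1 := S.distInterface_le_dist (x := F.frame y)
      (S.rim_subset_interface i (F.vert_mem_rim t))
    rwa [QuadPatch.vert, F.frame_isometry.dist_eq, dist_polarPoint_center, abs_of_pos hr] at h1
  have hrq : 0 < r * q := mul_pos hr hq0
  have hδc : δ ≤ c * (r * q) := by
    rcases min_le_iff.1 hmin with h | h
    · calc δ ≤ D := hδD
        _ = D / R.C1 * R.C1 := by rw [div_mul_cancel₀ _ R.C1_pos.ne']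
        _ ≤ c * (r * q) := by
          gcongr
          · exact R.C1_pos.le
          · exact le_max_right _ _
    · calc δ ≤ 1 * (r * q) := by rw [one_mul]; exact h
        _ ≤ c * (r * q) := by gcongr
  have hrqT : r * q ≤ T := by
    refine le_trans ?_ (le_max_right _ _)
    calc r * q ≤ D * 4 := by gcongr
      _ = _ := by ring
  have hkρ : 0 < (k : ℝ) - ρ := by linarith
  have hder := hC (F.corner t) (F.theta t) (F.angle t) F.dom (R.piece w (F.vert t) i) hγ.2.le
    F.dom_open (R.contDiffOn_piece hw hν i) r φ hr hφ hy l hl1 hlk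
  have hWeq : ∑ β ∈ derivIndices k, ‖weightedDeriv (F.angle t) ρ ρ β.1 β.2 (fun r φ =>
      R.piece w (F.vert t) i (polarPoint (F.corner t) (F.theta t) r φ)) r φ‖ = W := by
    refine Finset.sum_congr rfl fun β _ => ?_
    rw [norm_weightedDeriv _ _ _ _ _ _ hr hφ, norm_weightedDeriv _ _ _ _ _ _ hr hφ]
    congr 2
    have hV : IsOpen ((fun p : ℝ × ℝ => polarPoint (F.corner t) (F.theta t) p.1 p.2) ⁻¹' F.dom) :=
      F.dom_open.preimage (contDiff_polarPoint _ _).continuous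
    refine mixedDeriv_congr hV (fun p hp => ?_) β.1 β.2 (p := (r, φ)) hy
    have hp' : polarPoint (F.corner t) (F.theta t) p.1 p.2 ∈ closure F.dom := subset_closure hp
    simp only [localized, ← hF, indicator_of_mem hp', piece]
  rw [hWeq] at hder
  have hpow : δ ^ (k - ρ) * (r * q) ^ (ρ - l) ≤ c ^ (k - ρ) * T ^ k := by
    calc δ ^ (k - ρ) * (r * q) ^ (ρ - l) ≤ (c * (r * q)) ^ (k - ρ) * (r * q) ^ (ρ - l) := by
          gcongr
      _ = c ^ (k - ρ) * (r * q) ^ (k - l) := by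
          rw [Real.mul_rpow (by positivity) hrq.le, mul_assoc, ← Real.rpow_add hrq,
            ← Real.rpow_natCast (r * q) (k - l), Nat.cast_sub hlk]
          congr 2; ring
      _ ≤ c ^ (k - ρ) * T ^ k := by
          gcongr
          calc (r * q) ^ (k - l) ≤ T ^ (k - l) := by gcongr
            _ ≤ T ^ k := pow_le_pow_right₀ hT1 (by omega)
  calc δ ^ (k - ρ) * ‖iteratedFDeriv ℝ l (R.piece w (F.vert t) i) y‖
      ≤ δ ^ (k - ρ) * (C * (r * q) ^ (ρ - l) * W) := by gcongr
    _ = C * (δ ^ (k - ρ) * (r * q) ^ (ρ - l)) * W := by ring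
    _ ≤ C * (c ^ (k - ρ) * T ^ k) * W := by gcongr
    _ = _ := by ring

/-- The localized function is smooth in polar coordinates. -/
theorem continuousOn_weightedDeriv_localized {w : E3 → ℂ} (hw : S.PwSmooth w) (ρ : ℝ)
    (β : ℕ × ℕ) {i : Fin S.I} {t : Fin 4} (hν : (S.patch i).vert t ∈ S.verts) :
    ContinuousOn (fun q : ℝ × ℝ => weightedDeriv ((S.patch i).angle t) ρ ρ β.1 β.2
      (R.localized w ((S.patch i).vert t) (i, t)) q.1 q.2)
      ((Ioi (0 : ℝ) ×ˢ Ioo (0 : ℝ) ((S.patch i).angle t)) ∩ (fun p : ℝ × ℝ =>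
        polarPoint ((S.patch i).corner t) ((S.patch i).theta t) p.1 p.2) ⁻¹' (S.patch i).dom) := by
  set F := S.patch i with hF
  have hV : IsOpen ((fun p : ℝ × ℝ => polarPoint (F.corner t) (F.theta t) p.1 p.2) ⁻¹' F.dom) :=
    F.dom_open.preimage (contDiff_polarPoint _ _).continuous
  have hsm : ContDiffOn ℝ ∞ (R.piece w (F.vert t) i ∘ fun p : ℝ × ℝ =>
      polarPoint (F.corner t) (F.theta t) p.1 p.2)
      ((fun p : ℝ × ℝ => polarPoint (F.corner t) (F.theta t) p.1 p.2) ⁻¹' F.dom) :=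
    (R.contDiffOn_piece hw hν i).comp (contDiff_polarPoint _ _).contDiffOn fun _ hq => hq
  have h1 := (continuousOn_mixedDeriv hV hsm β.1 β.2)
  have h2 : ContinuousOn (fun q : ℝ × ℝ => mixedDeriv β.1 β.2
      (R.localized w (F.vert t) (i, t)) q.1 q.2)
      ((fun p : ℝ × ℝ => polarPoint (F.corner t) (F.theta t) p.1 p.2) ⁻¹' F.dom) := by
    refine h1.congr fun q hq => mixedDeriv_congr hV (fun p hp => ?_) β.1 β.2 hq
    have hp' : polarPoint (F.corner t) (F.theta t) p.1 p.2 ∈ closure F.dom := subset_closure hp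
    simp only [localized, ← hF, indicator_of_mem hp', piece, Function.comp_apply]
  refine ContinuousOn.mul ?_ (h2.mono inter_subset_right)
  refine Complex.continuous_ofReal.comp_continuousOn ?_
  have hpos : ∀ q ∈ (Ioi (0 : ℝ) ×ˢ Ioo (0 : ℝ) (F.angle t)) ∩ (fun p : ℝ × ℝ =>
        polarPoint (F.corner t) (F.theta t) p.1 p.2) ⁻¹' F.dom,
      0 < q.1 ∧ 0 < min q.2 (F.angle t - q.2) := fun q hq =>
    ⟨hq.1.1, lt_min hq.1.2.1 (by linarith [hq.1.2.2])⟩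
  have hmin : Continuous fun q : ℝ × ℝ => min q.2 (F.angle t - q.2) := by fun_prop
  refine ContinuousOn.mul (ContinuousOn.mul (ContinuousOn.mul ?_ ?_) ?_) ?_
  · exact continuousOn_fst.rpow_const fun q hq => Or.inl (hpos q hq).1.ne'
  · exact (continuous_const.add continuous_fst).continuousOn.rpow_const
      fun q hq => Or.inl (by
        have := (hpos q hq).1
        simp only [Pi.add_apply]
        positivity)
  · exact (hmin.mul continuous_fst).continuousOn.pow _
  · exact hmin.continuousOn.rpow_const fun q hq => Or.inl (hpos q hq).2.ne'

theorem sectorL2_le_weightedNorm (k : ℕ) (ρ : ℝ) (w : E3 → ℂ) {i : Fin S.I} {t : Fin 4}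
    (hν : (S.patch i).vert t ∈ S.verts) {β : ℕ × ℕ} (hβ : β ∈ derivIndices k) :
    sectorL2 ((S.patch i).angle t) (weightedDeriv ((S.patch i).angle t) ρ ρ β.1 β.2
      (R.localized w ((S.patch i).vert t) (i, t))) ≤ R.weightedNorm k ρ w := by
  have h2 := S.sectorL2_le_coneNorm k ρ ρ ((S.patch i).vert t)
    (R.localized w ((S.patch i).vert t)) (c := (i, t)) (by simp [cornersAt]) hβ
  refine h2.trans ?_
  exact Finset.single_le_sum (f := fun ν => S.coneNorm k ρ ρ ν (R.localized w ν))
    (fun _ _ => zero_le) hν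

end SpecialResolution

end PolySurface

theorem ENNReal.rpow_half_sq (x : ℝ≥0∞) : (x ^ (1 / 2 : ℝ)) ^ 2 = x := by
  rw [← ENNReal.rpow_natCast, ← ENNReal.rpow_mul]; norm_num

/-! ### Integral bounds of weighted Cartesian derivatives -/

namespace PolySurface.SpecialResolution

variable {m : ℕ} {S : PolySurface m} (R : S.SpecialResolution)

/-- The squared derivative of order `l`, weighted with a power of the distance to the interfaces. -/
def weightedSq (S : PolySurface m) (i : Fin S.I) (μ : ℝ) (l : ℕ) (h : E2 → ℂ) (y : E2) : ℝ≥0∞ :=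
  (ENNReal.ofReal (S.distInterface ((S.patch i).frame y) ^ μ) * ‖iteratedFDeriv ℝ l h y‖ₑ) ^ 2

theorem weightedSq_eq_ofReal (S : PolySurface m) (i : Fin S.I) (μ : ℝ) (l : ℕ) (h : E2 → ℂ)
    (y : E2) : weightedSq S i μ l h y = ENNReal.ofReal
      (S.distInterface ((S.patch i).frame y) ^ μ * ‖iteratedFDeriv ℝ l h y‖) ^ 2 := by
  rw [weightedSq, ENNReal.ofReal_mul (Real.rpow_nonneg (S.distInterface_nonneg _) _), ofReal_norm]

theorem aemeasurable_weightedSq {i : Fin S.I} {μ : ℝ} {l : ℕ} {h : E2 → ℂ}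
    (hh : ContDiffOn ℝ ∞ h (S.patch i).dom) :
    AEMeasurable (weightedSq S i μ l h) (volume.restrict (S.patch i).dom) := by
  have h1 : ContinuousOn (iteratedFDeriv ℝ l h) (S.patch i).dom :=
    ((hh.of_le (m := l) ENat.LEInfty.out).continuousOn_iteratedFDerivWithin le_rfl
      (S.patch i).dom_open.uniqueDiffOn).congr fun z hz =>
      (iteratedFDerivWithin_of_isOpen l (S.patch i).dom_open hz).symm
  have h2 : AEMeasurable (fun y => ‖iteratedFDeriv ℝ l h y‖ₑ)
      (volume.restrict (S.patch i).dom) :=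
    h1.enorm.aemeasurable (S.patch i).dom_open.measurableSet
  have h3 : Measurable fun y : E2 => S.distInterface ((S.patch i).frame y) :=
    (S.continuous_distInterface.comp (S.patch i).frame.continuous).measurable
  exact ((ENNReal.measurable_ofReal.comp (h3.pow_const μ)).aemeasurable.mul h2).pow_const 2

theorem lintegral_weightedSq_piece_corner_le (k : ℕ) {ρ : ℝ} (hρ : 0 < ρ) (hρk : ρ < k)
    (i : Fin S.I) : ∃ C : ℝ≥0, ∀ w : E3 → ℂ, S.PwSmooth w → ∀ t : Fin 4,
    (S.patch i).vert t ∈ S.verts → ∀ l, 1 ≤ l → l ≤ k →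
    ∫⁻ y in (S.patch i).dom, weightedSq S i (k - ρ) l (R.piece w ((S.patch i).vert t) i) y ≤
      C * R.weightedNorm k ρ w ^ 2 := by
  obtain ⟨C, hC0, hC⟩ := R.exists_norm_iteratedFDeriv_piece_le k hρ hρk i
  refine ⟨C.toNNReal ^ 2 * ((derivIndices k).card * (derivIndices k).card), ?_⟩
  intro w hw t hν l hl1 hlk
  set F := S.patch i with hF
  set N := R.weightedNorm k ρ w with hN
  set H := weightedSq S i (k - ρ) l (R.piece w (F.vert t) i) with hH
  set Q : Set (ℝ × ℝ) := Ioi (0 : ℝ) ×ˢ Ioo (0 : ℝ) (F.angle t) with hQ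
  set P : ℝ × ℝ → E2 := fun q => polarPoint (F.corner t) (F.theta t) q.1 q.2 with hP
  set sec := planarSector (F.corner t) (F.theta t) (F.angle t) with hsec
  have hVm : MeasurableSet (P ⁻¹' F.dom) :=
    (F.dom_open.preimage (contDiff_polarPoint _ _).continuous).measurableSet
  have hQm : MeasurableSet Q := measurableSet_Ioi.prod measurableSet_Ioo
  set D : ℕ × ℕ → ℝ × ℝ → ℝ≥0∞ := fun β q => ‖weightedDeriv (F.angle t) ρ ρ β.1 β.2
      (R.localized w (F.vert t) (i, t)) q.1 q.2‖ₑ ^ 2 * ENNReal.ofReal q.1 with hD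
  have hDint : ∀ β ∈ derivIndices k, ∫⁻ q in Q, D β q ≤ N ^ 2 := by
    intro β hβ
    have h := R.sectorL2_le_weightedNorm k ρ w hν hβ
    calc ∫⁻ q in Q, D β q = ((∫⁻ q in Q, D β q) ^ (1 / 2 : ℝ)) ^ 2 :=
          (ENNReal.rpow_half_sq _).symm
      _ ≤ N ^ 2 := by gcongr; exact h
  have hDm : ∀ β, AEMeasurable (D β) (volume.restrict (Q ∩ P ⁻¹' F.dom)) := by
    intro β
    have h := R.continuousOn_weightedDeriv_localized hw ρ β hν
    exact ((h.enorm.aemeasurable (hQm.inter hVm)).pow_const 2).mul (by fun_prop)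
  -- Outside the closed sector the localized function has vanishing derivatives, and the boundary
  -- rays are null sets. The integral may thus be taken over the open sector, where polar
  -- coordinates apply.
  have hae : ∀ᵐ y : E2, F.dom.indicator H y ≤ sec.indicator (F.dom.indicator H) y := by
    filter_upwards [ae_mem_planarSector_or_notMem_closure (F.corner t) (F.theta t) (F.angle t)]
      with y hy
    rcases hy with hy | hy
    · rw [indicator_of_mem hy]
    · by_cases hyd : y ∈ F.dom
      · have hyn : y ∉ closure (R.near (F.vert t) i) := fun h => hy
          (closure_minimal (R.near_subset_closure_sector hν) isClosed_closure h)
        have : H y = 0 := by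
          simp only [H, weightedSq, R.iteratedFDeriv_piece_eq_zero w hν hyd hyn l]
          simp
        rw [indicator_of_mem hyd, this]
        exact zero_le
      · rw [indicator_of_notMem hyd]
        exact zero_le
  calc ∫⁻ y in F.dom, H y = ∫⁻ y, F.dom.indicator H y :=
        (lintegral_indicator F.dom_open.measurableSet _).symm
    _ ≤ ∫⁻ y, sec.indicator (F.dom.indicator H) y := lintegral_mono_ae hae
    _ = ∫⁻ y in sec, F.dom.indicator H y :=
        lintegral_indicator (isOpen_planarSector _ _ _).measurableSet _
    _ = ∫⁻ q in Q, ENNReal.ofReal q.1 * F.dom.indicator H (P q) :=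
        lintegral_planarSector (F.angle_mem t).2.le _
    _ = ∫⁻ q in Q, (P ⁻¹' F.dom).indicator (fun q => ENNReal.ofReal q.1 * H (P q)) q := by
        refine lintegral_congr fun q => ?_
        by_cases hq : P q ∈ F.dom
        · rw [indicator_of_mem hq, indicator_of_mem (mem_preimage.2 hq)]
        · rw [indicator_of_notMem hq, indicator_of_notMem (fun h => hq (mem_preimage.1 h)), mul_zero]
    _ = ∫⁻ q in Q ∩ P ⁻¹' F.dom, ENNReal.ofReal q.1 * H (P q) := by
        rw [lintegral_indicator hVm, Measure.restrict_restrict hVm, inter_comm]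
    _ ≤ ∫⁻ q in Q ∩ P ⁻¹' F.dom, (C.toNNReal ^ 2 * (derivIndices k).card : ℝ≥0) *
          ∑ β ∈ derivIndices k, D β q := by
        refine setLIntegral_mono' (hQm.inter hVm) fun q hq => ?_
        have h1 := hC w hw t hν q.1 q.2 hq.1.1 hq.1.2 hq.2 l hl1 hlk
        have h2 : H (P q) ≤ (C.toNNReal : ℝ≥0∞) ^ 2 * ((derivIndices k).card *
            ∑ β ∈ derivIndices k, ‖weightedDeriv (F.angle t) ρ ρ β.1 β.2
              (R.localized w (F.vert t) (i, t)) q.1 q.2‖ₑ ^ 2) := by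
          simp only [H]
          rw [weightedSq_eq_ofReal]
          calc _ ≤ (ENNReal.ofReal (C * ∑ β ∈ derivIndices k, ‖weightedDeriv (F.angle t) ρ ρ β.1 β.2
              (R.localized w (F.vert t) (i, t)) q.1 q.2‖)) ^ 2 := by
                gcongr
            _ = (C.toNNReal : ℝ≥0∞) ^ 2 * (∑ β ∈ derivIndices k,
                ‖weightedDeriv (F.angle t) ρ ρ β.1 β.2
                (R.localized w (F.vert t) (i, t)) q.1 q.2‖ₑ) ^ 2 := by
              rw [ENNReal.ofReal_mul hC0.le, ENNReal.ofReal_sum_of_nonneg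
                (fun _ _ => norm_nonneg _), mul_pow]
              simp only [ofReal_norm]
              rw [ENNReal.ofReal]
            _ ≤ _ := by
              gcongr
              exact ENNReal.sum_sq_le _ _
        refine (mul_le_mul_right h2 (ENNReal.ofReal q.1)).trans_eq ?_
        simp only [D, ← Finset.sum_mul]
        push_cast
        ring
    _ = (C.toNNReal ^ 2 * (derivIndices k).card : ℝ≥0) *
          ∑ β ∈ derivIndices k, ∫⁻ q in Q ∩ P ⁻¹' F.dom, D β q := by
        rw [lintegral_const_mul' _ _ ENNReal.coe_ne_top, lintegral_finsetSum' _ fun β _ => hDm β]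
    _ ≤ (C.toNNReal ^ 2 * (derivIndices k).card : ℝ≥0) * ∑ β ∈ derivIndices k, N ^ 2 := by
        gcongr with β hβ
        exact (lintegral_mono_set inter_subset_left).trans (hDint β hβ)
    _ = _ := by
        rw [Finset.sum_const, nsmul_eq_mul]
        push_cast
        ring

/-- The resolution of unity splits `w` into its localized pieces. Vertices off the closed patch
contribute nothing, and every other one is a corner of the patch. -/
theorem lintegral_weightedSq_le (k : ℕ) {ρ : ℝ} (hρ : 0 < ρ) (hρk : ρ < k)
    (i : Fin S.I) : ∃ C : ℝ≥0, ∀ w : E3 → ℂ, S.PwSmooth w → ∀ l, 1 ≤ l → l ≤ k →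
    ∫⁻ y in (S.patch i).dom, weightedSq S i (k - ρ) l (w ∘ (S.patch i).frame) y ≤
      C * R.weightedNorm k ρ w ^ 2 := by
  obtain ⟨C, hC⟩ := R.lintegral_weightedSq_piece_corner_le k hρ hρk i
  refine ⟨S.verts.card * (S.verts.card * C), ?_⟩
  intro w hw l hl1 hlk
  set F := S.patch i with hF
  have hpiece : ∀ ν ∈ S.verts, ∫⁻ y in F.dom, weightedSq S i (k - ρ) l (R.piece w ν i) y ≤
      C * R.weightedNorm k ρ w ^ 2 := by
    intro ν hν
    by_cases hνi : ν ∈ F.closedFace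
    · obtain ⟨t, rfl⟩ := S.exists_vert_eq hν hνi
      exact hC w hw t hν l hl1 hlk
    · have : ∫⁻ y in F.dom, weightedSq S i (k - ρ) l (R.piece w ν i) y = ∫⁻ _y in F.dom, 0 := by
        refine setLIntegral_congr_fun F.dom_open.measurableSet fun y hy => ?_
        simp only [weightedSq]
        rw [R.iteratedFDeriv_piece_eq_zero w hν hy (by rw [R.near_eq_empty hν hνi]; simp) l]
        simp
      rw [this]
      simp
  calc ∫⁻ y in F.dom, weightedSq S i (k - ρ) l (w ∘ F.frame) y
      ≤ ∫⁻ y in F.dom, S.verts.card * ∑ ν ∈ S.verts, weightedSq S i (k - ρ) l (R.piece w ν i) y := by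
        refine setLIntegral_mono' F.dom_open.measurableSet fun y hy => ?_
        have h1 : w ∘ F.frame =ᶠ[𝓝 y] fun y => ∑ ν ∈ S.verts, R.piece w ν i y := by
          filter_upwards [F.dom_open.mem_nhds hy] with z hz
          exact (R.sum_piece w hz).symm
        have h2 : iteratedFDeriv ℝ l (w ∘ F.frame) y =
            ∑ ν ∈ S.verts, iteratedFDeriv ℝ l (R.piece w ν i) y := by
          rw [(h1.iteratedFDeriv ℝ l).eq_of_nhds]
          refine iteratedFDeriv_fun_sum_apply fun ν hν => ?_
          exact ((R.contDiffOn_piece hw hν i).contDiffAt (F.dom_open.mem_nhds hy)).of_le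
            ENat.LEInfty.out
        simp only [weightedSq]
        rw [h2]
        refine le_trans ?_ (ENNReal.sum_sq_le _ _)
        rw [← Finset.mul_sum]
        gcongr
        exact enorm_sum_le _ _
    _ = S.verts.card * ∑ ν ∈ S.verts,
          ∫⁻ y in F.dom, weightedSq S i (k - ρ) l (R.piece w ν i) y := by
        rw [lintegral_const_mul' _ _ (by simp), lintegral_finsetSum']
        exact fun ν hν => aemeasurable_weightedSq (R.contDiffOn_piece hw hν i)
    _ ≤ S.verts.card * ∑ ν ∈ S.verts, C * R.weightedNorm k ρ w ^ 2 := by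
        gcongr with ν hν
        exact hpiece ν hν
    _ = _ := by
        rw [Finset.sum_const, nsmul_eq_mul]
        push_cast
        ring

end PolySurface.SpecialResolution

/-! ### Metric geometry of the surface -/

/-- The map onto its range has a linear right inverse, which is bounded in finite dimensions. -/
theorem exists_bounded_preimage {V W : Type*} [NormedAddCommGroup V] [NormedSpace ℝ V]
    [FiniteDimensional ℝ V] [NormedAddCommGroup W] [NormedSpace ℝ W] (A : V →ₗ[ℝ] W) :
    ∃ C : ℝ, 0 < C ∧ ∀ v, ∃ u, A u = A v ∧ ‖u‖ ≤ C * ‖A v‖ := by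
  obtain ⟨B, hB⟩ := A.rangeRestrict.exists_rightInverse_of_surjective A.range_rangeRestrict
  set B' := LinearMap.toContinuousLinearMap B with hB'
  refine ⟨‖B'‖ + 1, by positivity, fun v => ⟨B (A.rangeRestrict v), ?_, ?_⟩⟩
  · have := LinearMap.congr_fun hB (A.rangeRestrict v)
    exact congrArg Subtype.val this
  · calc ‖B (A.rangeRestrict v)‖ ≤ ‖B'‖ * ‖A.rangeRestrict v‖ := B'.le_opNorm _
      _ = ‖B'‖ * ‖A v‖ := rfl
      _ ≤ _ := by gcongr; linarith

/-- Two planes that intersect are linearly regular. -/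
theorem exists_dist_le_of_planes (f g : E2 →ᵃⁱ[ℝ] E3) (h : ∃ a b, f a = g b) :
    ∃ C : ℝ, 0 < C ∧ ∀ a b, ∃ a' b', f a' = g b' ∧ dist a a' ≤ C * dist (f a) (g b) ∧
      dist b b' ≤ C * dist (f a) (g b) := by
  obtain ⟨p, q, hpq⟩ := h
  -- The value of `A` at `(a - p, b - q)` is the gap `f a - g b`. Subtracting a preimage of the gap
  -- of comparable size yields parameters with a common image.
  set A : E2 × E2 →ₗ[ℝ] E3 := f.linear ∘ₗ LinearMap.fst ℝ E2 E2 - g.linear ∘ₗ LinearMap.snd ℝ E2 E2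
    with hA
  obtain ⟨C, hC0, hC⟩ := exists_bounded_preimage A
  have hAv : ∀ a b, A (a - p, b - q) = f a - g b := by
    intro a b
    have h1 : f.linear (a - p) = f a - f p := by
      have := f.toAffineMap.linearMap_vsub a p
      simpa using this
    have h2 : g.linear (b - q) = g b - g q := by
      have := g.toAffineMap.linearMap_vsub b q
      simpa using this
    simp only [A, LinearMap.sub_apply, LinearMap.comp_apply, LinearMap.fst_apply,
      LinearMap.snd_apply, h1, h2, hpq]
    abel
  refine ⟨C, hC0, fun a b => ?_⟩
  obtain ⟨u, hu1, hu2⟩ := hC (a - p, b - q)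
  rw [hAv, ← dist_eq_norm] at hu2
  refine ⟨a - u.1, b - u.2, ?_, ?_, ?_⟩
  · have h1 : A (a - u.1 - p, b - u.2 - q) = 0 := by
      have : ((a - u.1 - p, b - u.2 - q) : E2 × E2) = (a - p, b - q) - u := by
        ext1 <;> simp <;> abel
      rw [this, map_sub, hu1, sub_self]
    rw [hAv] at h1
    exact sub_eq_zero.1 h1
  · rw [dist_eq_norm, sub_sub_cancel]; exact (norm_fst_le u).trans hu2
  · rw [dist_eq_norm, sub_sub_cancel]; exact (norm_snd_le u).trans hu2

namespace PolySurface

variable {m : ℕ} (S : PolySurface m)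

theorem isCompact_frontier : IsCompact (frontier S.Ω) :=
  S.compact.of_isClosed_subset isClosed_frontier S.compact.isClosed.frontier_subset

theorem frontier_nonempty : (frontier S.Ω).Nonempty := by
  rw [nonempty_frontier_iff]
  have := S.simplyConnected
  refine ⟨nonempty_coe_sort.1 inferInstance, fun h => ?_⟩
  have hc := S.compact
  rw [h] at hc
  exact noncompact_univ E3 hc

theorem I_pos : 0 < S.I := by
  obtain ⟨x, hx⟩ := S.frontier_nonempty
  rw [S.boundary] at hx
  obtain ⟨i, -⟩ := mem_iUnion.1 hx
  exact i.pos

theorem interface_nonempty : S.interface.Nonempty :=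
  ⟨_, S.rim_subset_interface ⟨0, S.I_pos⟩ ((S.patch ⟨0, S.I_pos⟩).vert_mem_rim 0)⟩

theorem interface_subset_frontier : S.interface ⊆ frontier S.Ω := by
  refine iUnion_subset fun i => ?_
  refine Subset.trans ?_ (S.closedFace_subset_frontier i)
  rw [QuadPatch.closedFace_eq]
  exact subset_union_right

/-- An upper bound of the distances to the interface. -/
theorem exists_distInterface_le : ∃ D : ℝ, 0 < D ∧ ∀ x ∈ frontier S.Ω, S.distInterface x ≤ D := by
  obtain ⟨z, hz⟩ := S.interface_nonempty
  refine ⟨Metric.diam (frontier S.Ω) + 1, by positivity, fun x hx => ?_⟩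
  have h1 := S.distInterface_le_dist (x := x) hz
  have h2 := Metric.dist_le_diam_of_mem S.isCompact_frontier.isBounded hx
    (S.interface_subset_frontier hz)
  linarith

/-- If the planes meet, linear regularity moves both points to a common point at a cost proportional
to their distance. That point cannot be in both patches, so one of the two paths crosses a rim. If
the planes do not meet, compactness gives a positive distance. -/
theorem exists_distInterface_le_dist_pair {i l : Fin S.I} (hil : i ≠ l) :
    ∃ C : ℝ, 0 < C ∧ ∀ x ∈ (S.patch i).face, ∀ y ∈ (S.patch l).closedFace,
      S.distInterface x ≤ C * dist x y := by
  by_cases h : ∃ a b, (S.patch i).frame a = (S.patch l).frame b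
  · obtain ⟨C, hC0, hC⟩ := exists_dist_le_of_planes _ _ h
    refine ⟨1 + 2 * C, by positivity, ?_⟩
    rintro _ ⟨a, ha, rfl⟩ _ ⟨b, hb, rfl⟩
    set δ := dist ((S.patch i).frame a) ((S.patch l).frame b) with hδ
    have hδ0 : 0 ≤ δ := dist_nonneg
    obtain ⟨a', b', he, h1, h2⟩ := hC a b
    by_cases ha' : a' ∈ (S.patch i).dom
    · have hb' : b' ∉ closure (S.patch l).dom := fun hb' =>
        Set.disjoint_left.1 (S.disjoint_face_closedFace hil) (mem_image_of_mem _ ha')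
          (by rw [he]; exact mem_image_of_mem _ hb')
      obtain ⟨z, hz, hzf⟩ := exists_mem_segment_frontier hb hb'
      have hzr : (S.patch l).frame z ∈ S.interface :=
        S.rim_subset_interface l (mem_image_of_mem _ (frontier_closure_subset hzf))
      have h3 := S.distInterface_le_dist (x := (S.patch i).frame a) hzr
      have h4 := dist_triangle ((S.patch i).frame a) ((S.patch l).frame b) ((S.patch l).frame z)
      rw [(S.patch l).frame_isometry.dist_eq b z] at h4
      have h5 := dist_add_dist_of_mem_segment hz
      nlinarith [dist_nonneg (x := z) (y := b')]
    · have := S.distInterface_le_of_notMem ha ha'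
      nlinarith
  · have hdis : ∀ q ∈ (S.patch i).closedFace ×ˢ (S.patch l).closedFace,
        0 < dist q.1 q.2 := by
      rintro ⟨x, y⟩ ⟨⟨a, _, rfl⟩, ⟨b, _, hb⟩⟩
      refine dist_pos.2 fun he => h ⟨a, b, ?_⟩
      rw [hb]; exact he
    obtain ⟨δ, hδ0, hδ⟩ := ((S.patch i).isCompact_closedFace.prod
      (S.patch l).isCompact_closedFace).exists_forall_le' (by fun_prop) hdis
    obtain ⟨D, hD0, hD⟩ := S.exists_distInterface_le
    refine ⟨D / δ, by positivity, fun x hx y hy => ?_⟩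
    have hx' := (S.patch i).face_subset_closedFace hx
    have h1 := hD x (S.closedFace_subset_frontier i hx')
    have h2 : δ ≤ dist x y := hδ (x, y) ⟨hx', hy⟩
    calc S.distInterface x ≤ D := h1
      _ = D / δ * δ := by field_simp
      _ ≤ _ := by gcongr

/-- Different patches are separated away from the interfaces. -/
theorem exists_distInterface_le_dist : ∃ C : ℝ, 0 < C ∧ ∀ i l : Fin S.I, i ≠ l →
    ∀ x ∈ (S.patch i).face, ∀ y ∈ (S.patch l).closedFace, S.distInterface x ≤ C * dist x y := by
  have h : ∀ q : Fin S.I × Fin S.I, ∃ C : ℝ, 0 < C ∧ (q.1 ≠ q.2 → ∀ x ∈ (S.patch q.1).face,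
      ∀ y ∈ (S.patch q.2).closedFace, S.distInterface x ≤ C * dist x y) := by
    intro q
    by_cases hq : q.1 = q.2
    · exact ⟨1, one_pos, fun h => absurd hq h⟩
    · obtain ⟨C, hC0, hC⟩ := S.exists_distInterface_le_dist_pair hq
      exact ⟨C, hC0, fun _ => hC⟩
  choose C hC0 hC using h
  refine ⟨1 + ∑ q, C q, add_pos_of_pos_of_nonneg one_pos (Finset.sum_nonneg fun q _ => (hC0 q).le),
    fun i l hil x hx y hy => ?_⟩
  refine (hC (i, l) hil x hx y hy).trans ?_
  gcongr
  have := Finset.single_le_sum (f := C) (fun q _ => (hC0 q).le) (Finset.mem_univ (i, l))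
  linarith

/-! ### The surface measure -/

theorem lintegral_area (g : E3 → ℝ≥0∞) :
    ∫⁻ x, g x ∂S.area = ∑ i, ∫⁻ y in (S.patch i).dom, g ((S.patch i).frame y) := by
  rw [area, lintegral_finsetSum_measure]
  exact Finset.sum_congr rfl fun i _ => (S.patch i).measurableEmbedding_frame.lintegral_map _

theorem lintegral_dom_le (i : Fin S.I) (g : E3 → ℝ≥0∞) :
    ∫⁻ y in (S.patch i).dom, g ((S.patch i).frame y) ≤ ∫⁻ x, g x ∂S.area := by
  rw [lintegral_area]
  exact Finset.single_le_sum (f := fun i => ∫⁻ y in (S.patch i).dom, g ((S.patch i).frame y))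
    (fun _ _ => zero_le) (Finset.mem_univ i)

theorem area_apply_le (A : Set E3) (hA : MeasurableSet A) :
    S.area A ≤ ∑ i, volume ((S.patch i).frame ⁻¹' A) := by
  rw [area, Measure.finsetSum_apply]
  refine Finset.sum_le_sum fun i _ => ?_
  rw [Measure.map_apply (S.patch i).frame.continuous.measurable hA]
  exact Measure.restrict_apply_le _ _

instance isFiniteMeasure_area : IsFiniteMeasure S.area := by
  have : ∀ i, IsFiniteMeasure (Measure.map (S.patch i).frame (volume.restrict (S.patch i).dom)) := by
    intro i
    have : IsFiniteMeasure ((volume : Measure E2).restrict (S.patch i).dom) :=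
      ⟨by simpa using (S.patch i).dom_bounded.measure_lt_top⟩
    infer_instance
  rw [area]
  infer_instance

/-- The centre need not be in the plane of the patch, but the trace of the ball on the plane lies in
a planar ball of radius `2 r` about any of its points. -/
theorem exists_area_closedBall_le : ∃ C : ℝ, 0 < C ∧ ∀ (x : E3) (r : ℝ), 0 ≤ r →
    S.area (Metric.closedBall x r) ≤ ENNReal.ofReal (C * r ^ 2) := by
  set V := (volume (Metric.ball (0 : E2) 1)).toReal with hV
  have hV' : ENNReal.ofReal V = volume (Metric.ball (0 : E2) 1) :=
    ENNReal.ofReal_toReal Metric.isBounded_ball.measure_lt_top.ne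
  have hV0 : 0 ≤ V := ENNReal.toReal_nonneg
  refine ⟨S.I * (4 * V) + 1, by positivity, fun x r hr => ?_⟩
  refine (S.area_apply_le _ Metric.isClosed_closedBall.measurableSet).trans ?_
  calc ∑ i, volume ((S.patch i).frame ⁻¹' Metric.closedBall x r)
      ≤ ∑ _i : Fin S.I, ENNReal.ofReal (4 * V * r ^ 2) := by
        refine Finset.sum_le_sum fun i _ => ?_
        rcases eq_empty_or_nonempty ((S.patch i).frame ⁻¹' Metric.closedBall x r) with h | ⟨a, ha⟩
        · rw [h]; simp
        · have hsub : (S.patch i).frame ⁻¹' Metric.closedBall x r ⊆ Metric.closedBall a (2 * r) := by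
            intro b hb
            have h1 : dist ((S.patch i).frame b) x ≤ r := hb
            have h2 : dist ((S.patch i).frame a) x ≤ r := ha
            rw [Metric.mem_closedBall, ← (S.patch i).frame_isometry.dist_eq]
            linarith [dist_triangle_right ((S.patch i).frame b) ((S.patch i).frame a) x]
          refine (measure_mono hsub).trans ?_
          rw [Measure.addHaar_closedBall _ _ (by positivity), ← hV',
            ← ENNReal.ofReal_mul (by positivity)]
          refine ENNReal.ofReal_le_ofReal (le_of_eq ?_)
          rw [finrank_euclideanSpace_fin]; ring
    _ = ENNReal.ofReal (S.I * (4 * V * r ^ 2)) := by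
        rw [Finset.sum_const, Finset.card_univ, Fintype.card_fin, nsmul_eq_mul,
          ENNReal.ofReal_mul (p := (S.I : ℝ)) (by positivity), ENNReal.ofReal_natCast]
    _ ≤ _ := ENNReal.ofReal_le_ofReal (by nlinarith [sq_nonneg r])

theorem exists_area_segment_le (p q : E3) : ∃ C : ℝ, 0 < C ∧ ∀ t : ℝ, 0 < t → t ≤ 1 →
    S.area {x | ∃ z ∈ segment ℝ p q, dist x z ≤ t} ≤ ENNReal.ofReal (C * t) := by
  obtain ⟨C, hC0, hC⟩ := S.exists_area_closedBall_le
  refine ⟨(‖q - p‖ + 3) * (C * 4), by positivity, fun t ht ht1 => ?_⟩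
  -- About `‖q - p‖ / t` balls of radius `2 t` cover the neighbourhood, each of area `≲ t²`. The
  -- summand one keeps `N` positive for degenerate segments.
  set N : ℕ := ⌈‖q - p‖ / t⌉₊ + 1 with hN
  have hN0 : (0 : ℝ) < N := by positivity
  have hN1 : ‖q - p‖ / t ≤ N := by
    rw [hN]; push_cast; linarith [Nat.le_ceil (‖q - p‖ / t)]
  have hN2 : (N : ℝ) ≤ ‖q - p‖ / t + 2 := by
    rw [hN]; push_cast
    linarith [(Nat.ceil_lt_add_one (by positivity : 0 ≤ ‖q - p‖ / t)).le]
  have hsub : {x | ∃ z ∈ segment ℝ p q, dist x z ≤ t} ⊆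
      ⋃ n ∈ Finset.range (N + 1), Metric.closedBall (p + ((n : ℝ) / N) • (q - p)) (2 * t) := by
    rintro x ⟨z, hz, hxz⟩
    rw [segment_eq_image'] at hz
    obtain ⟨s, ⟨hs0, hs1⟩, rfl⟩ := hz
    have hfl : ⌊s * N⌋₊ ≤ N := Nat.floor_le_of_le (by nlinarith)
    refine mem_iUnion₂.2 ⟨⌊s * N⌋₊, Finset.mem_range.2 (by omega), ?_⟩
    rw [Metric.mem_closedBall]
    have h1 : dist (p + s • (q - p)) (p + ((⌊s * N⌋₊ : ℝ) / N) • (q - p)) ≤ t := by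
      rw [dist_add_left, dist_eq_norm, ← sub_smul, norm_smul, Real.norm_eq_abs]
      have h2 : |s - (⌊s * N⌋₊ : ℝ) / N| ≤ 1 / N := by
        have h3 := Nat.floor_le (by positivity : 0 ≤ s * N)
        have h4 := (Nat.lt_floor_add_one (s * N)).le
        have h5 : s - (⌊s * N⌋₊ : ℝ) / N = (s * N - ⌊s * N⌋₊) / N := by field_simp
        rw [h5, abs_div, abs_of_pos hN0, abs_of_nonneg (by linarith)]
        gcongr
        linarith
      calc |s - (⌊s * N⌋₊ : ℝ) / N| * ‖q - p‖ ≤ 1 / N * ‖q - p‖ := by gcongr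
        _ ≤ t := by
          rw [div_le_iff₀ ht] at hN1
          rw [div_mul_eq_mul_div, one_mul, div_le_iff₀ hN0]
          linarith
    linarith [dist_triangle x (p + s • (q - p)) (p + ((⌊s * N⌋₊ : ℝ) / N) • (q - p))]
  refine (measure_mono hsub).trans ((measure_biUnion_finset_le _ _).trans ?_)
  calc ∑ n ∈ Finset.range (N + 1),
        S.area (Metric.closedBall (p + ((n : ℝ) / N) • (q - p)) (2 * t))
      ≤ ∑ _n ∈ Finset.range (N + 1), ENNReal.ofReal (C * (2 * t) ^ 2) :=
        Finset.sum_le_sum fun n _ => hC _ _ (by positivity)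
    _ = ENNReal.ofReal ((N + 1 : ℕ) * (C * (2 * t) ^ 2)) := by
        rw [Finset.sum_const, Finset.card_range, nsmul_eq_mul,
          ENNReal.ofReal_mul (p := ((N + 1 : ℕ) : ℝ)) (by positivity), ENNReal.ofReal_natCast]
    _ ≤ _ := by
        refine ENNReal.ofReal_le_ofReal ?_
        have h1 : ((N + 1 : ℕ) : ℝ) * t ≤ ‖q - p‖ + 3 := by
          push_cast
          have : (N : ℝ) * t ≤ (‖q - p‖ / t + 2) * t := by gcongr
          have h2 : (‖q - p‖ / t + 2) * t = ‖q - p‖ + 2 * t := by field_simp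
          nlinarith
        calc ((N + 1 : ℕ) : ℝ) * (C * (2 * t) ^ 2) = ((N + 1 : ℕ) * t) * (C * 4) * t := by ring
          _ ≤ (‖q - p‖ + 3) * (C * 4) * t := by gcongr

/-- The area of a neighbourhood of the interfaces. -/
theorem exists_area_distInterface_le : ∃ C : ℝ, 0 < C ∧ ∀ t : ℝ, 0 < t →
    S.area {x | S.distInterface x ≤ t} ≤ ENNReal.ofReal (C * t) := by
  choose C hC0 hC using fun c : Fin S.I × Fin 4 =>
    S.exists_area_segment_le ((S.patch c.1).vert c.2) ((S.patch c.1).vert (c.2 + 1))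
  set A := (S.area univ).toReal with hA
  have hA' : ENNReal.ofReal A = S.area univ := ENNReal.ofReal_toReal (measure_ne_top _ _)
  have hA0 : 0 ≤ A := ENNReal.toReal_nonneg
  have hsum : 0 ≤ ∑ c, C c := Finset.sum_nonneg fun c _ => (hC0 c).le
  refine ⟨∑ c, C c + A + 1, by positivity, fun t ht => ?_⟩
  rcases le_total t 1 with ht1 | ht1
  · have hsub : {x | S.distInterface x ≤ t} ⊆ ⋃ c : Fin S.I × Fin 4,
        {x | ∃ z ∈ segment ℝ ((S.patch c.1).vert c.2) ((S.patch c.1).vert (c.2 + 1)),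
          dist x z ≤ t} := by
      intro x hx
      obtain ⟨z, hz, hzd⟩ := S.isCompact_interface.exists_infDist_eq_dist S.interface_nonempty x
      obtain ⟨i, hi⟩ := mem_iUnion.1 hz
      rw [QuadPatch.rim, QuadPatch.dom_frontier, image_iUnion] at hi
      obtain ⟨a, ha⟩ := mem_iUnion.1 hi
      rw [← QuadPatch.edge_eq] at ha
      refine mem_iUnion.2 ⟨(i, a), z, ha, ?_⟩
      rw [← hzd]
      exact hx
    refine (measure_mono hsub).trans ((measure_iUnion_fintype_le _ _).trans ?_)
    calc _ ≤ ∑ c, ENNReal.ofReal (C c * t) := Finset.sum_le_sum fun c _ => hC c t ht ht1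
      _ = ENNReal.ofReal (∑ c, C c * t) :=
          (ENNReal.ofReal_sum_of_nonneg fun c _ => mul_nonneg (hC0 c).le ht.le).symm
      _ ≤ _ := by
          refine ENNReal.ofReal_le_ofReal ?_
          rw [← Finset.sum_mul]
          gcongr
          linarith
  · refine (measure_mono (subset_univ _)).trans ?_
    rw [← hA']
    refine ENNReal.ofReal_le_ofReal ?_
    nlinarith

end PolySurface

/-! ### Lifting, pairing and counting -/

namespace PolySurface

variable {m : ℕ} (S : PolySurface m)

theorem exists_lintegral_comp_kappa_le (hm : 1 ≤ m) : ∃ C : ℝ≥0, 0 < C ∧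
    ∀ (i : Fin S.I) (g : E3 → ℝ≥0∞),
      ∫⁻ x in openSquare, g ((S.patch i).kappa x) ≤ C * ∫⁻ x, g x ∂S.area := by
  choose C hC0 hC using fun i : Fin S.I => (S.patch i).exists_lintegral_comp_param_le hm
  refine ⟨∑ i, C i + 1, by positivity, fun i g => ?_⟩
  have h1 := hC i openSquare Subset.rfl isOpen_openSquare.measurableSet
    fun y => g ((S.patch i).frame y)
  rw [(S.patch i).param_open.image_eq] at h1
  refine h1.trans (mul_le_mul' ?_ (S.lintegral_dom_le i g))
  have : C i ≤ ∑ i, C i := Finset.single_le_sum (fun _ _ => zero_le) (Finset.mem_univ i)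
  exact_mod_cast this.trans (by simp)

theorem aemeasurable_kappa (i : Fin S.I) :
    AEMeasurable (S.patch i).kappa (volume.restrict openSquare) :=
  ((S.patch i).frame.continuous.comp_continuousOn
    ((S.patch i).param_contDiffOn.continuousOn)).aemeasurable isOpen_openSquare.measurableSet

/-- This makes the lifting of almost everywhere classes from the surface to the square legitimate.
-/
theorem map_kappa_absolutelyContinuous (hm : 1 ≤ m) (i : Fin S.I) :
    Measure.map (S.patch i).kappa (volume.restrict openSquare) ≪ S.area := by
  obtain ⟨C, -, hC⟩ := S.exists_lintegral_comp_kappa_le hm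
  refine Measure.AbsolutelyContinuous.mk fun A hA hA0 => ?_
  have h := hC i (A.indicator 1)
  rw [lintegral_indicator_one hA, hA0, mul_zero] at h
  rw [← lintegral_indicator_one hA, lintegral_map' (measurable_one.indicator hA).aemeasurable
    (S.aemeasurable_kappa i)]
  exact le_antisymm h zero_le

theorem aestronglyMeasurable_comp_kappa (hm : 1 ≤ m) {u : E3 → ℂ}
    (hu : AEStronglyMeasurable u S.area) (i : Fin S.I) :
    AEStronglyMeasurable (u ∘ (S.patch i).kappa) (volume.restrict openSquare) :=
  (hu.mono_ac (S.map_kappa_absolutelyContinuous hm i)).comp_aemeasurable (S.aemeasurable_kappa i)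

theorem eLpNorm_two_eq {X : Type*} [MeasurableSpace X] (μ : Measure X) (f : X → ℂ) :
    eLpNorm f 2 μ = (∫⁻ x, ‖f x‖ₑ ^ 2 ∂μ) ^ (1 / 2 : ℝ) := by
  rw [eLpNorm_eq_lintegral_rpow_enorm_toReal (by norm_num) (by norm_num)]
  norm_num

theorem exists_eLpNorm_comp_kappa_le (hm : 1 ≤ m) : ∃ C : ℝ≥0, 0 < C ∧
    ∀ (i : Fin S.I) (u : E3 → ℂ),
      eLpNorm (u ∘ (S.patch i).kappa) 2 (volume.restrict openSquare) ≤ C * eLpNorm u 2 S.area := by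
  obtain ⟨C, hC0, hC⟩ := S.exists_lintegral_comp_kappa_le hm
  refine ⟨C ^ (1 / 2 : ℝ), by positivity, fun i u => ?_⟩
  rw [eLpNorm_two_eq, eLpNorm_two_eq, ENNReal.coe_rpow_of_nonneg _ (by norm_num),
    ← ENNReal.mul_rpow_of_nonneg _ _ (by norm_num)]
  exact ENNReal.rpow_le_rpow (hC i fun x => ‖u x‖ₑ ^ 2) (by norm_num)

variable {S} in
theorem memLp_comp_kappa (hm : 1 ≤ m) {u : E3 → ℂ} (hu : MemLp u 2 S.area) (i : Fin S.I) :
    MemLp (u ∘ (S.patch i).kappa) 2 (volume.restrict openSquare) := by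
  obtain ⟨C, -, hC⟩ := S.exists_eLpNorm_comp_kappa_le hm
  exact ⟨S.aestronglyMeasurable_comp_kappa hm hu.1 i,
    (hC i u).trans_lt (ENNReal.mul_lt_top (by simp) hu.2)⟩

theorem pairing_eq (u v : E3 → ℂ) : S.pairing u v =
    ∑ i, ∫ x in openSquare, u ((S.patch i).kappa x) *
      starRingEnd ℂ (v ((S.patch i).kappa x)) := by
  rw [pairing, restrict_closedSquare]

variable {S} in
theorem integrable_pairing (hm : 1 ≤ m) {u v : E3 → ℂ} (hu : MemLp u 2 S.area)
    (hv : MemLp v 2 S.area) (i : Fin S.I) :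
    Integrable (fun x => u ((S.patch i).kappa x) * starRingEnd ℂ (v ((S.patch i).kappa x)))
      (volume.restrict openSquare) :=
  (memLp_comp_kappa hm hu i).integrable_mul (memLp_comp_kappa hm hv i).star

variable {S} in
theorem pairing_sub (hm : 1 ≤ m) {u w v : E3 → ℂ} (hu : MemLp u 2 S.area)
    (hw : MemLp w 2 S.area) (hv : MemLp v 2 S.area) :
    S.pairing (u - w) v = S.pairing u v - S.pairing w v := by
  simp only [pairing_eq, ← Finset.sum_sub_distrib]
  refine Finset.sum_congr rfl fun i _ => ?_
  rw [← integral_sub (integrable_pairing hm hu hv i) (integrable_pairing hm hw hv i)]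
  simp [sub_mul]

variable {S} in
theorem pairing_sum (hm : 1 ≤ m) {J : Type*} (s : Finset J) (c : J → ℂ) {f : J → E3 → ℂ}
    {v : E3 → ℂ} (hf : ∀ t ∈ s, MemLp (f t) 2 S.area) (hv : MemLp v 2 S.area) :
    S.pairing (fun x => ∑ t ∈ s, c t * f t x) v = ∑ t ∈ s, c t * S.pairing (f t) v := by
  simp only [pairing_eq, Finset.mul_sum]
  rw [Finset.sum_comm]
  refine Finset.sum_congr rfl fun i _ => ?_
  simp only [← integral_const_mul]
  rw [← integral_finsetSum _ fun t ht => (integrable_pairing hm (hf t ht) hv i).const_mul _]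
  simp only [Finset.sum_mul, mul_assoc]

theorem exists_enorm_pairing_le (hm : 1 ≤ m) : ∃ C : ℝ≥0, 0 < C ∧ ∀ u v : E3 → ℂ,
    MemLp u 2 S.area → MemLp v 2 S.area →
      ‖S.pairing u v‖ₑ ≤ C * eLpNorm u 2 S.area * eLpNorm v 2 S.area := by
  obtain ⟨C, hC0, hC⟩ := S.exists_eLpNorm_comp_kappa_le hm
  refine ⟨S.I * (C * C) + 1, by positivity, fun u v hu hv => ?_⟩
  rw [pairing_eq]
  refine (enorm_sum_le _ _).trans ?_
  have h : ∀ i : Fin S.I, ‖∫ x in openSquare, u ((S.patch i).kappa x) *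
      starRingEnd ℂ (v ((S.patch i).kappa x))‖ₑ ≤
      C * C * (eLpNorm u 2 S.area * eLpNorm v 2 S.area) := by
    intro i
    refine (enorm_integral_le_lintegral_enorm _).trans ?_
    have h1 := lintegral_mul_sq_le (μ := volume.restrict openSquare)
      (memLp_comp_kappa hm hu i).1.enorm (memLp_comp_kappa hm hv i).1.enorm
    rw [← eLpNorm_two_eq, ← eLpNorm_two_eq] at h1
    calc _ = ∫⁻ x in openSquare, ‖(u ∘ (S.patch i).kappa) x‖ₑ * ‖(v ∘ (S.patch i).kappa) x‖ₑ := by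
          simp [enorm_mul]
      _ ≤ _ := h1
      _ ≤ (C * eLpNorm u 2 S.area) * (C * eLpNorm v 2 S.area) := mul_le_mul' (hC i u) (hC i v)
      _ = _ := by ring
  refine (Finset.sum_le_sum fun i _ => h i).trans ?_
  rw [Finset.sum_const, Finset.card_univ, Fintype.card_fin, nsmul_eq_mul, ← mul_assoc, ← mul_assoc]
  gcongr
  push_cast
  exact le_self_add

theorem area_compl_frontier : S.area (frontier S.Ω)ᶜ = 0 := by
  rw [area, Measure.finsetSum_apply]
  refine Finset.sum_eq_zero fun i _ => ?_
  rw [Measure.map_apply (S.patch i).frame.continuous.measurable isClosed_frontier.measurableSet.compl,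
    Measure.restrict_apply (isClosed_frontier.measurableSet.compl.preimage
      (S.patch i).frame.continuous.measurable)]
  convert measure_empty (μ := volume)
  rw [eq_empty_iff_forall_notMem]
  rintro y ⟨h1, h2⟩
  exact h1 (SpecialResolution.frame_mem_frontier h2)

theorem ae_mem_frontier : ∀ᵐ x ∂S.area, x ∈ frontier S.Ω := S.area_compl_frontier

theorem restrict_frontier : S.area.restrict (frontier S.Ω) = S.area :=
  Measure.restrict_eq_self_of_ae_mem S.ae_mem_frontier

variable {S} in
theorem PwSmooth.memLp {w : E3 → ℂ} (hw : S.PwSmooth w) : MemLp w 2 S.area := by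
  obtain ⟨C, hC⟩ := S.isCompact_frontier.exists_bound_of_continuousOn hw.1
  refine MemLp.of_bound ?_ C (S.ae_mem_frontier.mono hC)
  have := hw.1.aestronglyMeasurable (μ := S.area) isClosed_frontier.measurableSet
  rwa [S.restrict_frontier] at this

variable {S} in
theorem PwSmooth.sub {w v : E3 → ℂ} (hw : S.PwSmooth w) (hv : S.PwSmooth v) :
    S.PwSmooth (w - v) :=
  ⟨hw.1.sub hv.1, fun i => (hw.2 i).sub (hv.2 i)⟩

end PolySurface

/-! ### Counting wavelets on a level -/

namespace PolySurface.WaveletSystem.IsWaveletBasis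

variable {m : ℕ} {S : PolySurface m} {W : S.WaveletSystem} {d : ℕ} {sΓ : ℝ}
  (hW : W.IsWaveletBasis d sΓ)
include hW

theorem exists_dist_point_le : ∃ C : ℝ, 0 < C ∧ ∀ j ≥ W.jstar, ∀ ξ ∈ W.level j,
    ∀ x ∈ tsupport (W.psiDual j ξ), dist x (W.point ξ) ≤ C * (2 ^ j)⁻¹ := by
  obtain ⟨C, hC0, hC⟩ := hW.supp_diam
  refine ⟨C, hC0, fun j hj ξ hξ x hx => ?_⟩
  exact (Metric.dist_le_diam_of_mem (S.isCompact_frontier.isBounded.subset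
    (hW.supp_subset j hj ξ hξ)) hx (hW.point_mem_supp j hj ξ hξ)).trans (hC j hj ξ hξ)

theorem memLp_psiDual {j : ℕ} (hj : W.jstar ≤ j) {ξ : W.Grid} (hξ : ξ ∈ W.level j) :
    MemLp (W.psiDual j ξ) 2 S.area :=
  hW.riesz_dual.1 (Sum.inr ⟨(j, ξ), hj, hξ⟩)

/-- A set contains the supports of a number of dual wavelets of a level that is proportional to
its area. -/
theorem exists_card_le_area : ∃ C : ℝ, 0 < C ∧ ∀ j ≥ W.jstar, ∀ (A : Set E3) (a : ℝ),
    MeasurableSet A → 0 ≤ a → S.area A ≤ ENNReal.ofReal a → ∀ T ⊆ W.level j,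
    (∀ ξ ∈ T, tsupport (W.psiDual j ξ) ⊆ A) → (T.card : ℝ) ≤ C * 2 ^ (2 * j) * a := by
  classical
  obtain ⟨N, hN⟩ := hW.overlap
  obtain ⟨c, _, hc0, -, hc⟩ := hW.supp_area
  refine ⟨(N + 1) / c, by positivity, fun j hj A a hA ha haA T hT hTA => ?_⟩
  have hp : (0 : ℝ) < 2 ^ (2 * j) := by positivity
  have hmeas : ∀ ξ, MeasurableSet (tsupport (W.psiDual j ξ)) := fun ξ =>
    (isClosed_tsupport _).measurableSet
  -- Double counting: the integral of the sum of the indicators of the supports is at least the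
  -- number of supports times the minimal area, and at most the overlap bound times the area of `A`.
  have h1 : (T.card : ℝ≥0∞) * ENNReal.ofReal (c * (2 ^ (2 * j))⁻¹) ≤ N * S.area A := by
    calc (T.card : ℝ≥0∞) * ENNReal.ofReal (c * (2 ^ (2 * j))⁻¹)
        = ∑ _ξ ∈ T, ENNReal.ofReal (c * (2 ^ (2 * j))⁻¹) := by
          rw [Finset.sum_const, nsmul_eq_mul]
      _ ≤ ∑ ξ ∈ T, ∫⁻ x, (tsupport (W.psiDual j ξ)).indicator 1 x ∂S.area :=
          Finset.sum_le_sum fun ξ hξ => by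
            rw [lintegral_indicator_one (hmeas ξ)]
            exact (hc j hj ξ (hT hξ)).1
      _ = ∫⁻ x, ∑ ξ ∈ T, (tsupport (W.psiDual j ξ)).indicator 1 x ∂S.area :=
          (lintegral_finsetSum _ fun ξ _ => measurable_one.indicator (hmeas ξ)).symm
      _ ≤ ∫⁻ x, (N : ℝ≥0∞) * A.indicator 1 x ∂S.area := by
          refine lintegral_mono_ae (S.ae_mem_frontier.mono fun x hx => ?_)
          have h2 : ∑ ξ ∈ T, (tsupport (W.psiDual j ξ)).indicator (1 : E3 → ℝ≥0∞) x =
              ((T.filter fun ξ => x ∈ tsupport (W.psiDual j ξ)).card : ℝ≥0∞) := by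
            simp only [indicator_apply, Pi.one_apply, Finset.sum_boole]
          rw [h2]
          by_cases hxA : x ∈ A
          · rw [indicator_of_mem hxA, Pi.one_apply, mul_one]
            refine Nat.cast_le.2 (le_trans ?_ (hN j hj x hx))
            rw [← Set.ncard_coe_finset]
            refine Set.ncard_le_ncard (fun ξ hξ => ?_)
              ((W.level j).finite_toSet.subset fun ξ hξ => hξ.1)
            have := Finset.mem_filter.1 (Finset.mem_coe.1 hξ)
            exact ⟨hT this.1, this.2⟩
          · rw [Finset.card_eq_zero.2]
            · simp
            · exact Finset.filter_eq_empty_iff.2 fun ξ hξ h => hxA (hTA ξ hξ h)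
      _ = N * S.area A := by
          rw [lintegral_const_mul _ (measurable_one.indicator hA), lintegral_indicator_one hA]
  have h2 : ENNReal.ofReal (T.card * (c * (2 ^ (2 * j))⁻¹)) ≤ ENNReal.ofReal (N * a) := by
    rw [ENNReal.ofReal_mul (p := (T.card : ℝ)) (by positivity), ENNReal.ofReal_natCast,
      ENNReal.ofReal_mul (p := (N : ℝ)) (by positivity), ENNReal.ofReal_natCast]
    exact h1.trans (mul_le_mul' le_rfl haA)
  rw [ENNReal.ofReal_le_ofReal_iff (by positivity)] at h2
  rw [← mul_assoc, ← div_eq_mul_inv, div_le_iff₀ hp] at h2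
  rw [div_mul_eq_mul_div, div_mul_eq_mul_div, le_div_iff₀ hc0]
  nlinarith [mul_nonneg hp.le ha]

theorem exists_card_ball_le {b : ℝ} (hb : 0 < b) : ∃ C : ℝ, 0 < C ∧ ∀ j ≥ W.jstar, ∀ x : E3,
    ∀ T ⊆ W.level j, (∀ ξ ∈ T, dist (W.point ξ) x ≤ b * (2 ^ j)⁻¹) → (T.card : ℝ) ≤ C := by
  obtain ⟨C1, hC1, h1⟩ := hW.exists_card_le_area
  obtain ⟨C2, hC2, h2⟩ := hW.exists_dist_point_le
  obtain ⟨C3, hC3, h3⟩ := S.exists_area_closedBall_le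
  refine ⟨C1 * (C3 * (C2 + b) ^ 2), by positivity, fun j hj x T hT hTx => ?_⟩
  have hp : (0 : ℝ) < 2 ^ j := by positivity
  refine (h1 j hj (Metric.closedBall x ((C2 + b) * (2 ^ j)⁻¹)) _
    Metric.isClosed_closedBall.measurableSet (by positivity) (h3 x _ (by positivity)) T hT
    fun ξ hξ y hy => ?_).trans (le_of_eq ?_)
  · rw [Metric.mem_closedBall, add_mul]
    exact (dist_triangle _ (W.point ξ) _).trans (add_le_add (h2 j hj ξ (hT hξ) y hy) (hTx ξ hξ))
  · field_simp
    ring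

/-- The supports lie in a strip of width `t + C2 2^{-j}` around the interfaces, whose area is
proportional to its width. -/
theorem exists_card_distInterface_le : ∃ C : ℝ, 0 < C ∧ ∀ j ≥ W.jstar, ∀ t : ℝ, 0 < t →
    ∀ T ⊆ W.level j, (∀ ξ ∈ T, S.distInterface (W.point ξ) ≤ t) →
      (T.card : ℝ) ≤ C * 2 ^ (2 * j) * (t + (2 ^ j)⁻¹) := by
  obtain ⟨C1, hC1, h1⟩ := hW.exists_card_le_area
  obtain ⟨C2, hC2, h2⟩ := hW.exists_dist_point_le
  obtain ⟨C3, hC3, h3⟩ := S.exists_area_distInterface_le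
  refine ⟨C1 * (C3 * (1 + C2)), by positivity, fun j hj t ht T hT hTx => ?_⟩
  refine (h1 j hj {x | S.distInterface x ≤ t + C2 * (2 ^ j)⁻¹} _
    (isClosed_le S.continuous_distInterface continuous_const).measurableSet (by positivity)
    (h3 _ (by positivity)) T hT fun ξ hξ y hy => ?_).trans ?_
  · have h4 := h2 j hj ξ (hT hξ) y hy
    have h5 : S.distInterface y ≤ S.distInterface (W.point ξ) + dist y (W.point ξ) :=
      Metric.infDist_le_infDist_add_dist
    have h6 := hTx ξ hξ
    show S.distInterface y ≤ _
    linarith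
  · have h4 : t + C2 * (2 ^ j)⁻¹ ≤ (1 + C2) * (t + (2 ^ j)⁻¹) := by
      have : (0 : ℝ) < (2 ^ j)⁻¹ := by positivity
      nlinarith [mul_pos hC2 ht]
    calc C1 * 2 ^ (2 * j) * (C3 * (t + C2 * (2 ^ j)⁻¹))
        ≤ C1 * 2 ^ (2 * j) * (C3 * ((1 + C2) * (t + (2 ^ j)⁻¹))) := by gcongr
      _ = _ := by ring

end PolySurface.WaveletSystem.IsWaveletBasis

/-! ### Coefficients of wavelets in the interior of a patch -/

namespace PolySurface

variable {m : ℕ} (S : PolySurface m)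

/-- Points of small distance to a point that is further away from the interfaces lie in the image
of a small ball in the parameter domain. -/
theorem exists_chart_ball (hm : 1 ≤ m) {r : ℝ} (hr : 0 < r) : ∃ B a b : ℝ, 0 < B ∧ 0 < a ∧ 0 < b ∧
    ∀ (i : Fin S.I), ∀ x₀ ∈ (S.patch i).closedFace, ∀ ε : ℝ, 0 < ε → B * ε < S.distInterface x₀ →
    (∀ x ∈ frontier S.Ω, dist x x₀ ≤ r * ε → x ∈ (S.patch i).face) ∧
    ∃ t₀, Metric.ball t₀ (a * ε) ⊆ openSquare ∧
      (∀ x ∈ openSquare, dist ((S.patch i).kappa x) x₀ ≤ r * ε → x ∈ Metric.ball t₀ (a * ε)) ∧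
      ∀ x ∈ Metric.ball t₀ (a * ε), dist ((S.patch i).kappa x) x₀ ≤ b * ε ∧
        S.distInterface x₀ ≤ 2 * S.distInterface ((S.patch i).kappa x) := by
  obtain ⟨Cs, hCs0, hCs⟩ := S.exists_distInterface_le_dist
  choose L hL0 hL using fun i : Fin S.I => (S.patch i).exists_lipschitz_param hm
  choose M hM0 hM using fun i : Fin S.I => (S.patch i).exists_norm_fderiv_paramInv_le hm
  set L' : ℝ := ∑ i, (L i : ℝ) with hL'
  set M' : ℝ := ∑ i, (M i : ℝ) with hM'
  have hLi : ∀ i, (L i : ℝ) ≤ L' := fun i =>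
    Finset.single_le_sum (f := fun i => (L i : ℝ)) (fun _ _ => NNReal.coe_nonneg _)
      (Finset.mem_univ i)
  have hMi : ∀ i, (M i : ℝ) ≤ M' := fun i =>
    Finset.single_le_sum (f := fun i => (M i : ℝ)) (fun _ _ => NNReal.coe_nonneg _)
      (Finset.mem_univ i)
  have hLnn : 0 ≤ L' := Finset.sum_nonneg fun _ _ => NNReal.coe_nonneg _
  have hMnn : 0 ≤ M' := Finset.sum_nonneg fun _ _ => NNReal.coe_nonneg _
  -- `M'` is a Lipschitz bound for the inverse charts, so `a ε` captures the preimage of the ball of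
  -- radius `r ε`; `L'` bounds the charts, so `b ε` captures the image of the parameter ball. In the
  -- final constant, `Cs * r` keeps the other patches away and `2 * b` ensures that at least half of
  -- the distance to the interfaces survives.
  set a : ℝ := (M' + 1) * r with ha
  set b : ℝ := L' * a + r with hb
  have ha0 : 0 < a := by positivity
  have hb0 : 0 < b := by positivity
  refine ⟨Cs * r + 2 * b, a, b, by positivity, ha0, hb0, fun i x₀ hx₀ ε hε hd => ?_⟩
  have hCrε : 0 < Cs * r * ε := by positivity
  have hbε : 0 < b * ε := by positivity
  have hLaε : 0 ≤ L' * a * ε := by positivity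
  have hrε : 0 < r * ε := by positivity
  have hbr : r * ε + L' * a * ε = b * ε := by rw [hb]; ring
  have hd' : Cs * r * ε + 2 * (b * ε) < S.distInterface x₀ := by linarith
  have hrim : ∀ x ∈ (S.patch i).rim, S.distInterface x₀ ≤ dist x x₀ := fun x hx => by
    rw [dist_comm]; exact S.distInterface_le_dist (S.rim_subset_interface i hx)
  have hx₀' : x₀ ∈ (S.patch i).face := by
    rw [QuadPatch.closedFace_eq] at hx₀
    refine hx₀.resolve_right fun h => ?_
    have := hrim x₀ h
    rw [dist_self] at this
    linarith
  refine ⟨fun x hx hxx₀ => ?_, ?_⟩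
  · rw [S.boundary] at hx
    obtain ⟨l, hl⟩ := mem_iUnion.1 hx
    by_cases hil : i = l
    · subst hil
      rw [QuadPatch.closedFace_eq] at hl
      refine hl.resolve_right fun h => ?_
      have := hrim x h
      linarith
    · have := hCs i l hil x₀ hx₀' x hl
      rw [dist_comm] at this
      have h2 : Cs * dist x x₀ ≤ Cs * (r * ε) := by gcongr
      linarith
  obtain ⟨y₀, hy₀, rfl⟩ := hx₀'
  set F := S.patch i with hF
  have hout : ∀ p, p ∉ F.dom → S.distInterface (F.frame y₀) ≤ dist y₀ p := fun p hp =>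
    S.distInterface_le_of_notMem hy₀ hp
  have hball : Metric.closedBall y₀ (r * ε) ⊆ F.dom := fun p hp => by
    by_contra h
    have := hout p h
    rw [Metric.mem_closedBall, dist_comm] at hp
    linarith
  set t₀ := F.paramInv y₀ with ht₀
  have ht₀m : t₀ ∈ openSquare := F.paramInv_mem hy₀
  have hpt₀ : F.param t₀ = y₀ := F.param_paramInv hy₀
  have hclos : closure openSquare ⊆ closedSquare :=
    isCompact_closedSquare.isClosed.closure_subset_iff.2 openSquare_subset_closedSquare
  have hlip : ∀ q ∈ closedSquare, dist (F.param q) y₀ ≤ L' * dist q t₀ := fun q hq => by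
    rw [← hpt₀]
    exact ((hL i).dist_le_mul q hq t₀ (openSquare_subset_closedSquare ht₀m)).trans
      (mul_le_mul_of_nonneg_right (hLi i) dist_nonneg)
  -- A ball leaving the square would contain a boundary point of it. The image of that point is
  -- outside the open patch but at distance at most `L' a ε` from the centre, less than the distance
  -- to the interfaces.
  have hsub : Metric.ball t₀ (a * ε) ⊆ openSquare := by
    intro p hp
    by_contra hpn
    obtain ⟨q, hq, hqf⟩ := exists_mem_segment_frontier ht₀m hpn
    have hqc : q ∈ closedSquare := hclos hqf.1
    have hqo : q ∉ openSquare := by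
      rw [isOpen_openSquare.frontier_eq] at hqf; exact hqf.2
    have hqd : F.param q ∉ F.dom := fun h => by
      obtain ⟨q', hq', hqq'⟩ := F.param_open.surjOn h
      exact hqo (F.param_closed.injOn (openSquare_subset_closedSquare hq') hqc hqq' ▸ hq')
    have h1 := hout _ hqd
    have h2 := hlip q hqc
    have hqb : q ∈ Metric.ball t₀ (a * ε) :=
      (convex_ball t₀ (a * ε)).segment_subset (Metric.mem_ball_self (by positivity)) hp hq
    have h3 : L' * dist q t₀ ≤ L' * (a * ε) := by gcongr; exact hqb.le
    rw [dist_comm] at h1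
    linarith
  refine ⟨t₀, hsub, fun x hx hxr => ?_, fun x hx => ?_⟩
  · have hxr' : dist (F.param x) y₀ ≤ r * ε := by rwa [← F.frame_isometry.dist_eq]
    have h1 : dist (F.paramInv (F.param x)) (F.paramInv y₀) ≤ M i * dist (F.param x) y₀ := by
      rw [dist_eq_norm, dist_eq_norm]
      refine (convex_closedBall y₀ (r * ε)).norm_image_sub_le_of_norm_fderiv_le (𝕜 := ℝ)
        (fun z hz => ?_) (fun z hz => hM i z (hball hz))
        (Metric.mem_closedBall_self hrε.le) (Metric.mem_closedBall.2 hxr')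
      exact ((F.paramInv_contDiffOn.mono subset_closure).contDiffAt
        (F.dom_open.mem_nhds (hball hz))).differentiableAt (by norm_cast; omega)
    rw [F.paramInv_param (openSquare_subset_closedSquare hx)] at h1
    rw [Metric.mem_ball]
    calc dist x t₀ ≤ M i * dist (F.param x) y₀ := h1
      _ ≤ M' * (r * ε) := mul_le_mul (hMi i) hxr' dist_nonneg hMnn
      _ < a * ε := by rw [ha]; linarith
  · have h1 : dist (F.kappa x) (F.frame y₀) ≤ L' * dist x t₀ := by
      rw [QuadPatch.kappa, F.frame_isometry.dist_eq]
      exact hlip x (openSquare_subset_closedSquare (hsub hx))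
    have h2 : L' * dist x t₀ ≤ L' * (a * ε) := by gcongr; exact (Metric.mem_ball.1 hx).le
    refine ⟨by linarith, ?_⟩
    have h3 : S.distInterface (F.frame y₀) ≤ S.distInterface (F.kappa x) +
      dist (F.frame y₀) (F.kappa x) := Metric.infDist_le_infDist_add_dist
    rw [dist_comm] at h3
    linarith

end PolySurface

namespace PolySurface.WaveletSystem.IsWaveletBasis

variable {m : ℕ} {S : PolySurface m} {W : S.WaveletSystem} {d : ℕ} {sΓ : ℝ}
  (hW : W.IsWaveletBasis d sΓ)
include hW

/-- Vanishing moments and Cauchy's inequality for wavelets supported in a patch. -/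
theorem enorm_coeff_le_of_tsupport (hm : 1 ≤ m) {j : ℕ} (hj : W.jstar ≤ j) {ξ : W.Grid}
    (hξ : ξ ∈ W.level j) {i : Fin S.I} (hsupp : tsupport (W.psiDual j ξ) ⊆ (S.patch i).face)
    {D : Set E2} (hD : IsOpen D) (hc : Convex ℝ D) (hne : D.Nonempty) (hDs : D ⊆ openSquare)
    (hDsupp : ∀ x ∈ openSquare, (S.patch i).kappa x ∈ tsupport (W.psiDual j ξ) → x ∈ D)
    {r : ℝ} (hr : ∀ x ∈ D, ∀ y ∈ D, dist x y ≤ r) {n : ℕ} (hnm : n + 1 ≤ m) (hnd : n + 1 ≤ d)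
    {w : E3 → ℂ} (hw : S.PwSmooth w) :
    ‖W.coeff w j ξ‖ₑ ≤ 2 * ENNReal.ofReal r ^ (n + 1) *
      (∫⁻ x in D, ‖iteratedFDeriv ℝ (n + 1) ((w ∘ (S.patch i).frame) ∘ (S.patch i).param) x‖ₑ ^ 2)
        ^ (1 / 2 : ℝ) *
      eLpNorm (W.psiDual j ξ ∘ (S.patch i).kappa) 2 (volume.restrict openSquare) := by
  set F := S.patch i with hF
  set ψ : E2 → ℂ := fun x => starRingEnd ℂ (W.psiDual j ξ (F.kappa x)) with hψ
  have hψ0 : ∀ x ∈ openSquare, x ∉ D → ψ x = 0 := fun x hx hxD => by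
    have : W.psiDual j ξ (F.kappa x) = 0 := image_eq_zero_of_notMem_tsupport
      fun h => hxD (hDsupp x hx h)
    rw [hψ]; simp [this]
  have hmL := hW.memLp_psiDual hj hξ
  have hred : ∀ f : E2 → ℂ, ∫ x in openSquare, f x * ψ x = ∫ x in D, f x * ψ x := fun f =>
    (setIntegral_eq_of_subset_of_forall_sdiff_eq_zero isOpen_openSquare.measurableSet hDs
      fun x hx => by rw [hψ0 x hx.1 hx.2, mul_zero])
  have hcoeff : W.coeff w j ξ = ∫ x in D, ((w ∘ F.frame) ∘ F.param) x * ψ x := by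
    rw [← hred, coeff, pairing_eq, Finset.sum_eq_single_of_mem i (Finset.mem_univ i)]
    · rfl
    · intro l _ hl
      refine setIntegral_eq_zero_of_forall_eq_zero fun x hx => ?_
      have : W.psiDual j ξ ((S.patch l).kappa x) = 0 := by
        refine image_eq_zero_of_notMem_tsupport fun h => ?_
        refine disjoint_left.1 (S.disjoint_face_closedFace hl.symm) (hsupp h) ?_
        exact mem_image_of_mem _ (subset_closure ((S.patch l).param_open.mapsTo hx))
      rw [this, map_zero, mul_zero]
  have hψL : MemLp ψ 2 (volume.restrict openSquare) := (memLp_comp_kappa hm hmL i).star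
  have hψD : MemLp ψ 2 (volume.restrict D) := hψL.mono_measure (Measure.restrict_mono hDs le_rfl)
  rw [hcoeff]
  refine (enorm_integral_mul_le_of_vanishing hD hc hne hr (n := n) ?_ hψD ?_ ?_).trans ?_
  · refine ContDiffOn.comp (t := F.dom) ?_ (F.param_contDiffOn.mono hDs |>.of_le
      (by exact_mod_cast hnm)) (F.param_open.mapsTo.mono_left hDs)
    exact ((hw.2 i).mono subset_closure).of_le ENat.LEInfty.out
  · exact (integrable_pairing hm hw.memLp hmL i).mono_measure (Measure.restrict_mono hDs le_rfl)
  · intro P hP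
    rw [← hred, ← restrict_closedSquare]
    exact hW.vanishing j hj ξ hξ i hsupp P (hP.trans_le hnd)
  · refine mul_le_mul' le_rfl ?_
    rw [eLpNorm_two_eq]
    refine ENNReal.rpow_le_rpow ?_ (by norm_num)
    refine (lintegral_mono_set hDs).trans_eq ?_
    simp [hψ]

/-- The estimate of a wavelet coefficient by a weighted norm over a neighbourhood of the support. -/
theorem exists_interior_coeff_le {k : ℕ} (hk : 1 ≤ k) (hkm : k ≤ m) (hkd : k ≤ d) {μ : ℝ}
    (hμ : 0 ≤ μ) : ∃ B b : ℝ, ∃ C : ℝ≥0, 0 < B ∧ 0 < b ∧ ∀ w, S.PwSmooth w → ∀ j ≥ W.jstar,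
      ∀ i, ∀ ξ ∈ W.nabla j i, B * (2 ^ j)⁻¹ < S.distInterface (W.point ξ) →
      (ENNReal.ofReal (S.distInterface (W.point ξ) ^ μ * 2 ^ (j * k)) * ‖W.coeff w j ξ‖ₑ) ^ 2 ≤
        C * ∫⁻ y in (S.patch i).dom ∩
          {y | dist (W.point ξ) ((S.patch i).frame y) ≤ b * (2 ^ j)⁻¹},
          ∑ l ∈ Finset.Icc 1 k, SpecialResolution.weightedSq S i μ l (w ∘ (S.patch i).frame) y := by
  classical
  have hm : 1 ≤ m := hk.trans hkm
  obtain ⟨r, hr0, hr⟩ := hW.exists_dist_point_le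
  obtain ⟨B, a, b, hB, ha, hb, hgeo⟩ := S.exists_chart_ball hm hr0
  obtain ⟨_, Cn, -, -, hCn⟩ := hW.normalized
  obtain ⟨Ck, -, hCk⟩ := S.exists_eLpNorm_comp_kappa_le hm
  choose Cd hCd0 hCd using fun i : Fin S.I =>
    (S.patch i).exists_norm_iteratedFDeriv_comp_param_le k hk hkm
  choose Cv hCv0 hCv using fun i : Fin S.I => (S.patch i).exists_lintegral_comp_param_le hm
  set CD : ℝ≥0 := ∑ i, (Cd i).toNNReal with hCD
  set CV : ℝ≥0 := ∑ i, Cv i with hCV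
  set A : ℝ≥0 := (2 * (2 * a)^k * 2 ^ μ).toNNReal * (Ck * Cn) with hA
  refine ⟨B, b, A ^ 2 * (CD ^ 2 * k * CV), hB, hb, fun w hw j hj i ξ hξ hd => ?_⟩
  have hξl : ξ ∈ W.level j := Finset.mem_biUnion.2 ⟨i, Finset.mem_univ i, hξ⟩
  set ε : ℝ := (2 ^ j)⁻¹ with hε
  have hε0 : 0 < ε := by positivity
  obtain ⟨hface, t₀, hsub, hin, hD⟩ := hgeo i _ (hW.point_mem j hj i ξ hξ) ε hε0 hd
  set F := S.patch i with hF
  set D := Metric.ball t₀ (a * ε) with hDdef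
  set h : E2 → ℂ := w ∘ F.frame with hh
  have hhs : ContDiffOn ℝ ∞ h F.dom := (hw.2 i).mono subset_closure
  set dξ := S.distInterface (W.point ξ) with hdξ
  obtain ⟨n, rfl⟩ : ∃ n, k = n + 1 := ⟨k - 1, by omega⟩
  have h1 := hW.enorm_coeff_le_of_tsupport hm hj hξl (i := i) (D := D) (r := 2 * (a * ε)) (n := n)
    (fun x hx => hface x (hW.supp_subset j hj ξ hξl hx) (hr j hj ξ hξl x hx)) Metric.isOpen_ball
    (convex_ball _ _) (Metric.nonempty_ball.2 (by positivity)) hsub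
    (fun x hx hxs => hin x hx (hr j hj ξ hξl _ hxs))
    (fun x hx y hy => by
      rw [hDdef, Metric.mem_ball] at hx hy
      linarith [dist_triangle_right x y t₀]) hkm hkd hw
  set Q : ℝ≥0∞ := ∫⁻ x in D, ‖iteratedFDeriv ℝ (n + 1) (h ∘ F.param) x‖ₑ ^ 2 with hQ
  set P : Set E2 := F.dom ∩ {y | dist (W.point ξ) (F.frame y) ≤ b * ε} with hP
  set G : E2 → ℝ≥0∞ := fun y => ∑ l ∈ Finset.Icc 1 (n + 1), SpecialResolution.weightedSq S i μ l h y
    with hG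
  have hpsi : eLpNorm (W.psiDual j ξ ∘ F.kappa) 2 (volume.restrict openSquare) ≤ (Ck * Cn : ℝ≥0) := by
    push_cast
    exact (hCk i _).trans (mul_le_mul' le_rfl (hCn j hj ξ hξl).2)
  have hCDi : (Cd i).toNNReal ≤ CD := Finset.single_le_sum (f := fun i => (Cd i).toNNReal)
    (fun _ _ => zero_le) (Finset.mem_univ i)
  have hCVi : Cv i ≤ CV := Finset.single_le_sum (f := Cv) (fun _ _ => zero_le) (Finset.mem_univ i)
  -- On `D` the distance to the interfaces is at least half of that of the grid point. As `μ ≥ 0`,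
  -- the constant weight is dominated by the pointwise one.
  have hpt : ∀ x ∈ D, ENNReal.ofReal ((dξ / 2) ^ μ) ^ 2 *
      ‖iteratedFDeriv ℝ (n + 1) (h ∘ F.param) x‖ₑ ^ 2 ≤
      (CD ^ 2 * (n + 1 : ℕ) : ℝ≥0) * G (F.param x) := by
    intro x hx
    have h2 : ‖iteratedFDeriv ℝ (n + 1) (h ∘ F.param) x‖ₑ ≤
        CD * ∑ l ∈ Finset.Icc 1 (n + 1), ‖iteratedFDeriv ℝ l h (F.param x)‖ₑ := by
      rw [← ofReal_norm]
      refine (ENNReal.ofReal_le_ofReal (hCd i h hhs x (hsub hx))).trans ?_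
      rw [ENNReal.ofReal_mul (hCd0 i).le, ENNReal.ofReal_sum_of_nonneg fun _ _ => norm_nonneg _]
      simp only [ofReal_norm]
      exact mul_le_mul' (ENNReal.coe_le_coe.2 hCDi) le_rfl
    have h3 : ENNReal.ofReal ((dξ / 2) ^ μ) ≤
        ENNReal.ofReal (S.distInterface (F.frame (F.param x)) ^ μ) := by
      refine ENNReal.ofReal_le_ofReal (Real.rpow_le_rpow (by
        have := S.distInterface_nonneg (W.point ξ); positivity) ?_ hμ)
      have := (hD x hx).2
      rw [QuadPatch.kappa] at this
      linarith
    calc ENNReal.ofReal ((dξ / 2) ^ μ) ^ 2 * ‖iteratedFDeriv ℝ (n + 1) (h ∘ F.param) x‖ₑ ^ 2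
        ≤ ENNReal.ofReal (S.distInterface (F.frame (F.param x)) ^ μ) ^ 2 *
          (CD * ∑ l ∈ Finset.Icc 1 (n + 1), ‖iteratedFDeriv ℝ l h (F.param x)‖ₑ) ^ 2 := by gcongr
      _ = CD ^ 2 * (∑ l ∈ Finset.Icc 1 (n + 1),
          ENNReal.ofReal (S.distInterface (F.frame (F.param x)) ^ μ) *
            ‖iteratedFDeriv ℝ l h (F.param x)‖ₑ) ^ 2 := by
          rw [← Finset.mul_sum]; ring
      _ ≤ CD ^ 2 * ((Finset.Icc 1 (n + 1)).card * G (F.param x)) := by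
          gcongr; exact ENNReal.sum_sq_le _ _
      _ = _ := by
          rw [Nat.card_Icc, Nat.add_sub_cancel, ← mul_assoc]; push_cast; rfl
  have hint : ENNReal.ofReal ((dξ / 2) ^ μ) ^ 2 * Q ≤
      (CD ^ 2 * (n + 1 : ℕ) * CV : ℝ≥0) * ∫⁻ y in P, G y := by
    rw [hQ, ← lintegral_const_mul' _ _ (by simp)]
    calc _ ≤ ∫⁻ x in D, (CD ^ 2 * (n + 1 : ℕ) : ℝ≥0) * G (F.param x) :=
          setLIntegral_mono' Metric.isOpen_ball.measurableSet hpt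
      _ = (CD ^ 2 * (n + 1 : ℕ) : ℝ≥0) * ∫⁻ x in D, G (F.param x) :=
          lintegral_const_mul' _ _ ENNReal.coe_ne_top
      _ ≤ (CD ^ 2 * (n + 1 : ℕ) : ℝ≥0) * (CV * ∫⁻ y in P, G y) := by
          refine mul_le_mul' le_rfl ((hCv i D hsub Metric.isOpen_ball.measurableSet G).trans
            (mul_le_mul' (ENNReal.coe_le_coe.2 hCVi) (lintegral_mono_set ?_)))
          rintro _ ⟨x, hx, rfl⟩
          refine ⟨F.param_open.mapsTo (hsub hx), ?_⟩
          show dist _ _ ≤ _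
          rw [dist_comm]
          exact (hD x hx).1
      _ = _ := by push_cast; ring
  have hdξ0 : 0 ≤ dξ := S.distInterface_nonneg _
  -- The level factor `2^(jk)` cancels the power `ε^k` gained from the vanishing moments.
  have hscale : ENNReal.ofReal (dξ ^ μ * 2 ^ (j * (n + 1))) *
      (2 * ENNReal.ofReal (2 * (a * ε)) ^ (n + 1)) =
      ENNReal.ofReal (2 * (2 * a) ^ (n + 1) * 2 ^ μ) * ENNReal.ofReal ((dξ / 2) ^ μ) := by
    rw [← ENNReal.ofReal_pow (by positivity), ← ENNReal.ofReal_ofNat 2,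
      ← ENNReal.ofReal_mul (by positivity), ← ENNReal.ofReal_mul (by positivity),
      ← ENNReal.ofReal_mul (by positivity)]
    congr 1
    have h2 : (2 : ℝ) ^ μ ≠ 0 := (Real.rpow_pos_of_pos two_pos _).ne'
    have h3 : (2 : ℝ) ^ (j * (n + 1)) * ε ^ (n + 1) = 1 := by
      rw [pow_mul, ← mul_pow, hε, mul_inv_cancel₀ (by positivity), one_pow]
    rw [Real.div_rpow hdξ0 (by norm_num), ← mul_assoc 2 a ε, mul_pow (2 * a) ε]
    calc _ = dξ ^ μ * (2 * (2 * a) ^ (n + 1)) * (2 ^ (j * (n + 1)) * ε ^ (n + 1)) := by ring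
      _ = _ := by rw [h3]; field_simp
  have hA' : (A : ℝ≥0∞) = ENNReal.ofReal (2 * (2 * a) ^ (n + 1) * 2 ^ μ) * (Ck * Cn : ℝ≥0) := by
    rw [hA, ENNReal.coe_mul]; rfl
  calc (ENNReal.ofReal (dξ ^ μ * 2 ^ (j * (n + 1))) * ‖W.coeff w j ξ‖ₑ) ^ 2
      ≤ (ENNReal.ofReal (dξ ^ μ * 2 ^ (j * (n + 1))) *
        (2 * ENNReal.ofReal (2 * (a * ε)) ^ (n + 1) * Q ^ (1 / 2 : ℝ) * (Ck * Cn : ℝ≥0))) ^ 2 := by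
        gcongr
        exact h1.trans (mul_le_mul' le_rfl hpsi)
    _ = (A * (ENNReal.ofReal ((dξ / 2) ^ μ) * Q ^ (1 / 2 : ℝ))) ^ 2 := by
        congr 1
        rw [hA']
        calc _ = (ENNReal.ofReal (dξ ^ μ * 2 ^ (j * (n + 1))) *
            (2 * ENNReal.ofReal (2 * (a * ε)) ^ (n + 1))) * (Q ^ (1 / 2 : ℝ) * (Ck * Cn : ℝ≥0)) := by
              ring
          _ = _ := by rw [hscale]; ring
    _ = A ^ 2 * (ENNReal.ofReal ((dξ / 2) ^ μ) ^ 2 * Q) := by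
        rw [mul_pow, mul_pow, ENNReal.rpow_half_sq]
    _ ≤ A ^ 2 * ((CD ^ 2 * (n + 1 : ℕ) * CV : ℝ≥0) * ∫⁻ y in P, G y) := by gcongr
    _ = _ := by push_cast; ring

end PolySurface.WaveletSystem.IsWaveletBasis

theorem ENNReal.sum_biUnion_le {ι κ : Type*} [DecidableEq κ] (s : Finset ι) (t : ι → Finset κ)
    (f : κ → ℝ≥0∞) : ∑ x ∈ s.biUnion t, f x ≤ ∑ i ∈ s, ∑ x ∈ t i, f x := by
  classical
  induction s using Finset.induction_on with
  | empty => simp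
  | insert a s ha ih =>
    rw [Finset.biUnion_insert, Finset.sum_insert ha]
    refine le_trans ?_ (add_le_add_right ih _)
    rw [← Finset.sum_union_inter]
    exact le_self_add

/-! ### Weighted square sums of the coefficients on a level -/

namespace PolySurface.WaveletSystem.IsWaveletBasis

open PolySurface.SpecialResolution

variable {m : ℕ} {S : PolySurface m} {W : S.WaveletSystem} {d : ℕ} {sΓ : ℝ}
  (hW : W.IsWaveletBasis d sΓ)
include hW

open Classical in
/-- Weighted estimate of the coefficients of the wavelets away from the interfaces. -/
theorem exists_interior_sum_le (R : S.SpecialResolution) {k : ℕ} (hk : 1 ≤ k) (hkm : k ≤ m)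
    (hkd : k ≤ d) {ρ : ℝ} (hρ : 0 < ρ) (hρk : ρ < k) :
    ∃ B : ℝ, ∃ C : ℝ≥0, 0 < B ∧ ∀ w, S.PwSmooth w → ∀ j ≥ W.jstar,
      ∑ ξ ∈ (W.level j).filter fun ξ => B * (2 ^ j)⁻¹ < S.distInterface (W.point ξ),
        (ENNReal.ofReal (S.distInterface (W.point ξ) ^ (k - ρ) * 2 ^ (j * k)) *
          ‖W.coeff w j ξ‖ₑ) ^ 2 ≤ C * R.weightedNorm k ρ w ^ 2 := by
  obtain ⟨B, b, C, hB, hb, hC⟩ := hW.exists_interior_coeff_le hk hkm hkd (μ := k - ρ) (by linarith)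
  obtain ⟨N, hN0, hN⟩ := hW.exists_card_ball_le hb
  choose Cx hCx using fun i : Fin S.I => R.lintegral_weightedSq_le k hρ hρk i
  refine ⟨B, ∑ i, C * (N.toNNReal * (k * Cx i)), hB, fun w hw j hj => ?_⟩
  set f : W.Grid → ℝ≥0∞ := fun ξ =>
    (ENNReal.ofReal (S.distInterface (W.point ξ) ^ (k - ρ) * 2 ^ (j * k)) *
      ‖W.coeff w j ξ‖ₑ) ^ 2 with hf
  set far : W.Grid → Prop := fun ξ => B * (2 ^ j)⁻¹ < S.distInterface (W.point ξ) with hfar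
  have hi : ∀ i, ∑ ξ ∈ (W.nabla j i).filter far, f ξ ≤
      (C * (N.toNNReal * (k * Cx i)) : ℝ≥0) * R.weightedNorm k ρ w ^ 2 := by
    intro i
    set F := S.patch i with hF
    set T := (W.nabla j i).filter far with hT
    have hTl : T ⊆ W.level j := fun ξ hξ => Finset.mem_biUnion.2
      ⟨i, Finset.mem_univ i, (Finset.mem_filter.1 hξ).1⟩
    set G : E2 → ℝ≥0∞ := fun y => ∑ l ∈ Finset.Icc 1 k, weightedSq S i (k - ρ) l (w ∘ F.frame) y
      with hG
    set P : W.Grid → Set E2 := fun ξ => {y | dist (W.point ξ) (F.frame y) ≤ b * (2 ^ j)⁻¹} with hP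
    have hPm : ∀ ξ, MeasurableSet (P ξ) := fun ξ =>
      (isClosed_le (continuous_const.dist F.frame.continuous) continuous_const).measurableSet
    have hGm : AEMeasurable G (volume.restrict F.dom) := by
      have := Finset.aemeasurable_sum (Finset.Icc 1 k) fun l _ =>
        aemeasurable_weightedSq (i := i) (μ := k - ρ) (l := l) ((hw.2 i).mono subset_closure)
      rw [hG, ← Finset.sum_fn]
      exact this
    calc ∑ ξ ∈ T, f ξ ≤ ∑ ξ ∈ T, C * ∫⁻ y in F.dom ∩ P ξ, G y :=
          Finset.sum_le_sum fun ξ hξ => hC w hw j hj i ξ (Finset.mem_filter.1 hξ).1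
            (Finset.mem_filter.1 hξ).2
      _ = C * ∑ ξ ∈ T, ∫⁻ y in F.dom, (P ξ).indicator G y := by
          rw [Finset.mul_sum]
          refine Finset.sum_congr rfl fun ξ _ => ?_
          rw [setLIntegral_indicator (hPm ξ), inter_comm]
      _ = C * ∫⁻ y in F.dom, ∑ ξ ∈ T, (P ξ).indicator G y := by
          rw [lintegral_finsetSum' _ fun ξ _ => hGm.indicator (hPm ξ)]
      _ ≤ C * ∫⁻ y in F.dom, N.toNNReal * G y := by
          gcongr with y
          -- Only boundedly many grid points of the level are within `b 2^{-j}` of a given point, so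
          -- the local integrals add up to one integral over the patch.
          have h1 : ∑ ξ ∈ T, (P ξ).indicator G y = ((T.filter fun ξ => y ∈ P ξ).card : ℝ≥0∞) * G y := by
            simp only [indicator_apply]
            rw [← Finset.sum_filter, Finset.sum_const, nsmul_eq_mul]
          rw [h1]
          gcongr
          have h2 := hN j hj (F.frame y) (T.filter fun ξ => y ∈ P ξ)
            ((Finset.filter_subset _ _).trans hTl) fun ξ hξ => (Finset.mem_filter.1 hξ).2
          have h3 : ((T.filter fun ξ => y ∈ P ξ).card : ℝ≥0) ≤ N.toNNReal := by
            rw [← NNReal.coe_le_coe, Real.coe_toNNReal _ hN0.le]; exact_mod_cast h2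
          exact_mod_cast h3
      _ = C * (N.toNNReal * ∑ l ∈ Finset.Icc 1 k,
            ∫⁻ y in F.dom, weightedSq S i (k - ρ) l (w ∘ F.frame) y) := by
          rw [lintegral_const_mul' _ _ ENNReal.coe_ne_top, lintegral_finsetSum' _ fun l _ =>
            aemeasurable_weightedSq ((hw.2 i).mono subset_closure)]
      _ ≤ C * (N.toNNReal * ∑ l ∈ Finset.Icc 1 k, Cx i * R.weightedNorm k ρ w ^ 2) := by
          gcongr with l hl
          exact hCx i w hw l (Finset.mem_Icc.1 hl).1 (Finset.mem_Icc.1 hl).2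
      _ = _ := by
          rw [Finset.sum_const, Nat.card_Icc, Nat.add_sub_cancel, nsmul_eq_mul]
          push_cast; ring
  calc ∑ ξ ∈ (W.level j).filter far, f ξ
      = ∑ ξ ∈ Finset.univ.biUnion fun i => (W.nabla j i).filter far, f ξ := by
        rw [level, Finset.filter_biUnion]
    _ ≤ ∑ i, ∑ ξ ∈ (W.nabla j i).filter far, f ξ := ENNReal.sum_biUnion_le _ _ _
    _ ≤ ∑ i, (C * (N.toNNReal * (k * Cx i)) : ℝ≥0) * R.weightedNorm k ρ w ^ 2 :=
        Finset.sum_le_sum fun i _ => hi i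
    _ = _ := by rw [← Finset.sum_mul, ENNReal.ofNNReal_finsetSum]

theorem tendsto_coeff (hm : 1 ≤ m) {u : E3 → ℂ} {w : ℕ → E3 → ℂ} (hu : MemLp u 2 S.area)
    (hw : ∀ n, MemLp (w n) 2 S.area)
    (h : Tendsto (fun n => eLpNorm (w n - u) 2 S.area) atTop (𝓝 0)) {j : ℕ} (hj : W.jstar ≤ j)
    {ξ : W.Grid} (hξ : ξ ∈ W.level j) :
    Tendsto (fun n => W.coeff (w n) j ξ) atTop (𝓝 (W.coeff u j ξ)) := by
  obtain ⟨C, -, hC⟩ := S.exists_enorm_pairing_le hm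
  have hψ := hW.memLp_psiDual hj hξ
  rw [tendsto_iff_edist_tendsto_0]
  have h0 : Tendsto (fun n => C * eLpNorm (w n - u) 2 S.area * eLpNorm (W.psiDual j ξ) 2 S.area)
      atTop (𝓝 0) := by
    have := ENNReal.Tendsto.mul_const (ENNReal.Tendsto.const_mul h
      (Or.inr (ENNReal.coe_ne_top (r := C)))) (Or.inr hψ.2.ne)
    simpa using this
  refine tendsto_of_tendsto_of_tendsto_of_le_of_le tendsto_const_nhds h0 (fun _ => zero_le)
    fun n => ?_
  simp only [edist_eq_enorm_sub]
  rw [coeff, coeff, ← pairing_sub hm (hw n) hu hψ]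
  exact hC _ _ ((hw n).sub hu) hψ

open Classical in
-- Splitting `w n = (w n - w N) + w N` bounds the sums uniformly in `n` and `j` by the Cauchy
-- property. Each is a finite sum of coefficients that converge in `n`, so the bound survives the
-- limit.
theorem exists_interior_sum_le_of_mem_weightedSobolev {R : S.SpecialResolution} {k : ℕ}
    (hk : 1 ≤ k) (hkm : k ≤ m) (hkd : k ≤ d) {ρ : ℝ} (hρ : 0 < ρ) (hρk : ρ < k) {u : E3 → ℂ}
    (hu : u ∈ R.weightedSobolev k ρ) :
    ∃ B : ℝ, ∃ M : ℝ≥0, 0 < B ∧ ∀ j ≥ W.jstar,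
      ∑ ξ ∈ (W.level j).filter fun ξ => B * (2 ^ j)⁻¹ < S.distInterface (W.point ξ),
        (ENNReal.ofReal (S.distInterface (W.point ξ) ^ (k - ρ) * 2 ^ (j * k)) *
          ‖W.coeff u j ξ‖ₑ) ^ 2 ≤ M := by
  have hm : 1 ≤ m := hk.trans hkm
  obtain ⟨B, C, hB, hC⟩ := hW.exists_interior_sum_le R hk hkm hkd hρ hρk
  obtain ⟨huL, w, hw, hcauchy, hlim⟩ := hu
  obtain ⟨N, hN⟩ := hcauchy 1 one_pos
  set q := R.weightedNorm k ρ (w N) with hq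
  have hqt : q ≠ ⊤ := (hw N).2.ne
  refine ⟨B, 2 * C * (1 + q.toNNReal ^ 2), hB, fun j hj => ?_⟩
  set T := (W.level j).filter fun ξ => B * (2 ^ j)⁻¹ < S.distInterface (W.point ξ) with hT
  set a : W.Grid → ℝ := fun ξ => S.distInterface (W.point ξ) ^ (k - ρ) * 2 ^ (j * k) with ha
  have hwL : ∀ n, MemLp (w n) 2 S.area := fun n => (hw n).1.memLp
  have hTl : ∀ ξ ∈ T, ξ ∈ W.level j := fun ξ hξ => (Finset.mem_filter.1 hξ).1
  have ht : Tendsto (fun n => ∑ ξ ∈ T, (ENNReal.ofReal (a ξ) * ‖W.coeff (w n) j ξ‖ₑ) ^ 2) atTop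
      (𝓝 (∑ ξ ∈ T, (ENNReal.ofReal (a ξ) * ‖W.coeff u j ξ‖ₑ) ^ 2)) := by
    refine tendsto_finsetSum _ fun ξ hξ => ENNReal.Tendsto.pow (ENNReal.Tendsto.const_mul ?_
      (Or.inr ENNReal.ofReal_ne_top))
    exact (hW.tendsto_coeff hm huL hwL hlim hj (hTl ξ hξ)).enorm
  refine le_of_tendsto ht (eventually_atTop.2 ⟨N, fun n hn => ?_⟩)
  have h1 := hC _ ((hw n).1.sub (hw N).1) j hj
  have h2 := hC _ (hw N).1 j hj
  have h3 : R.weightedNorm k ρ (w n - w N) ^ 2 ≤ 1 :=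
    pow_le_one₀ zero_le (by simpa using (hN n hn N le_rfl).le)
  calc ∑ ξ ∈ T, (ENNReal.ofReal (a ξ) * ‖W.coeff (w n) j ξ‖ₑ) ^ 2
      ≤ ∑ ξ ∈ T, 2 * ((ENNReal.ofReal (a ξ) * ‖W.coeff (w n - w N) j ξ‖ₑ) ^ 2 +
          (ENNReal.ofReal (a ξ) * ‖W.coeff (w N) j ξ‖ₑ) ^ 2) := by
        refine Finset.sum_le_sum fun ξ hξ => ?_
        have h4 : ‖W.coeff (w n) j ξ‖ₑ ≤
            ‖W.coeff (w n - w N) j ξ‖ₑ + ‖W.coeff (w N) j ξ‖ₑ := by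
          have : W.coeff (w n) j ξ = W.coeff (w n - w N) j ξ + W.coeff (w N) j ξ := by
            rw [coeff, coeff, coeff, pairing_sub hm (hwL n) (hwL N)
              (hW.memLp_psiDual hj (hTl ξ hξ)), sub_add_cancel]
          rw [this]
          exact enorm_add_le _ _
        calc _ ≤ (ENNReal.ofReal (a ξ) * ‖W.coeff (w n - w N) j ξ‖ₑ +
              ENNReal.ofReal (a ξ) * ‖W.coeff (w N) j ξ‖ₑ) ^ 2 := by
              rw [← mul_add]; gcongr
          _ ≤ _ := by
              have := ENNReal.rpow_add_le_mul_rpow_add_rpow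
                (ENNReal.ofReal (a ξ) * ‖W.coeff (w n - w N) j ξ‖ₑ)
                (ENNReal.ofReal (a ξ) * ‖W.coeff (w N) j ξ‖ₑ) (p := 2) (by norm_num)
              norm_num at this
              exact this
    _ ≤ 2 * (C * 1 + C * q ^ 2) := by
        rw [← Finset.mul_sum, Finset.sum_add_distrib]
        gcongr
        exact h1.trans (mul_le_mul' le_rfl h3)
    _ = _ := by
        push_cast
        rw [ENNReal.coe_toNNReal hqt]
        ring

end PolySurface.WaveletSystem.IsWaveletBasis

/-! ### Hölder's inequality and summation over levels -/

theorem ENNReal.tsum_rpow_mul_rpow_le {ι : Type*} (f g : ι → ℝ≥0∞) {a b : ℝ} (ha : 0 ≤ a)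
    (hb : 0 ≤ b) (hab : a + b = 1) :
    ∑' i, f i ^ a * g i ^ b ≤ (∑' i, f i) ^ a * (∑' i, g i) ^ b := by
  let _ : MeasurableSpace ι := ⊤
  have h := ENNReal.lintegral_mul_norm_pow_le (μ := Measure.count) (f := f) (g := g)
    measurable_from_top.aemeasurable measurable_from_top.aemeasurable ha hb hab
  simpa only [lintegral_count] using h

theorem ENNReal.sum_rpow_mul_rpow_le {ι : Type*} (s : Finset ι) (f g : ι → ℝ≥0∞) {a b : ℝ}
    (ha : 0 ≤ a) (hb : 0 ≤ b) (hab : a + b = 1) :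
    ∑ i ∈ s, f i ^ a * g i ^ b ≤ (∑ i ∈ s, f i) ^ a * (∑ i ∈ s, g i) ^ b := by
  have h := ENNReal.tsum_rpow_mul_rpow_le (fun i : s => f i) (fun i : s => g i) ha hb hab
  rwa [Finset.tsum_subtype s fun i => f i ^ a * g i ^ b, Finset.tsum_subtype s f,
    Finset.tsum_subtype s g] at h

theorem ENNReal.tsum_rpow_lt_top_of_le {ι : Type*} {x : ι → ℝ≥0∞} {p τ : ℝ} (hp : 0 < p)
    (hpτ : p ≤ τ) (h : ∑' i, x i ^ p < ⊤) : ∑' i, x i ^ τ < ⊤ := by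
  set K := ∑' i, x i ^ p with hK
  have hx : ∀ i, x i ≤ K ^ (1 / p) := fun i => by
    rw [one_div, ENNReal.le_rpow_inv_iff hp]
    exact ENNReal.le_tsum i
  calc ∑' i, x i ^ τ ≤ ∑' i, (K ^ (1 / p)) ^ (τ - p) * x i ^ p := by
        refine ENNReal.tsum_le_tsum fun i => ?_
        have : x i ^ τ = x i ^ (τ - p) * x i ^ p := by
          rw [← ENNReal.rpow_add_of_nonneg _ _ (by linarith) hp.le, sub_add_cancel]
        rw [this]
        gcongr
        exact hx i
    _ = (K ^ (1 / p)) ^ (τ - p) * K := ENNReal.tsum_mul_left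
    _ < ⊤ := ENNReal.mul_lt_top (ENNReal.rpow_lt_top_of_nonneg (by linarith)
        (ENNReal.rpow_lt_top_of_nonneg (by positivity) h.ne).ne) h

theorem tsum_ofReal_two_rpow_neg_lt_top {C δ : ℝ} (hδ : 0 < δ) (n : ℕ) :
    ∑' j : Ici n, ENNReal.ofReal (C * 2 ^ (-δ * (j : ℕ))) < ⊤ := by
  have h1 : Summable fun j : ℕ => C * (2 : ℝ) ^ (-δ * (j : ℕ)) := by
    refine Summable.mul_left C ?_
    simp_rw [Real.rpow_mul_natCast zero_le_two]
    exact summable_geometric_of_lt_one (by positivity)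
      (Real.rpow_lt_one_of_one_lt_of_neg one_lt_two (by linarith))
  exact (ENNReal.tsum_comp_le_tsum_of_injective Subtype.val_injective
    fun j : ℕ => ENNReal.ofReal (C * 2 ^ (-δ * (j : ℕ)))).trans_lt h1.tsum_ofReal_lt_top

/-- Hölder's inequality for a finite sum with few summands. -/
theorem sum_rpow_le_of_card_le {ι : Type*} (T : Finset ι) (x : ι → ℝ≥0∞) {p τ : ℝ} (hτ : 0 < τ)
    (hτp : τ < p) {C A σ : ℝ} (hC : 0 ≤ C) (hA : 0 ≤ A) {j : ℕ} (hcard : (T.card : ℝ) ≤ C * 2 ^ j)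
    (h : ∑ i ∈ T, x i ^ p ≤ ENNReal.ofReal (A * 2 ^ (-((j : ℝ) * σ * p)))) :
    ∑ i ∈ T, x i ^ τ ≤ ENNReal.ofReal (C ^ (1 - τ / p) * A ^ (τ / p) *
      2 ^ (-(σ * τ - (1 - τ / p)) * (j : ℕ))) := by
  have hp : 0 < p := hτ.trans hτp
  have h1 : 0 ≤ 1 - τ / p := by rw [sub_nonneg, div_le_one hp]; exact hτp.le
  have h2 : 0 ≤ τ / p := by positivity
  calc ∑ i ∈ T, x i ^ τ = ∑ i ∈ T, (x i ^ p) ^ (τ / p) * 1 ^ (1 - τ / p) := by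
        refine Finset.sum_congr rfl fun i _ => ?_
        rw [ENNReal.one_rpow, mul_one, ← ENNReal.rpow_mul, mul_div_cancel₀ _ hp.ne']
    _ ≤ (∑ i ∈ T, x i ^ p) ^ (τ / p) * (∑ _i ∈ T, 1) ^ (1 - τ / p) :=
        ENNReal.sum_rpow_mul_rpow_le T _ _ h2 h1 (by ring)
    _ ≤ ENNReal.ofReal (A * 2 ^ (-((j : ℝ) * σ * p))) ^ (τ / p) *
        ENNReal.ofReal (C * 2 ^ j) ^ (1 - τ / p) := by
        gcongr
        rw [Finset.sum_const, nsmul_eq_mul, mul_one, ← ENNReal.ofReal_natCast]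
        exact ENNReal.ofReal_le_ofReal hcard
    _ = _ := by
        rw [ENNReal.ofReal_rpow_of_nonneg (by positivity) h2,
          ENNReal.ofReal_rpow_of_nonneg (by positivity) h1, ← ENNReal.ofReal_mul (by positivity)]
        congr 1
        rw [Real.mul_rpow hA (by positivity), Real.mul_rpow hC (by positivity),
          ← Real.rpow_natCast 2 j, ← Real.rpow_mul zero_le_two, ← Real.rpow_mul zero_le_two]
        have h3 : (2 : ℝ) ^ (-(σ * τ - (1 - τ / p)) * (j : ℕ)) =
            2 ^ (-((j : ℝ) * σ * p) * (τ / p)) * 2 ^ ((j : ℝ) * (1 - τ / p)) := by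
          rw [← Real.rpow_add two_pos]
          congr 1
          field_simp
          ring
        rw [h3]; ring

/-- Hölder's inequality with weights. -/
theorem sum_rpow_le_of_weighted {ι : Type*} (T : Finset ι) (x : ι → ℝ≥0∞) (w : ι → ℝ)
    (hw : ∀ i ∈ T, 0 < w i) {τ α μ : ℝ} {k : ℕ} (hα : 0 < α) (hτ : 1 / τ = α / 2 + 1 / 2)
    {M C : ℝ} (hM : 0 ≤ M) (hC : 0 ≤ C) {j : ℕ}
    (h : ∑ i ∈ T, (ENNReal.ofReal (w i ^ μ * 2 ^ (j * k)) * x i) ^ 2 ≤ ENNReal.ofReal M)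
    (hsum : ∑ i ∈ T, ENNReal.ofReal (w i ^ (-(2 * μ / α))) ≤
      ENNReal.ofReal (C * 2 ^ ((j : ℝ) * (1 + 2 * μ / α)))) :
    ∑ i ∈ T, x i ^ τ ≤ ENNReal.ofReal (M ^ (τ / 2) * C ^ (1 - τ / 2) *
      2 ^ (-(τ * (k - μ - α / 2)) * (j : ℕ))) := by
  have hτ0 : 0 < τ := by
    rw [← one_div_pos, hτ]; positivity
  -- Thus `(a ^ (-2/α)) ^ (1 - τ/2) = a ^ (-τ)`, which dictates the exponent `2 μ / α` of the dual
  -- sum.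
  have hτα : 1 - τ / 2 = α * τ / 2 := by
    field_simp at hτ; linarith
  have h1 : 0 ≤ 1 - τ / 2 := by rw [hτα]; positivity
  have h2 : 0 ≤ τ / 2 := by positivity
  set a : ι → ℝ := fun i => w i ^ μ * 2 ^ (j * k) with ha
  have ha0 : ∀ i ∈ T, 0 < a i := fun i hi => mul_pos (Real.rpow_pos_of_pos (hw i hi) _) (by positivity)
  calc ∑ i ∈ T, x i ^ τ = ∑ i ∈ T, ((ENNReal.ofReal (a i) * x i) ^ 2) ^ (τ / 2) *
        ENNReal.ofReal (a i ^ (-(2 / α))) ^ (1 - τ / 2) := by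
        refine Finset.sum_congr rfl fun i hi => ?_
        rw [← ENNReal.rpow_natCast, ← ENNReal.rpow_mul,
          ENNReal.ofReal_rpow_of_nonneg (Real.rpow_nonneg (ha0 i hi).le _) h1,
          ← Real.rpow_mul (ha0 i hi).le, hτα]
        have h4 : -(2 / α) * (α * τ / 2) = -τ := by field_simp
        have h5 : ((2 : ℕ) : ℝ) * (τ / 2) = τ := by push_cast; ring
        rw [h4, h5, ENNReal.mul_rpow_of_nonneg _ _ hτ0.le,
          ENNReal.ofReal_rpow_of_nonneg (ha0 i hi).le hτ0.le, mul_right_comm,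
          ← ENNReal.ofReal_mul (Real.rpow_nonneg (ha0 i hi).le _), ← Real.rpow_add (ha0 i hi)]
        simp
    _ ≤ (∑ i ∈ T, (ENNReal.ofReal (a i) * x i) ^ 2) ^ (τ / 2) *
        (∑ i ∈ T, ENNReal.ofReal (a i ^ (-(2 / α)))) ^ (1 - τ / 2) :=
        ENNReal.sum_rpow_mul_rpow_le T _ _ h2 h1 (by ring)
    _ ≤ ENNReal.ofReal M ^ (τ / 2) * ENNReal.ofReal (C * 2 ^ ((j : ℝ) * (1 + 2 * μ / α)) *
          2 ^ (-((j : ℝ) * k * (2 / α)))) ^ (1 - τ / 2) := by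
        gcongr
        rw [ENNReal.ofReal_mul (by positivity)]
        refine le_trans (le_of_eq ?_) (mul_le_mul' hsum le_rfl)
        rw [Finset.sum_mul]
        refine Finset.sum_congr rfl fun i hi => ?_
        rw [← ENNReal.ofReal_mul (Real.rpow_nonneg (hw i hi).le _), ha]
        congr 1
        rw [Real.mul_rpow (Real.rpow_nonneg (hw i hi).le _) (by positivity),
          ← Real.rpow_mul (hw i hi).le, ← Real.rpow_natCast 2, ← Real.rpow_mul zero_le_two]
        congr 2
        · ring
        · push_cast; ring
    _ = _ := by
        rw [ENNReal.ofReal_rpow_of_nonneg hM h2, ENNReal.ofReal_rpow_of_nonneg (by positivity) h1,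
          ← ENNReal.ofReal_mul (by positivity)]
        congr 1
        rw [mul_assoc C, Real.mul_rpow hC (by positivity), ← Real.rpow_add two_pos,
          ← Real.rpow_mul zero_le_two, ← mul_assoc]
        congr 2
        rw [hτα]
        field_simp
        ring

open Classical in
/-- Sums of negative powers of quantities whose distribution is controlled. -/
theorem exists_sum_rpow_neg_le {B C β : ℝ} (hB : 0 < B) (hC : 0 < C) (hβ : 1 < β) :
    ∃ K : ℝ, 0 ≤ K ∧ ∀ {ι : Type*} (T : Finset ι) (w : ι → ℝ) (j : ℕ),
      (∀ i ∈ T, B * (2 ^ j)⁻¹ < w i) →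
      (∀ t : ℝ, 0 < t → ((T.filter fun i => w i ≤ t).card : ℝ) ≤
        C * 2 ^ (2 * j) * (t + (2 ^ j)⁻¹)) →
      ∑ i ∈ T, ENNReal.ofReal (w i ^ (-β)) ≤ ENNReal.ofReal (K * 2 ^ ((j : ℝ) * (1 + β))) := by
  set q : ℝ := 2 ^ (1 - β) with hq
  have hq0 : 0 < q := by positivity
  have hq1 : q < 1 := Real.rpow_lt_one_of_one_lt_of_neg one_lt_two (by linarith)
  refine ⟨B ^ (-β) * (C * (2 * B + 1)) * ∑' n : ℕ, q ^ n, by positivity,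
    fun {ι} T w j hT hcard => ?_⟩
  set ε : ℝ := (2 ^ j)⁻¹ with hε
  have hε0 : 0 < ε := by positivity
  have hBε : 0 < B * ε := by positivity
  set f : ℕ → ℝ := fun n => (B * ε * 2 ^ n) ^ (-β) with hf
  have hf0 : ∀ n, 0 ≤ f n := fun n => by positivity
  -- Dyadic layers: `w i` lies between `B ε 2^n` and `B ε 2^(n+1)` for some `n`, and the
  -- corresponding term alone dominates.
  have hpt : ∀ i ∈ T, ENNReal.ofReal (w i ^ (-β)) ≤
      ∑' n : ℕ, if w i ≤ B * ε * 2 ^ (n + 1) then ENNReal.ofReal (f n) else 0 := by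
    intro i hi
    have h1 : 1 ≤ w i / (B * ε) := by rw [le_div_iff₀ hBε]; linarith [hT i hi]
    obtain ⟨n, hn1, hn2⟩ := exists_nat_pow_near h1 (one_lt_two (α := ℝ))
    rw [le_div_iff₀ hBε] at hn1
    rw [div_lt_iff₀ hBε] at hn2
    refine le_trans ?_ (ENNReal.le_tsum n)
    rw [if_pos (by linarith)]
    refine ENNReal.ofReal_le_ofReal ?_
    exact Real.rpow_le_rpow_of_nonpos (by positivity) (by linarith) (by linarith)
  -- In layer `n` the count grows like `2^n` and the value decays like `2^(-βn)`; the ratio `q =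
  -- 2^(1-β)` is below one because `β > 1`.
  have hpow : ∀ n : ℕ, C * 2 ^ (2 * j) * (B * ε * 2 ^ (n + 1) + ε) * f n ≤
      B ^ (-β) * (C * (2 * B + 1)) * 2 ^ ((j : ℝ) * (1 + β)) * q ^ n := by
    intro n
    have h1 : f n = B ^ (-β) * 2 ^ ((j : ℝ) * β) * 2 ^ (-β * n) := by
      rw [hf]
      simp only
      rw [Real.mul_rpow hBε.le (by positivity), Real.mul_rpow hB.le hε0.le, hε,
        ← Real.rpow_natCast 2 j, ← Real.rpow_natCast 2 n, ← Real.rpow_neg zero_le_two,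
        ← Real.rpow_mul zero_le_two, ← Real.rpow_mul zero_le_two]
      congr 2 <;> ring_nf
    have h2 : (2 : ℝ) ^ (2 * j) * (B * ε * 2 ^ (n + 1) + ε) ≤ 2 ^ j * ((2 * B + 1) * 2 ^ n) := by
      have h3 : (2 : ℝ) ^ (2 * j) * ε = 2 ^ j := by
        rw [hε, two_mul, pow_add]; field_simp
      have h4 : (1 : ℝ) ≤ 2 ^ n := one_le_pow₀ one_le_two
      calc (2 : ℝ) ^ (2 * j) * (B * ε * 2 ^ (n + 1) + ε) =
            (2 ^ (2 * j) * ε) * (2 * B * 2 ^ n + 1) := by rw [pow_succ]; ring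
        _ ≤ _ := by rw [h3]; gcongr; linarith
    have h5 : q ^ n = 2 ^ n * 2 ^ (-β * n) := by
      rw [hq, ← Real.rpow_mul_natCast zero_le_two, ← Real.rpow_natCast 2 n, ← Real.rpow_add two_pos]
      ring_nf
    have h6 : (2 : ℝ) ^ ((j : ℝ) * (1 + β)) = 2 ^ j * 2 ^ ((j : ℝ) * β) := by
      rw [← Real.rpow_natCast 2 j, ← Real.rpow_add two_pos]; ring_nf
    calc C * 2 ^ (2 * j) * (B * ε * 2 ^ (n + 1) + ε) * f n
        = C * (2 ^ (2 * j) * (B * ε * 2 ^ (n + 1) + ε)) * f n := by ring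
      _ ≤ C * (2 ^ j * ((2 * B + 1) * 2 ^ n)) * f n := by
          have := hf0 n
          gcongr
      _ = _ := by rw [h1, h5, h6]; ring
  calc ∑ i ∈ T, ENNReal.ofReal (w i ^ (-β))
      ≤ ∑ i ∈ T, ∑' n : ℕ, if w i ≤ B * ε * 2 ^ (n + 1) then ENNReal.ofReal (f n) else 0 :=
        Finset.sum_le_sum hpt
    _ = ∑' n : ℕ, ∑ i ∈ T, if w i ≤ B * ε * 2 ^ (n + 1) then ENNReal.ofReal (f n) else 0 :=
        (Summable.tsum_finsetSum fun _ _ => ENNReal.summable).symm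
    _ ≤ ∑' n : ℕ, ENNReal.ofReal (B ^ (-β) * (C * (2 * B + 1)) * 2 ^ ((j : ℝ) * (1 + β)) * q ^ n) := by
        refine ENNReal.tsum_le_tsum fun n => ?_
        rw [← Finset.sum_filter, Finset.sum_const, nsmul_eq_mul, ← ENNReal.ofReal_natCast,
          ← ENNReal.ofReal_mul (by positivity)]
        refine ENNReal.ofReal_le_ofReal (le_trans ?_ (hpow n))
        have := hf0 n
        gcongr
        exact hcard _ (by positivity)
    _ = _ := by
        rw [← ENNReal.ofReal_tsum_of_nonneg (fun n => by positivity)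
          ((summable_geometric_of_lt_one hq0.le hq1).mul_left _), tsum_mul_left]
        congr 1
        ring

/-! ### Regularity in the Besov-type scale -/

namespace PolySurface.WaveletSystem

variable {m : ℕ} {S : PolySurface m} {W : S.WaveletSystem}

/-- The sum of the weighted coefficients that is finite for functions in a Besov-type space. -/
theorem tsum_weighted_coeff_lt_top {s p : ℝ} (hp : 0 < p) {u : E3 → ℂ}
    (hu : u ∈ W.besov s p (ENNReal.ofReal p)) :
    ∑' j : Ici W.jstar, (2 : ℝ≥0∞) ^ ((j : ℕ) * (s + 2 * (1 / 2 - 1 / p)) * p) *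
      ∑ ξ ∈ W.level j, ‖W.coeff u j ξ‖ₑ ^ p < ⊤ := by
  have h := hu.2
  rw [besovNorm, if_neg ENNReal.ofReal_ne_top, ENNReal.toReal_ofReal hp.le, div_self hp.ne'] at h
  have h2 := (ENNReal.add_lt_top.1 h).2
  rw [ENNReal.rpow_lt_top_iff_of_pos (by positivity)] at h2
  simpa only [ENNReal.rpow_one] using h2

theorem level_sum_le {s p : ℝ} {u : E3 → ℂ} {K : ℝ≥0}
    (hK : ∑' j : Ici W.jstar, (2 : ℝ≥0∞) ^ ((j : ℕ) * (s + 2 * (1 / 2 - 1 / p)) * p) *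
      ∑ ξ ∈ W.level j, ‖W.coeff u j ξ‖ₑ ^ p ≤ K) {j : ℕ} (hj : W.jstar ≤ j) :
    ∑ ξ ∈ W.level j, ‖W.coeff u j ξ‖ₑ ^ p ≤
      ENNReal.ofReal (K * 2 ^ (-((j : ℝ) * (s + 2 * (1 / 2 - 1 / p)) * p))) := by
  set e := (j : ℝ) * (s + 2 * (1 / 2 - 1 / p)) * p with he
  have h1 := (ENNReal.le_tsum (⟨j, hj⟩ : Ici W.jstar)).trans hK
  have h2 : (2 : ℝ≥0∞) ^ (-e) * 2 ^ e = 1 := by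
    rw [← ENNReal.rpow_add _ _ (by norm_num) (by norm_num), neg_add_cancel, ENNReal.rpow_zero]
  have h3 : ENNReal.ofReal ((2 : ℝ) ^ (-e)) = (2 : ℝ≥0∞) ^ (-e) := by
    rw [← ENNReal.ofReal_rpow_of_pos two_pos]; simp
  rw [mul_comm (K : ℝ), ENNReal.ofReal_mul (by positivity), h3, ENNReal.ofReal_coe_nnreal]
  calc ∑ ξ ∈ W.level j, ‖W.coeff u j ξ‖ₑ ^ p
      = 2 ^ (-e) * (2 ^ e * ∑ ξ ∈ W.level j, ‖W.coeff u j ξ‖ₑ ^ p) := by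
        rw [← mul_assoc, h2, one_mul]
    _ ≤ _ := by gcongr

namespace IsWaveletBasis

variable {d : ℕ} {sΓ : ℝ} (hW : W.IsWaveletBasis d sΓ)
include hW

/-- Wavelet coefficients of functions in a weighted Sobolev space are in `ℓ_τ` for
`1 / τ = α / 2 + 1 / 2`. -/
theorem tsum_coeff_lt_top_of_lt {R : S.SpecialResolution} {k : ℕ}
    (hk : 1 ≤ k) (hkm : k ≤ m) (hkd : k ≤ d) {ρ : ℝ} (hρ : 0 < ρ) (hρk : ρ < k) {s p : ℝ}
    {u : E3 → ℂ} (huB : u ∈ W.besov s p (ENNReal.ofReal p)) (huX : u ∈ R.weightedSobolev k ρ)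
    {α τ : ℝ} (hα : 0 < α) (hτ : 1 / τ = α / 2 + 1 / 2) (hτp : τ < p)
    (hαρ : α < 2 * ρ) (hαk : α < 2 * (k - ρ)) (hαs : α < 2 * (s - (1 / p - 1 / 2))) :
    ∑' j : Ici W.jstar, ∑ ξ ∈ W.level j, ‖W.coeff u j ξ‖ₑ ^ τ < ⊤ := by
  classical
  have hτ0 : 0 < τ := by rw [← one_div_pos, hτ]; positivity
  have hp : 0 < p := hτ0.trans hτp
  obtain ⟨K, hK⟩ : ∃ K : ℝ≥0, (K : ℝ≥0∞) = _ :=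
    ⟨_, ENNReal.coe_toNNReal (tsum_weighted_coeff_lt_top hp huB).ne⟩
  obtain ⟨B, M, hB, hM⟩ :=
    hW.exists_interior_sum_le_of_mem_weightedSobolev hk hkm hkd hρ hρk huX
  obtain ⟨Cn, hCn0, hCn⟩ := hW.exists_card_distInterface_le
  set μ : ℝ := k - ρ with hμ
  -- The bound `α < 2(k-ρ)` enters here: it makes the layers around the interfaces summable.
  have hβ : 1 < 2 * μ / α := by rw [one_lt_div hα]; exact hαk
  obtain ⟨Q, hQ0, hQ⟩ := exists_sum_rpow_neg_le hB hCn0 hβ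
  set σ : ℝ := s + 2 * (1 / 2 - 1 / p) with hσ
  set δ₁ : ℝ := σ * τ - (1 - τ / p) with hδ₁
  set δ₂ : ℝ := τ * (k - μ - α / 2) with hδ₂
  -- `δ₁ = τ (s - (1/p - 1/2) - α/2)`, the decay rate of the coefficients near the interfaces.
  have hδ₁0 : 0 < δ₁ := by
    have : δ₁ = τ * (σ + 1 / p - 1 / τ) := by rw [hδ₁]; field_simp; ring
    rw [this, hσ, hτ]
    refine mul_pos hτ0 ?_
    have : s + 2 * (1 / 2 - 1 / p) + 1 / p - (α / 2 + 1 / 2) = s - (1 / p - 1 / 2) - α / 2 := by ring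
    rw [this]; linarith
  -- Since `k - μ = ρ`, the decay rate away from the interfaces is `τ (ρ - α/2)`.
  have hδ₂0 : 0 < δ₂ := mul_pos hτ0 (by rw [hμ]; linarith)
  set far : ℕ → W.Grid → Prop := fun j ξ => B * (2 ^ j)⁻¹ < S.distInterface (W.point ξ) with hfar
  set C₁ : ℝ := (Cn * (B + 1)) ^ (1 - τ / p) * (K : ℝ) ^ (τ / p) with hC₁
  set C₂ : ℝ := (M : ℝ) ^ (τ / 2) * Q ^ (1 - τ / 2) with hC₂
  have hlevel : ∀ j : Ici W.jstar, ∑ ξ ∈ W.level j, ‖W.coeff u j ξ‖ₑ ^ τ ≤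
      ENNReal.ofReal (C₂ * 2 ^ (-δ₂ * (j : ℕ))) + ENNReal.ofReal (C₁ * 2 ^ (-δ₁ * (j : ℕ))) := by
    rintro ⟨j, hj⟩
    rw [← Finset.sum_filter_add_sum_filter_not (W.level j) (far j)]
    refine add_le_add ?_ ?_
    · refine sum_rpow_le_of_weighted _ _ (fun ξ => S.distInterface (W.point ξ)) (fun ξ hξ => ?_)
        hα hτ (NNReal.coe_nonneg M) hQ0 ?_ ?_
      · exact (by positivity : (0 : ℝ) < B * (2 ^ j)⁻¹).trans (Finset.mem_filter.1 hξ).2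
      · rw [ENNReal.ofReal_coe_nnreal]
        exact hM j hj
      · refine hQ _ _ j (fun ξ hξ => (Finset.mem_filter.1 hξ).2) fun t ht => ?_
        exact hCn j hj t ht _ ((Finset.filter_subset _ _).trans (Finset.filter_subset _ _))
          fun ξ hξ => (Finset.mem_filter.1 hξ).2
    · refine sum_rpow_le_of_card_le _ _ hτ0 hτp (by positivity) K.coe_nonneg ?_ ?_
      · refine (hCn j hj (B * (2 ^ j)⁻¹) (by positivity) _ (Finset.filter_subset _ _)
          fun ξ hξ => not_lt.1 (Finset.mem_filter.1 hξ).2).trans (le_of_eq ?_)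
        rw [two_mul, pow_add]
        field_simp
      · exact (Finset.sum_le_sum_of_subset (Finset.filter_subset _ _)).trans
          (level_sum_le hK.ge hj)
  refine (ENNReal.tsum_le_tsum hlevel).trans_lt ?_
  rw [ENNReal.tsum_add]
  exact ENNReal.add_lt_top.2 ⟨tsum_ofReal_two_rpow_neg_lt_top hδ₂0 _,
    tsum_ofReal_two_rpow_neg_lt_top hδ₁0 _⟩

theorem tsum_coeff_lt_top {R : S.SpecialResolution} {k : ℕ}
    (hk : 1 ≤ k) (hkm : k ≤ m) (hkd : k ≤ d) {ρ : ℝ} (hρ : 0 < ρ) (hρk : ρ < k) {s p : ℝ}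
    (hadm : Admissible s p (ENNReal.ofReal p)) {u : E3 → ℂ}
    (huB : u ∈ W.besov s p (ENNReal.ofReal p)) (huX : u ∈ R.weightedSobolev k ρ)
    {α τ : ℝ} (hα : 0 ≤ α) (hτ : 1 / τ = α / 2 + 1 / 2)
    (hαρ : α < 2 * ρ) (hαk : α < 2 * (k - ρ)) (hαs : α < 2 * (s - (1 / p - 1 / 2))) :
    ∑' j : Ici W.jstar, ∑ ξ ∈ W.level j, ‖W.coeff u j ξ‖ₑ ^ τ < ⊤ := by
  have hτ0 : 0 < τ := by rw [← one_div_pos, hτ]; positivity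
  have hp : 0 < p := by
    rw [← one_div_pos]; linarith [hadm.1]
  rcases lt_or_ge τ p with h | h
  · rcases hα.eq_or_lt with h0 | h0
    -- Here `τ = 2`, which cannot be below `p ≤ 2`.
    · exfalso
      have h1 := one_div_lt_one_div_of_lt hτ0 h
      have := hadm.1
      rw [hτ, ← h0] at h1
      linarith
    · exact hW.tsum_coeff_lt_top_of_lt hk hkm hkd hρ hρk huB huX h0 hτ h hαρ hαk hαs
  · have h1 := tsum_weighted_coeff_lt_top hp huB
    -- By admissibility the level weights are at least one, so the Besov assumption puts the
    -- coefficients into `ℓ_p`, which is contained in `ℓ_τ`.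
    have hσ : 0 ≤ s + 2 * (1 / 2 - 1 / p) := by linarith [hadm.2.1]
    have h2 : ∑' x : Σ j : Ici W.jstar, W.level j, ‖W.coeff u x.1 x.2‖ₑ ^ p < ⊤ := by
      rw [ENNReal.tsum_sigma']
      refine lt_of_le_of_lt (ENNReal.tsum_le_tsum fun j => ?_) h1
      rw [Finset.tsum_subtype (W.level j) fun ξ => ‖W.coeff u j ξ‖ₑ ^ p]
      refine le_mul_of_one_le_left zero_le ?_
      rw [← ENNReal.rpow_zero (x := 2)]
      exact ENNReal.rpow_le_rpow_of_exponent_le one_le_two (by positivity)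
    have h3 := ENNReal.tsum_rpow_lt_top_of_le hp h h2
    rw [ENNReal.tsum_sigma'] at h3
    refine lt_of_eq_of_lt (tsum_congr fun j => ?_) h3
    rw [Finset.tsum_subtype (W.level j) fun ξ => ‖W.coeff u j ξ‖ₑ ^ τ]

theorem eLpNorm_proj_lt_top {τ : ℝ} (hτ : τ ≤ 2) (u : E3 → ℂ) :
    eLpNorm (W.proj u) (ENNReal.ofReal τ) S.area < ⊤ := by
  have h1 : MemLp (W.proj u) 2 S.area := by
    have := memLp_finsetSum (Finset.univ : Finset W.Gen) (μ := S.area) (p := 2)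
      (f := fun g x => S.pairing u (W.genDual g) * W.gen g x)
      fun g _ => (hW.riesz_primal.1 (Sum.inl g)).const_mul _
    exact this
  refine (h1.mono_exponent ?_).2
  rw [← ENNReal.ofReal_ofNat 2]
  exact ENNReal.ofReal_le_ofReal hτ

end IsWaveletBasis

end PolySurface.WaveletSystem

theorem admissible_of_one_div_eq {α τ : ℝ} (hα : 0 ≤ α) (hτ : 1 / τ = α / 2 + 1 / 2) :
    Admissible α τ (ENNReal.ofReal τ) := by
  have hτ0 : 0 < τ := by rw [← one_div_pos, hτ]; positivity
  refine ⟨by linarith, hτ.le, ENNReal.ofReal_pos.2 hτ0, fun _ => ?_⟩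
  rw [← ENNReal.ofReal_ofNat 2]
  refine ENNReal.ofReal_le_ofReal ?_
  rw [← one_div_le_one_div two_pos hτ0]
  linarith

/-! ### Best approximation with finitely many terms -/

/-- Stechkin's estimate of the tail of a sequence in `ℓ_μ`. -/
theorem ENNReal.exists_finset_tsum_sq_le {ι : Type*} [DecidableEq ι] (x : ι → ℝ≥0∞) {μ A : ℝ}
    (hμ : 0 < μ) (hμ2 : μ ≤ 2) (hA : 0 < A) (h : ∑' i, x i ^ μ ≤ ENNReal.ofReal A) {n : ℕ}
    (hn : 1 ≤ n) : ∃ Λ : Finset ι, Λ.card ≤ n ∧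
      ∑' i, (if i ∈ Λ then 0 else x i) ^ 2 ≤ ENNReal.ofReal (A ^ (2 / μ) * n ^ (1 - 2 / μ)) := by
  have hn0 : (0 : ℝ) < n := by exact_mod_cast hn
  have he : 0 ≤ 2 / μ - 1 := by rw [sub_nonneg, one_le_div hμ]; exact hμ2
  -- By Markov's inequality at most `n` indices satisfy `x i ^ μ ≥ A / n`. For the others `x i ^ 2`
  -- is `x i ^ μ` times a power of a quantity below `A / n`.
  obtain ⟨hf, hcard⟩ := ENNReal.finset_card_const_le_le_of_tsum_le ENNReal.ofReal_ne_top h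
    (ε := ENNReal.ofReal (A / n)) (by rw [Ne, ENNReal.ofReal_eq_zero, not_le]; positivity)
  refine ⟨hf.toFinset, ?_, ?_⟩
  · rw [← ENNReal.ofReal_div_of_pos (by positivity), div_div_cancel₀ hA.ne',
      ENNReal.ofReal_natCast] at hcard
    exact_mod_cast hcard
  · calc ∑' i, (if i ∈ hf.toFinset then 0 else x i) ^ 2
        ≤ ∑' i, ENNReal.ofReal (A / n) ^ (2 / μ - 1) * x i ^ μ := by
          refine ENNReal.tsum_le_tsum fun i => ?_
          split_ifs with hi
          · simp
          · rw [hf.mem_toFinset, mem_ofPred_eq, not_le] at hi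
            calc x i ^ 2 = (x i ^ μ) ^ (2 / μ - 1) * x i ^ μ := by
                  rw [← ENNReal.rpow_natCast, ← ENNReal.rpow_mul,
                    ← ENNReal.rpow_add_of_nonneg _ _ (by positivity) hμ.le]
                  congr 1
                  field_simp
                  push_cast; ring
              _ ≤ _ := by gcongr
      _ = ENNReal.ofReal (A / n) ^ (2 / μ - 1) * ∑' i, x i ^ μ := ENNReal.tsum_mul_left
      _ ≤ ENNReal.ofReal (A / n) ^ (2 / μ - 1) * ENNReal.ofReal A := by gcongr
      _ = _ := by
          rw [ENNReal.ofReal_rpow_of_nonneg (by positivity) he, ← ENNReal.ofReal_mul (by positivity)]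
          congr 1
          have h1 : A ^ (2 / μ) = A ^ (2 / μ - 1) * A := by
            rw [← Real.rpow_add_one hA.ne', sub_add_cancel]
          have h2 : (n : ℝ) ^ (1 - 2 / μ) = ((n : ℝ) ^ (2 / μ - 1))⁻¹ := by
            rw [← Real.rpow_neg hn0.le, neg_sub]
          rw [Real.div_rpow hA.le hn0.le, h1, h2]
          ring

/-- The definition uses `n`-tuples, so a smaller selection is padded with arbitrary elements and
zero coefficients. -/
theorem bestNTerm_le_of_card_le {J : Type} [Nonempty J] (dict : J → E3 → ℂ)
    (norm : (E3 → ℂ) → ℝ≥0∞) (f : E3 → ℂ) {n : ℕ} (Λ : Finset J) (hΛ : Λ.card ≤ n) (c : J → ℂ) :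
    bestNTerm dict norm f n ≤ norm (fun x => f x - ∑ a ∈ Λ, c a * dict a x) := by
  obtain ⟨φ⟩ : Nonempty (Λ ↪ Fin n) := Function.Embedding.nonempty_of_card_le (by simpa using hΛ)
  refine (iInf₂_le (Function.extend φ (fun a => (a : J)) fun _ => Classical.arbitrary J)
    (Function.extend φ (fun a => c a) 0)).trans_eq ?_
  congr 1
  funext x
  congr 1
  rw [← Finset.sum_coe_sort Λ]
  refine (Fintype.sum_of_injective φ φ.injective _ _ (fun t ht => ?_) fun a => ?_).symm
  · rw [Function.extend_apply' _ _ _ ht, Pi.zero_apply, zero_mul]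
  · rw [φ.injective.extend_apply, φ.injective.extend_apply]

namespace PolySurface.WaveletSystem

variable {m : ℕ} {S : PolySurface m} {W : S.WaveletSystem}

theorem tsum_level_eq (F : ℕ → W.Grid → ℝ≥0∞) :
    ∑' j : Ici W.jstar, ∑ ξ ∈ W.level j, F j ξ =
      ∑' x : {x : ℕ × W.Grid // W.jstar ≤ x.1 ∧ x.2 ∈ W.level x.1}, F x.1.1 x.1.2 := by
  let e : {x : ℕ × W.Grid // W.jstar ≤ x.1 ∧ x.2 ∈ W.level x.1} ≃
      Σ j : Ici W.jstar, W.level j :=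
    { toFun := fun x => ⟨⟨x.1.1, x.2.1⟩, ⟨x.1.2, x.2.2⟩⟩
      invFun := fun y => ⟨(y.1, y.2), y.1.2, y.2.2⟩
      left_inv := fun _ => rfl
      right_inv := fun _ => rfl }
  rw [← e.symm.tsum_eq, ENNReal.tsum_sigma']
  refine tsum_congr fun j => ?_
  exact (Finset.tsum_subtype (W.level j) fun ξ => F j ξ).symm

namespace IsWaveletBasis

variable {d : ℕ} {sΓ : ℝ} (hW : W.IsWaveletBasis d sΓ)
include hW

theorem nonempty_idx : Nonempty W.Idx := by
  classical
  obtain ⟨c, _, hc, -, h⟩ := hW.card_nabla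
  have h1 := (h W.jstar le_rfl ⟨0, S.I_pos⟩).1
  have h2 : (0 : ℝ) < (W.nabla W.jstar ⟨0, S.I_pos⟩).card := lt_of_lt_of_le (by positivity) h1
  obtain ⟨ξ, hξ⟩ := Finset.card_pos.1 (by exact_mod_cast h2)
  exact ⟨Sum.inr ⟨(W.jstar, ξ), le_rfl, Finset.mem_biUnion.2 ⟨_, Finset.mem_univ _, hξ⟩⟩⟩

/-- The coefficients of the remainder after subtraction of a part of the wavelet expansion. -/
theorem pairing_sub_sum (hm : 1 ≤ m) [DecidableEq W.Idx] {u : E3 → ℂ} (hu : MemLp u 2 S.area)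
    (Λ : Finset W.Idx) (b : W.Idx) :
    S.pairing (fun x => u x - ∑ a ∈ Λ, S.pairing u (W.dual a) * W.primal a x) (W.dual b) =
      if b ∈ Λ then 0 else S.pairing u (W.dual b) := by
  have hp := hW.riesz_primal.1
  have hd := hW.riesz_dual.1 b
  have h1 : MemLp (fun x => ∑ a ∈ Λ, S.pairing u (W.dual a) * W.primal a x) 2 S.area :=
    memLp_finsetSum Λ fun a _ => (hp a).const_mul _
  have h2 := pairing_sub hm hu h1 hd
  rw [pairing_sum hm Λ _ (fun a _ => hp a) hd] at h2
  refine h2.trans ?_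
  split_ifs with hb
  · rw [Finset.sum_eq_single_of_mem b hb, hW.biorthogonal_same, mul_one, sub_self]
    intro a _ hab
    rw [hW.biorthogonal_diff a b hab, mul_zero]
  · rw [Finset.sum_eq_zero, sub_zero]
    intro a ha
    rw [hW.biorthogonal_diff a b (fun h => hb (h ▸ ha)), mul_zero]

/-- The approximant consists of all generators and the wavelets with large weighted coefficients. By
biorthogonality the remainder has zero projection and exactly the discarded coefficients, so its
Sobolev norm is bounded by an `ℓ₂` tail, to which Stechkin's estimate applies. -/
theorem exists_bestNTerm_le (hm : 1 ≤ m) {s' : ℝ} (hs' : 0 ≤ s') (hs'2 : s' < min (3 / 2) sΓ)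
    {u : E3 → ℂ} (hu : MemLp u 2 S.area) {μ : ℝ} (hμ : 0 < μ) (hμ2 : μ ≤ 2)
    (h : ∑' x : {x : ℕ × W.Grid // W.jstar ≤ x.1 ∧ x.2 ∈ W.level x.1},
      ((2 : ℝ≥0∞) ^ (s' * (x.1.1 : ℕ)) * ‖W.coeff u x.1.1 x.1.2‖ₑ) ^ μ < ⊤) :
    ∃ C : ℝ, 0 ≤ C ∧ ∀ n : ℕ, 1 ≤ n →
      bestNTerm W.primal (S.sobolevNorm s') u n ≤ ENNReal.ofReal (C * (n : ℝ) ^ (1 / 2 - 1 / μ)) := by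
  classical
  have := hW.nonempty_idx
  obtain ⟨_, C, -, -, hC⟩ := hW.sobolev_equiv s' (by linarith) hs'2
  set WI := {x : ℕ × W.Grid // W.jstar ≤ x.1 ∧ x.2 ∈ W.level x.1} with hWI
  set D : WI → ℝ≥0∞ := fun x => (2 : ℝ≥0∞) ^ (s' * (x.1.1 : ℕ)) * ‖W.coeff u x.1.1 x.1.2‖ₑ with hD
  have hexp : 1 / 2 - 1 / μ ≤ 0 := sub_nonpos.2 (one_div_le_one_div_of_le hμ hμ2)
  obtain ⟨A, hA0, hA⟩ : ∃ A : ℝ, 0 < A ∧ ∑' x, D x ^ μ ≤ ENNReal.ofReal A := by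
    refine ⟨(∑' x, D x ^ μ).toReal + 1, by positivity, ?_⟩
    rw [ENNReal.ofReal_add ENNReal.toReal_nonneg zero_le_one, ENNReal.ofReal_toReal h.ne]
    exact le_self_add
  have hnorm : ∀ v, MemLp v 2 S.area → S.sobolevNorm s' v ≤ C * (eLpNorm (W.proj v) 2 S.area +
      (∑' x : WI, ((2 : ℝ≥0∞) ^ (s' * (x.1.1 : ℕ)) * ‖W.coeff v x.1.1 x.1.2‖ₑ) ^ 2)
        ^ (1 / 2 : ℝ)) := by
    intro v hv
    refine (hC v hv).2.trans_eq ?_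
    rw [sobolevSeqNorm, tsum_level_eq fun j ξ => (2 : ℝ≥0∞) ^ (2 * s' * (j : ℕ)) * ‖W.coeff v j ξ‖ₑ ^ 2]
    congr 5
    funext x
    rw [mul_pow, ← ENNReal.rpow_natCast (2 ^ _), ← ENNReal.rpow_mul]
    congr 2
    push_cast; ring
  have hproj : ∀ v : E3 → ℂ, (∀ g, S.pairing v (W.genDual g) = 0) → eLpNorm (W.proj v) 2 S.area = 0 := by
    intro v hv
    have : W.proj v = 0 := by funext x; simp [proj, hv]
    rw [this, eLpNorm_zero]
  set G := Fintype.card W.Gen with hG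
  set gens : Finset W.Idx := Finset.univ.map Function.Embedding.inl with hgens
  have hkey : ∀ n : ℕ, 1 ≤ n → bestNTerm W.primal (S.sobolevNorm s') u (G + n) ≤
      ENNReal.ofReal (C * A ^ (1 / μ) * (n : ℝ) ^ (1 / 2 - 1 / μ)) := by
    intro n hn
    have hn0 : (0 : ℝ) < n := by exact_mod_cast hn
    obtain ⟨Λ, hΛ, hsum⟩ := ENNReal.exists_finset_tsum_sq_le D hμ hμ2 hA0 hA hn
    set Λ' : Finset W.Idx := gens ∪ Λ.map Function.Embedding.inr with hΛ'
    have hcard : Λ'.card ≤ G + n := by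
      refine (Finset.card_union_le _ _).trans ?_
      rw [Finset.card_map, Finset.card_map, Finset.card_univ]
      omega
    refine (bestNTerm_le_of_card_le _ _ u Λ' hcard fun a => S.pairing u (W.dual a)).trans ?_
    set v : E3 → ℂ := fun x => u x - ∑ a ∈ Λ', S.pairing u (W.dual a) * W.primal a x with hv
    have hvL : MemLp v 2 S.area :=
      hu.sub (memLp_finsetSum Λ' fun a _ => (hW.riesz_primal.1 a).const_mul _)
    have hvp := hW.pairing_sub_sum hm hu Λ'
    refine (hnorm v hvL).trans ?_
    rw [hproj v fun g => (hvp (Sum.inl g)).trans (if_pos (by simp [hΛ', hgens])), zero_add]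
    have hco : ∀ x : WI, (2 : ℝ≥0∞) ^ (s' * (x.1.1 : ℕ)) * ‖W.coeff v x.1.1 x.1.2‖ₑ =
        if x ∈ Λ then 0 else D x := by
      intro x
      have h1 : W.coeff v x.1.1 x.1.2 = if x ∈ Λ then 0 else W.coeff u x.1.1 x.1.2 := by
        refine (hvp (Sum.inr x)).trans ?_
        have : (Sum.inr x : W.Idx) ∈ Λ' ↔ x ∈ Λ := by simp [hΛ', hgens]
        simp only [this]
        rfl
      rw [h1]
      split_ifs <;> simp [hD]
    simp_rw [hco]
    calc (C : ℝ≥0∞) * (∑' x : WI, (if x ∈ Λ then 0 else D x) ^ 2) ^ (1 / 2 : ℝ)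
        ≤ C * (ENNReal.ofReal (A ^ (2 / μ) * n ^ (1 - 2 / μ))) ^ (1 / 2 : ℝ) := by gcongr
      _ = _ := by
          rw [ENNReal.ofReal_rpow_of_nonneg (by positivity) (by norm_num),
            ← ENNReal.ofReal_coe_nnreal, ← ENNReal.ofReal_mul (by positivity),
            Real.mul_rpow (by positivity) (by positivity), ← Real.rpow_mul hA0.le,
            ← Real.rpow_mul hn0.le, mul_assoc]
          congr 4 <;> ring_nf
  have hfin : S.sobolevNorm s' u < ⊤ := by
    have h2 : ∑' x, D x ^ (2 : ℝ) < ⊤ := ENNReal.tsum_rpow_lt_top_of_le hμ hμ2 h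
    refine (hnorm u hu).trans_lt (ENNReal.mul_lt_top (by simp) (ENNReal.add_lt_top.2 ⟨?_, ?_⟩))
    · have := hW.eLpNorm_proj_lt_top (τ := 2) le_rfl u
      rwa [ENNReal.ofReal_ofNat] at this
    · refine ENNReal.rpow_lt_top_of_nonneg (by norm_num) (ne_of_lt ?_)
      simpa only [ENNReal.rpow_ofNat] using h2
  set E := (S.sobolevNorm s' u).toReal with hE
  have hE0 : 0 ≤ E := ENNReal.toReal_nonneg
  -- The `G` generators use up part of the budget. For `n ≤ 2 G` the first summand makes the bound
  -- at least `E`, the norm of `u`, and the zero approximant suffices. For larger `n` at least `n /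
  -- 2` terms remain for wavelets, which costs the factor in the second summand.
  refine ⟨E * ((2 * G + 1 : ℕ) : ℝ) ^ (1 / μ - 1 / 2) + C * A ^ (1 / μ) * 2 ^ (1 / μ - 1 / 2),
    by positivity, fun n hn => ?_⟩
  have hn0 : (0 : ℝ) < n := by exact_mod_cast hn
  have hscale : ∀ c : ℝ, 0 < c → c ^ (1 / μ - 1 / 2) * (n : ℝ) ^ (1 / 2 - 1 / μ) =
      (n / c) ^ (1 / 2 - 1 / μ) := fun c hc => by
    rw [Real.div_rpow hn0.le hc.le, ← neg_sub (1 / 2) (1 / μ), Real.rpow_neg hc.le]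
    ring
  rw [add_mul, mul_assoc E, mul_assoc (C * A ^ (1 / μ)), hscale _ (by positivity),
    hscale _ (by positivity)]
  rcases le_or_gt n (2 * G) with hnG | hnG
  · refine (bestNTerm_le_of_card_le _ _ u ∅ (by simp) 0).trans ?_
    simp only [Finset.sum_empty, sub_zero]
    rw [← ENNReal.ofReal_toReal hfin.ne]
    refine ENNReal.ofReal_le_ofReal ?_
    have h1 : (1 : ℝ) ≤ (n / (2 * G + 1 : ℕ) : ℝ) ^ (1 / 2 - 1 / μ) := by
      refine Real.one_le_rpow_of_pos_of_le_one_of_nonpos (by positivity) ?_ hexp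
      rw [div_le_one (by positivity)]
      exact_mod_cast hnG.trans (Nat.le_succ _)
    have h2 : 0 ≤ C * A ^ (1 / μ) * ((n : ℝ) / 2) ^ (1 / 2 - 1 / μ) := by positivity
    have h3 : E * 1 ≤ E * (n / (2 * G + 1 : ℕ) : ℝ) ^ (1 / 2 - 1 / μ) := by gcongr
    rw [← hE]
    linarith
  · obtain ⟨l, rfl⟩ : ∃ l, n = G + l := ⟨n - G, by omega⟩
    refine (hkey l (by omega)).trans (ENNReal.ofReal_le_ofReal ?_)
    have h1 : (((G + l : ℕ) : ℝ) / 2) ≤ l := by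
      rw [div_le_iff₀ two_pos]
      have : G + l ≤ l * 2 := by omega
      exact_mod_cast this
    have h2 : (l : ℝ) ^ (1 / 2 - 1 / μ) ≤ (((G + l : ℕ) : ℝ) / 2) ^ (1 / 2 - 1 / μ) :=
      Real.rpow_le_rpow_of_nonpos (by positivity) h1 hexp
    have h3 : 0 ≤ E * ((((G + l : ℕ) : ℝ) / (2 * G + 1 : ℕ))) ^ (1 / 2 - 1 / μ) := by positivity
    have h4 : C * A ^ (1 / μ) * (l : ℝ) ^ (1 / 2 - 1 / μ) ≤
      C * A ^ (1 / μ) * (((G + l : ℕ) : ℝ) / 2) ^ (1 / 2 - 1 / μ) := by gcongr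
    linarith

end IsWaveletBasis

end PolySurface.WaveletSystem

/-! ### From summable coefficients to Besov regularity; interpolation -/

namespace PolySurface.WaveletSystem

variable {m : ℕ} {S : PolySurface m} {W : S.WaveletSystem}

/-- The level exponent `α + 2(1/2 - 1/τ)` is zero on this line. The projection is in `L_τ` because
it is in `L₂`, `τ ≤ 2` and the area is finite. -/
theorem mem_besov_of_tsum_lt_top {d : ℕ} {sΓ : ℝ} (hW : W.IsWaveletBasis d sΓ) {α τ : ℝ}
    (hα : 0 ≤ α) (hτ : 1 / τ = α / 2 + 1 / 2) {u : E3 → ℂ} (hu : MemLp u 2 S.area)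
    (h : ∑' j : Ici W.jstar, ∑ ξ ∈ W.level j, ‖W.coeff u j ξ‖ₑ ^ τ < ⊤) :
    u ∈ W.besov α τ (ENNReal.ofReal τ) := by
  have hτ0 : 0 < τ := by rw [← one_div_pos, hτ]; positivity
  have hτ2 : τ ≤ 2 := by
    rw [← one_div_le_one_div two_pos hτ0]; linarith
  have he : α + 2 * (1 / 2 - 1 / τ) = 0 := by rw [hτ]; ring
  refine ⟨hu, ?_⟩
  rw [besovNorm, if_neg ENNReal.ofReal_ne_top, ENNReal.toReal_ofReal hτ0.le, div_self hτ0.ne']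
  refine ENNReal.add_lt_top.2 ⟨hW.eLpNorm_proj_lt_top hτ2 u,
    ENNReal.rpow_lt_top_of_nonneg (by positivity) (ne_of_lt ?_)⟩
  simpa only [he, mul_zero, zero_mul, ENNReal.rpow_zero, one_mul, ENNReal.rpow_one] using h

/-- Interpolation between the two summability properties of the coefficients. -/
theorem tsum_interpolated_lt_top {σ p τ Θ μ : ℝ} (hp : 0 < p) (hτ : 0 < τ) (hμ : 0 < μ)
    (hΘ : Θ ∈ Icc (0 : ℝ) 1) (hΘμ : 1 / μ = (1 - Θ) / p + Θ / τ) {u : E3 → ℂ}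
    (h₁ : ∑' j : Ici W.jstar, (2 : ℝ≥0∞) ^ ((j : ℕ) * σ * p) *
      ∑ ξ ∈ W.level j, ‖W.coeff u j ξ‖ₑ ^ p < ⊤)
    (h₂ : ∑' j : Ici W.jstar, ∑ ξ ∈ W.level j, ‖W.coeff u j ξ‖ₑ ^ τ < ⊤) :
    ∑' x : {x : ℕ × W.Grid // W.jstar ≤ x.1 ∧ x.2 ∈ W.level x.1},
      ((2 : ℝ≥0∞) ^ ((1 - Θ) * σ * (x.1.1 : ℕ)) * ‖W.coeff u x.1.1 x.1.2‖ₑ) ^ μ < ⊤ := by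
  have hΘ0 : 0 ≤ 1 - Θ := sub_nonneg.2 hΘ.2
  have ha : 0 ≤ (1 - Θ) * μ / p := by positivity
  have hb : 0 ≤ Θ * μ / τ := div_nonneg (mul_nonneg hΘ.1 hμ.le) hτ.le
  -- The relation between `μ`, `p` and `τ` says precisely that these are complementary Hölder
  -- exponents.
  have hab : (1 - Θ) * μ / p + Θ * μ / τ = 1 := by
    have : (1 - Θ) * μ / p + Θ * μ / τ = μ * (1 / μ) := by rw [hΘμ]; ring
    rw [this, mul_one_div_cancel hμ.ne']
  simp only [Finset.mul_sum] at h₁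
  rw [tsum_level_eq fun j ξ => (2 : ℝ≥0∞) ^ ((j : ℕ) * σ * p) * ‖W.coeff u j ξ‖ₑ ^ p] at h₁
  rw [tsum_level_eq fun j ξ => ‖W.coeff u j ξ‖ₑ ^ τ] at h₂
  refine lt_of_le_of_lt (le_trans (le_of_eq (tsum_congr fun x => ?_))
    (ENNReal.tsum_rpow_mul_rpow_le _ _ ha hb hab))
    (ENNReal.mul_lt_top (ENNReal.rpow_lt_top_of_nonneg ha h₁.ne)
      (ENNReal.rpow_lt_top_of_nonneg hb h₂.ne))
  rw [ENNReal.mul_rpow_of_nonneg _ _ hμ.le, ENNReal.mul_rpow_of_nonneg _ _ ha,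
    ← ENNReal.rpow_mul, ← ENNReal.rpow_mul, ← ENNReal.rpow_mul, ← ENNReal.rpow_mul,
    mul_assoc ((2 : ℝ≥0∞) ^ ((x.1.1 : ℝ) * σ * p * ((1 - Θ) * μ / p))),
    ← ENNReal.rpow_add_of_nonneg _ _ (by positivity) (by positivity)]
  have h1 : p * ((1 - Θ) * μ / p) + τ * (Θ * μ / τ) = μ := by field_simp; ring
  have h2 : (x.1.1 : ℝ) * σ * p * ((1 - Θ) * μ / p) = (1 - Θ) * σ * (x.1.1 : ℝ) * μ := by
    field_simp
  rw [h1, h2]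

end PolySurface.WaveletSystem

end

/-! ### The main theorem -/

theorem mainTheorem2 (d : ℕ) (S : PolySurface d) (R : S.SpecialResolution)
    (sΓ : ℝ) (hsΓ : 1 ≤ sΓ) (W : S.WaveletSystem) (hW : W.IsWaveletBasis d sΓ)
    (k : ℕ) (hk : 1 ≤ k) (hkd : k ≤ d) (ρ : ℝ) (hρ : 0 < ρ) (hρk : ρ < k)
    (s p : ℝ) (hs : 0 < s) (hadm : Admissible s p (ENNReal.ofReal p))
    (T : (E3 → ℂ) → (E3 → ℂ)) (g u : E3 → ℂ) (hsol : T u =ᵐ[S.area] g)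
    (huB : u ∈ W.besov s p (ENNReal.ofReal p)) (huX : u ∈ R.weightedSobolev k ρ)
    (αs : ℝ) (hαs : αs = min (min ρ (k - ρ)) (s - (1 / p - 1 / 2))) :
    (∀ α τ : ℝ, 1 / τ = α / 2 + 1 / 2 → 0 ≤ α → α < 2 * αs →
      Admissible α τ (ENNReal.ofReal τ) ∧ u ∈ W.besov α τ (ENNReal.ofReal τ)) ∧
    (∀ s' : ℝ, 0 ≤ s' → s' < min (3 / 2) sΓ → 2 * (1 / p - 1 / 2) ≤ s - s' →
      ∀ Θ γs : ℝ, Θ = 1 - s' / (s - 2 * (1 / p - 1 / 2)) → γs = s - s' + Θ * (2 * αs - s) →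
        Θ ∈ Set.Icc (0 : ℝ) 1 ∧ 0 ≤ γs ∧
        ∀ γ : ℝ, γ < γs → ∃ C : ℝ, ∀ n : ℕ, 1 ≤ n →
          bestNTerm W.primal (S.sobolevNorm s') u n ≤ ENNReal.ofReal (C * (n : ℝ) ^ (-γ / 2))) := by
  have hu : MemLp u 2 S.area := huB.1
  have hαρ : αs ≤ ρ := hαs ▸ (min_le_left _ _).trans (min_le_left _ _)
  have hαk : αs ≤ k - ρ := hαs ▸ (min_le_left _ _).trans (min_le_right _ _)
  have hα₁ : αs ≤ s - (1 / p - 1 / 2) := hαs ▸ min_le_right _ _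
  -- Admissibility gives `1/p - 1/2 ≤ s/2`, so the last entry of the minimum is at least `s/2`.
  have hα₀ : 0 < αs := by
    rw [hαs]
    exact lt_min (lt_min hρ (by linarith)) (by linarith [hadm.2.1])
  have hp : 0 < p := by rw [← one_div_pos]; linarith [hadm.1]
  have hsum : ∀ α τ : ℝ, 1 / τ = α / 2 + 1 / 2 → 0 ≤ α → α < 2 * αs →
      ∑' j : Ici W.jstar, ∑ ξ ∈ W.level j, ‖W.coeff u j ξ‖ₑ ^ τ < ⊤ := fun α τ hτ h0 h1 =>
    hW.tsum_coeff_lt_top hk hkd hkd hρ hρk hadm huB huX h0 hτ (by linarith) (by linarith)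
      (by linarith)
  refine ⟨fun α τ hτ h0 h1 => ⟨admissible_of_one_div_eq h0 hτ,
    PolySurface.WaveletSystem.mem_besov_of_tsum_lt_top hW h0 hτ hu (hsum α τ hτ h0 h1)⟩, ?_⟩
  intro s' hs' hs'2 hss' Θ γs hΘ hγs
  set P : ℝ := 1 / p - 1 / 2 with hP
  have hP0 : 0 ≤ P := by linarith [hadm.1]
  have hσ : s + 2 * (1 / 2 - 1 / p) = s - 2 * P := by rw [hP]; ring
  have hσs : s' ≤ s - 2 * P := by linarith
  have hΘmem : Θ ∈ Icc (0 : ℝ) 1 := by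
    rw [hΘ, sub_mem_Icc_iff_right, sub_zero, sub_self]
    exact ⟨div_nonneg hs' (by linarith), div_le_one_of_le₀ hσs (by linarith)⟩
  -- If `s - 2 P = 0`, then `s' = 0`, the quotient is zero by convention, and `Θ = 1`.
  have hs'eq : s' = (1 - Θ) * (s - 2 * P) := by
    rw [hΘ, sub_sub_cancel]
    rcases eq_or_ne (s - 2 * P) 0 with h | h
    · rw [h, mul_zero]; linarith
    · rw [div_mul_cancel₀ _ h]
  have hΘ0 : 0 ≤ 1 - Θ := sub_nonneg.2 hΘmem.2
  have hγeq : γs = (1 - Θ) * (2 * P) + Θ * (2 * αs) := by rw [hγs, hs'eq]; ring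
  refine ⟨hΘmem, ?_, fun γ hγ => ?_⟩
  · rw [hγeq]
    have := hΘmem.1
    positivity
  -- `γ*` is the value of the affine function on the right at `α = 2 α*`. For `Θ > 0` a smaller `α`
  -- still reaches `γ`, and the maximum with zero covers small or negative `γ`; for `Θ = 0` the
  -- choice of `α` is irrelevant.
  obtain ⟨α, hα0, hα2, hγα⟩ : ∃ α : ℝ, 0 ≤ α ∧ α < 2 * αs ∧ γ ≤ (1 - Θ) * (2 * P) + Θ * α := by
    rcases hΘmem.1.eq_or_lt with h | h
    · refine ⟨0, le_rfl, by linarith, ?_⟩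
      rw [hγeq, ← h] at hγ
      rw [← h]
      linarith
    · refine ⟨max 0 ((γ - (1 - Θ) * (2 * P)) / Θ), le_max_left _ _, max_lt (by linarith) ?_, ?_⟩
      · rw [div_lt_iff₀ h]; linarith
      · have := mul_le_mul_of_nonneg_left (le_max_right 0 ((γ - (1 - Θ) * (2 * P)) / Θ)) h.le
        rw [mul_div_cancel₀ _ h.ne'] at this
        linarith
  set τ : ℝ := 1 / (α / 2 + 1 / 2) with hτ
  have hτ0 : 0 < τ := by positivity
  have hτ' : 1 / τ = α / 2 + 1 / 2 := one_div_one_div _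
  have hμ0 : 1 / 2 ≤ (1 - Θ) / p + Θ / τ := by
    have h1 : (1 - Θ) / p + Θ / τ = 1 / 2 + ((1 - Θ) * P + Θ * (α / 2)) := by
      rw [div_eq_mul_one_div (1 - Θ), div_eq_mul_one_div Θ, hτ', hP]; ring
    have := hΘmem.1
    rw [h1, le_add_iff_nonneg_right]
    positivity
  set μ : ℝ := 1 / ((1 - Θ) / p + Θ / τ) with hμ
  have hμpos : 0 < μ := one_div_pos.2 (by linarith)
  have hμ' : 1 / μ = (1 - Θ) / p + Θ / τ := one_div_one_div _
  have hμ2 : μ ≤ 2 := by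
    rw [← one_div_le_one_div two_pos hμpos, hμ']; exact hμ0
  have h₁ := PolySurface.WaveletSystem.tsum_weighted_coeff_lt_top hp huB
  rw [hσ] at h₁
  have h₃ := PolySurface.WaveletSystem.tsum_interpolated_lt_top hp hτ0 hμpos hΘmem hμ' h₁
    (hsum α τ hτ' hα0 hα2)
  rw [← hs'eq] at h₃
  obtain ⟨C, hC0, hC⟩ := hW.exists_bestNTerm_le (hk.trans hkd) hs' hs'2 hu hμpos hμ2 h₃
  refine ⟨C, fun n hn => (hC n hn).trans (ENNReal.ofReal_le_ofReal ?_)⟩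
  refine mul_le_mul_of_nonneg_left (Real.rpow_le_rpow_of_exponent_le (by exact_mod_cast hn) ?_) hC0
  -- So the rate `1/μ - 1/2` is half of the value by which `α` was chosen to dominate `γ`.
  have h1 : 1 / μ = 1 / 2 + ((1 - Θ) * P + Θ * (α / 2)) := by
    rw [hμ', div_eq_mul_one_div (1 - Θ), div_eq_mul_one_div Θ, hτ', hP]; ring
  rw [h1]
  linarith
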